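/- Let $n\ge 3$ and $r>0$. For $0\le k\le N$ let $\langle x,x\rangle_{N,k}=-x_1^2-\dots-x_k^2+x_{k+1}^2+\dots+x_N^2$ on $\mathbb R^N$, and let $\Delta_{N,k}$ (for $k<N$) be the complex spinor module of dimension $2^{[N/2]}$ of the Clifford algebra of $(\mathbb R^N,-\langle\cdot,\cdot\rangle_{N,k})$ (convention $x\cdot x=-\langle x,x\rangle$). For $N=2m$ let $\Delta^{\pm}_{N,k}$ be its half-spinor modules, i.e. the eigenspaces of $e_1\cdots e_{N}$ for the eigenvalues $\pm i^{m+k}$. Let $$S^n_1(r)=\{x\in\mathbb R^{n+1}\mid\langle x,x\rangle_{n+1,1}=r^2\},\qquad H^n_1(r)=\{x\in\mathbb R^{n+1}\mid\langle x,x\rangle_{n+1,2}=-r^2\}$$ with the induced Lorentzian metrics, oriented by the unit normal $x/r$ and with the spin structure induced from the ambient space. Write $F$ for either of them and put $k=1$ for $F=S^n_1(r)$ and $k=2$ for $F=H^n_1(r)$. A smooth section $\varphi$ of the spinor bundle $S_F$ is a twistor spinor if $\nabla^S\varphi$, regarded as a section of $TF\otimes S_F$ by means of the metric, has zero projection onto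 the kernel of the Clifford multiplication. Let $\Delta'=\Delta_{n+1,k}$ if $n$ is even and $\Delta'=\Delta^+_{n+1,k}$ if $n$ is odd. The modules $\Delta'$ and $\Delta_{n,1}$ are isomorphic as $\mathrm{Spin}(n,1)$-modules, and each such isomorphism identifies $S_F$ with the restriction to $F$ of the trivial bundle with fibre $\Delta'$. With respect to each of these identifications, the set of all twistor spinors on $F$ is $$\mathcal T(F)=\{\psi_{u,v}|_F\mid u,v\in\Delta_{n+1,k}\}\quad\text{if } n \text{ is even},$$ $$\mathcal T(F)=\{\psi_{u,v}|_F\mid u\in\Delta^+_{n+1,k},\ v\in\Delta^-_{n+1,k}\}\quad\text{if } n \text{ is odd},$$ where $\psi_{u,v}(x)=u+x\cdot v$. -/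

import Mathlib

open scoped ContDiff

namespace LorentzTwistor

noncomputable section

/-! ### Pseudo-Euclidean space and its Clifford algebra -/

/-- `ℝ^N` as a vector space; the scalar products are given below. -/
abbrev Vec (N : ℕ) : Type := Fin N → ℝ

/-- The sign `ε_j`: the first `k` basis vectors are timelike, the others spacelike. -/
def eps (k : ℕ) {N : ℕ} (j : Fin N) : ℝ := if (j : ℕ) < k then -1 else 1

/-- The scalar product of index `k`:
`⟨x,y⟩ = -x₁y₁ - … - x_k y_k + x_{k+1}y_{k+1} + … + x_N y_N`. -/
def sp (k : ℕ) {N : ℕ} (x y : Vec N) : ℝ := ∑ j, eps k j * x j * y j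

/-- The quadratic form `x ↦ -⟨x,x⟩`. -/
def cliffForm (N k : ℕ) : QuadraticForm ℝ (Vec N) :=
  QuadraticMap.weightedSumSquares ℝ (fun j : Fin N => -eps k j)

/-- The real Clifford algebra of `(ℝ^N, -⟨·,·⟩)`. -/
abbrev Cliff (N k : ℕ) : Type := CliffordAlgebra (cliffForm N k)

/-- The canonical embedding of vectors into the Clifford algebra. -/
abbrev vec (N k : ℕ) : Vec N →ₗ[ℝ] Cliff N k := CliffordAlgebra.ι (cliffForm N k)

/-- The canonical basis vector `e_j`. -/
def e {N : ℕ} (j : Fin N) : Vec N := Pi.single j 1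

/-- The group `Spin(N,k)` of all products of an even number of vectors `x` with `⟨x,x⟩ = ±1`
(it covers the whole of `SO(N,k)`, not only the identity component). -/
def Spin (N k : ℕ) : Subgroup (Cliff N k)ˣ :=
  Subgroup.closure {g | ∃ x y : Vec N, |sp k x x| = 1 ∧ |sp k y y| = 1 ∧
    (g : Cliff N k) = vec N k x * vec N k y}

/-! ### The spinor representation -/

/-- The spinor module `Δ_{N,k} = ℂ² ⊗ … ⊗ ℂ²` with `⌊N/2⌋` factors, which are numbered from the
right, beginning with `0`. -/
abbrev Spinor (N : ℕ) : Type := (Fin (N / 2) → Fin 2) → ℂ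

/-- Matrices acting on `Δ_{N,k}`. -/
abbrev SpinorMat (N : ℕ) : Type := Matrix (Fin (N / 2) → Fin 2) (Fin (N / 2) → Fin 2) ℂ

/-- The Kronecker product `M_{m-1} ⊗ … ⊗ M_1 ⊗ M_0` of `2 × 2` matrices. -/
def kron {m : ℕ} (M : Fin m → Matrix (Fin 2) (Fin 2) ℂ) :
    Matrix (Fin m → Fin 2) (Fin m → Fin 2) ℂ :=
  Matrix.of fun a b => ∏ l, M l (a l) (b l)

def matU : Matrix (Fin 2) (Fin 2) ℂ := !![Complex.I, 0; 0, -Complex.I]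
def matV : Matrix (Fin 2) (Fin 2) ℂ := !![0, Complex.I; Complex.I, 0]
def matT : Matrix (Fin 2) (Fin 2) ℂ := !![0, -Complex.I; Complex.I, 0]

/-- `τ_j = i` for timelike and `1` for spacelike `e_j`. -/
def tau (k : ℕ) {N : ℕ} (j : Fin N) : ℂ := if (j : ℕ) < k then Complex.I else 1

/-- The tensor factor number `l` of the matrix of the basis vector number `j` (both counted
from `0`): `T` to the right of the place `j / 2`, `U` or `V` at this place and the identity to
the left of it. -/
def factor (j l : ℕ) : Matrix (Fin 2) (Fin 2) ℂ :=
  if l < j / 2 then matT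
  else if l = j / 2 then (if j % 2 = 0 then matU else matV) else 1

/-- The matrix of the basis vector number `j`. For odd `N` the last basis vector acts as
`τ_N · i · T ⊗ … ⊗ T` (the first of the two irreducible representations). -/
def gamma (N k : ℕ) (j : Fin N) : SpinorMat N :=
  (tau k j * if (j : ℕ) / 2 < N / 2 then 1 else Complex.I) •
    kron fun l : Fin (N / 2) => factor j l

theorem kron_mul {m : ℕ} (A B : Fin m → Matrix (Fin 2) (Fin 2) ℂ) :
    kron A * kron B = kron fun l => A l * B l := by
  ext a b
  simp only [kron, Matrix.mul_apply, Matrix.of_apply, ← Finset.prod_mul_distrib]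
  exact (Fintype.prod_sum fun l c => A l (a l) c * B l c (b l)).symm

theorem kron_one {m : ℕ} : kron (fun _ : Fin m => 1) = 1 := by
  ext a b
  simp only [kron, Matrix.of_apply, Matrix.one_apply]
  by_cases h : a = b
  · simp [h]
  · obtain ⟨l, hl⟩ := Function.ne_iff.mp h
    rw [if_neg h]
    exact Finset.prod_eq_zero (Finset.mem_univ l) (if_neg hl)

theorem kron_neg {m : ℕ} (A B : Fin m → Matrix (Fin 2) (Fin 2) ℂ) (l₀ : Fin m)
    (h₀ : A l₀ = -B l₀) (h : ∀ l, l ≠ l₀ → A l = B l) : kron A = -kron B := by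
  ext a b
  simp only [kron, Matrix.of_apply, Matrix.neg_apply]
  rw [← Finset.mul_prod_erase _ _ (Finset.mem_univ l₀),
    ← Finset.mul_prod_erase (a := l₀) _ (fun l => B l (a l) (b l)) (Finset.mem_univ l₀), h₀,
    Matrix.neg_apply, neg_mul]
  congr 2
  exact Finset.prod_congr rfl fun l hl => by rw [h l (Finset.ne_of_mem_erase hl)]

theorem matU_sq : matU * matU = -1 := by
  ext i j; fin_cases i <;> fin_cases j <;> simp [matU, Matrix.mul_apply]
theorem matV_sq : matV * matV = -1 := by
  ext i j; fin_cases i <;> fin_cases j <;> simp [matV, Matrix.mul_apply]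
theorem matT_sq : matT * matT = 1 := by
  ext i j; fin_cases i <;> fin_cases j <;> simp [matT, Matrix.mul_apply]
theorem matUV : matU * matV = -(matV * matU) := by
  ext i j; fin_cases i <;> fin_cases j <;> simp [matU, matV, Matrix.mul_apply]
theorem matUT : matU * matT = -(matT * matU) := by
  ext i j; fin_cases i <;> fin_cases j <;> simp [matU, matT, Matrix.mul_apply]
theorem matVT : matV * matT = -(matT * matV) := by
  ext i j; fin_cases i <;> fin_cases j <;> simp [matV, matT, Matrix.mul_apply]

theorem gamma_anticomm_of_lt (N k : ℕ) (i j : Fin N) (hij : i < j) :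
    gamma N k i * gamma N k j = -(gamma N k j * gamma N k i) := by
  have hij' : (i : ℕ) < j := hij
  have hj := j.isLt
  have hi2 : (i : ℕ) / 2 < N / 2 := by omega
  simp only [gamma, smul_mul_assoc, mul_smul_comm, kron_mul]
  rw [kron_neg (fun l : Fin (N / 2) => factor i l * factor j l)
    (fun l : Fin (N / 2) => factor j l * factor i l) ⟨(i : ℕ) / 2, hi2⟩, smul_comm]
  · simp
  · rcases (Nat.div_le_div_right hij'.le : (i : ℕ) / 2 ≤ (j : ℕ) / 2).eq_or_lt with h | h
    · have h0 : (i : ℕ) % 2 = 0 := by omega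
      have h1 : ¬ ((j : ℕ) % 2 = 0) := by omega
      simpa [factor, h, h0, h1] using matUV
    · by_cases h0 : (i : ℕ) % 2 = 0
      · simpa [factor, h, h0] using matUT
      · simpa [factor, h, h0] using matVT
  · intro l hl
    have hl' : (l : ℕ) ≠ (i : ℕ) / 2 := fun h => hl (Fin.ext h)
    by_cases h1 : (l : ℕ) < (i : ℕ) / 2
    · have h2 : (l : ℕ) < (j : ℕ) / 2 := by omega
      simp [factor, h1, h2]
    · simp [factor, h1, hl']

theorem gamma_sq (N k : ℕ) (j : Fin N) :
    gamma N k j * gamma N k j = algebraMap ℝ (SpinorMat N) (-eps k j) := by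
  have hj := j.isLt
  simp only [gamma, smul_mul_assoc, mul_smul_comm, kron_mul, smul_smul]
  by_cases h : (j : ℕ) / 2 < N / 2
  · rw [kron_neg _ (fun _ => 1) ⟨(j : ℕ) / 2, h⟩, kron_one, Algebra.algebraMap_eq_smul_one]
    · by_cases hk : (j : ℕ) < k <;> simp [tau, eps, h, hk]
    · by_cases h0 : (j : ℕ) % 2 = 0
      · simpa [factor, h0] using matU_sq
      · simpa [factor, h0] using matV_sq
    · intro l hl
      have hl' : (l : ℕ) ≠ (j : ℕ) / 2 := fun h => hl (Fin.ext h)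
      by_cases h1 : (l : ℕ) < (j : ℕ) / 2
      · simp [factor, h1, matT_sq]
      · simp [factor, h1, hl']
  · have : (fun l : Fin (N / 2) => factor j l * factor j l) = fun _ => 1 := by
      funext l
      have h1 : (l : ℕ) < (j : ℕ) / 2 := by omega
      simp [factor, h1, matT_sq]
    rw [this, kron_one, Algebra.algebraMap_eq_smul_one]
    by_cases hk : (j : ℕ) < k <;> simp [tau, eps, h, hk]

/-- Clifford multiplication by a vector, as a matrix. -/
def gammaVec (N k : ℕ) : Vec N →ₗ[ℝ] SpinorMat N :=
  ∑ j, (LinearMap.proj j : Vec N →ₗ[ℝ] ℝ).smulRight (gamma N k j)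

theorem gammaVec_apply (N k : ℕ) (x : Vec N) : gammaVec N k x = ∑ j, x j • gamma N k j := by
  simp [gammaVec]

theorem gammaVec_sq (N k : ℕ) (x : Vec N) :
    gammaVec N k x * gammaVec N k x = algebraMap ℝ (SpinorMat N) (cliffForm N k x) := by
  have key : gammaVec N k x * gammaVec N k x + gammaVec N k x * gammaVec N k x
      = algebraMap ℝ (SpinorMat N) (cliffForm N k x)
        + algebraMap ℝ (SpinorMat N) (cliffForm N k x) := by
    have h1 : gammaVec N k x * gammaVec N k x
        = ∑ i, ∑ j, (x i * x j) • (gamma N k i * gamma N k j) := by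
      simp only [gammaVec_apply, Finset.sum_mul_sum, smul_mul_smul_comm]
    have h2 : gammaVec N k x * gammaVec N k x
        = ∑ i, ∑ j, (x i * x j) • (gamma N k j * gamma N k i) := by
      rw [h1, Finset.sum_comm]
      simp only [mul_comm]
    nth_rewrite 1 [h1]
    rw [h2, ← Finset.sum_add_distrib]
    simp only [← Finset.sum_add_distrib, ← smul_add]
    rw [← map_add, cliffForm, QuadraticMap.weightedSumSquares_apply, ← Finset.sum_add_distrib,
      map_sum]
    refine Finset.sum_congr rfl fun i _ => ?_
    rw [Finset.sum_eq_single i]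
    · rw [gamma_sq, ← map_add, Algebra.smul_def, ← map_mul]
      congr 1
      simp only [smul_eq_mul]
      ring
    · intro j _ hji
      rcases lt_or_gt_of_ne hji with h | h
      · rw [gamma_anticomm_of_lt N k j i h]; simp
      · rw [gamma_anticomm_of_lt N k i j h]; simp
    · simp
  rw [← two_smul ℝ, ← two_smul ℝ (algebraMap ℝ (SpinorMat N) _)] at key
  exact smul_right_injective _ (two_ne_zero) key

/-- The action of the Clifford algebra on spinors; its restriction to `Spin(N,k)` is the spinor
representation `Δ_{N,k}`. -/
def kappa (N k : ℕ) : Cliff N k →ₐ[ℝ] SpinorMat N :=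
  CliffordAlgebra.lift (cliffForm N k) ⟨gammaVec N k, gammaVec_sq N k⟩

/-- Clifford multiplication `x · w` of a spinor by a vector. -/
def cmul (k : ℕ) {N : ℕ} (x : Vec N) (w : Spinor N) : Spinor N :=
  (kappa N k (vec N k x)).mulVec w

/-- The volume element `e₁ · … · e_N`. -/
def volumeElement (N k : ℕ) : Cliff N k := (List.ofFn fun j : Fin N => vec N k (e j)).prod

/-- For `N = 2m`: the half spinors `Δ⁺_{N,k}` (`s = 1`) and `Δ⁻_{N,k}` (`s = -1`), that is, the
eigenspace of the volume element to the eigenvalue `s · i^{m+k}`. -/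
def halfSpinor (N k : ℕ) (s : ℂ) : Submodule ℂ (Spinor N) :=
  Module.End.eigenspace (Matrix.toLin' (kappa N k (volumeElement N k)))
    (s * Complex.I ^ (N / 2 + k))

/-! ### The two hypersurfaces and their induced spin structures -/

/-- The two families of Lorentzian space forms: `S^n_1(r)` and `H^n_1(r)`. -/
inductive SpaceForm : Type
  | pseudoSphere : SpaceForm
  | pseudoHyperbolic : SpaceForm

/-- The index of the ambient space: `S^n_1(r) ⊂ ℝ^{n+1,1}` and `H^n_1(r) ⊂ ℝ^{n+1,2}`. -/
def SpaceForm.index : SpaceForm → ℕ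
  | .pseudoSphere => 1
  | .pseudoHyperbolic => 2

/-- The sign `⟨η,η⟩` of the unit normal. -/
def SpaceForm.sign : SpaceForm → ℝ
  | .pseudoSphere => 1
  | .pseudoHyperbolic => -1

/-- The place of the unit normal in an adapted orthonormal basis `(s₁,…,s_n,η)` in the case of
the pseudo-sphere and `(η,s₁,…,s_n)` in the case of the pseudo-hyperbolic space: timelike vectors
come first. -/
def SpaceForm.pos : SpaceForm → (n : ℕ) → Fin (n + 1)
  | .pseudoSphere, n => Fin.last n
  | .pseudoHyperbolic, _ => 0

/-- `S^n_1(r) = {⟨x,x⟩ = r²}` in `ℝ^{n+1,1}` and `H^n_1(r) = {⟨x,x⟩ = -r²}` in `ℝ^{n+1,2}`. -/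
def SpaceForm.carrier (c : SpaceForm) (n : ℕ) (r : ℝ) : Set (Vec (n + 1)) :=
  {x | sp c.index x x = c.sign * r ^ 2}

/-- The Gauss map `η(x) = x / r`. -/
def gauss {n : ℕ} (r : ℝ) (x : Vec (n + 1)) : Vec (n + 1) := r⁻¹ • x

theorem eps_succAbove (c : SpaceForm) (n : ℕ) (j : Fin n) :
    eps c.index ((c.pos n).succAbove j) = eps 1 j := by
  cases c <;> simp [SpaceForm.index, SpaceForm.pos, eps]

theorem eps_pos (c : SpaceForm) (n : ℕ) (hn : 0 < n) : eps c.index (c.pos n) = c.sign := by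
  cases c
  · simp [SpaceForm.index, SpaceForm.pos, SpaceForm.sign, eps]; omega
  · simp [SpaceForm.index, SpaceForm.pos, SpaceForm.sign, eps]

/-- The isometric embedding `ℝ^{n,1} → ℝ^{n+1,k}` onto the orthogonal complement of the basis
vector at the place of the normal, in the order of the basis. -/
def inclVec (c : SpaceForm) (n : ℕ) :
    (cliffForm n 1).Isometry (cliffForm (n + 1) c.index) where
  toFun x := (c.pos n).insertNth (0 : ℝ) x
  map_add' x y := by
    ext i
    refine Fin.succAboveCases (c.pos n) ?_ (fun j => ?_) i <;> simp
  map_smul' a x := by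
    ext i
    refine Fin.succAboveCases (c.pos n) ?_ (fun j => ?_) i <;> simp
  map_app' x := by
    simp only [cliffForm, QuadraticMap.weightedSumSquares_apply]
    rw [Fin.sum_univ_succAbove _ (c.pos n)]
    simp [eps_succAbove]

/-- The induced embedding of Clifford algebras, `Cliff_{n,1} → Cliff_{n+1,k}`, which maps
`Spin(n,1)` into `Spin(n+1,k)`. -/
def inclCliff (c : SpaceForm) (n : ℕ) : Cliff n 1 →ₐ[ℝ] Cliff (n + 1) c.index :=
  CliffordAlgebra.map (inclVec c n)

/-- `λ(g) x = y`, where `λ : Spin(N,k) → SO(N,k)`, `λ(g) x = g · x · g⁻¹`, is the double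
covering. -/
def RotatesTo {N k : ℕ} (g : (Cliff N k)ˣ) (x y : Vec N) : Prop :=
  (g : Cliff N k) * vec N k x * ((g⁻¹ : (Cliff N k)ˣ) : Cliff N k) = vec N k y

/-- The total space of the induced spin structure of the hypersurface: the trivial spin structure
`ℝ^{n+1} × Spin(n+1,k)` of the ambient space, restricted to the points of the hypersurface and
reduced to those `g` whose orthonormal basis `λ(g)` contains the unit normal at its place. The
other `n` vectors of this basis form the oriented orthonormal basis of the tangent space that
lies under `(x, g)`. -/
structure SpinFrame (c : SpaceForm) (n : ℕ) (r : ℝ) where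
  pt : Vec (n + 1)
  lift : (Cliff (n + 1) c.index)ˣ
  pt_mem : pt ∈ c.carrier n r
  lift_mem : lift ∈ Spin (n + 1) c.index
  normal : RotatesTo lift (e (c.pos n)) (gauss r pt)

/-- A smooth local section of the induced spin structure, with the tangent orthonormal basis field
`(s₁,…,s_n)` under it; the domain is an open subset of the hypersurface, written as the trace of an
open set `dom`, and the values of the functions outside of it do not matter. -/
structure LocalSection (c : SpaceForm) (n : ℕ) (r : ℝ) where
  dom : Set (Vec (n + 1))
  isOpen_dom : IsOpen dom
  lift : Vec (n + 1) → (Cliff (n + 1) c.index)ˣ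
  frame : Fin n → Vec (n + 1) → Vec (n + 1)
  lift_mem : ∀ x ∈ c.carrier n r ∩ dom, lift x ∈ Spin (n + 1) c.index
  normal : ∀ x ∈ c.carrier n r ∩ dom, RotatesTo (lift x) (e (c.pos n)) (gauss r x)
  tangent : ∀ x ∈ c.carrier n r ∩ dom, ∀ j,
    RotatesTo (lift x) (e ((c.pos n).succAbove j)) (frame j x)
  smooth_lift : ∀ l : Cliff (n + 1) c.index →ₗ[ℝ] ℝ,
    ContDiffOn ℝ ∞ (fun x => l (lift x : Cliff (n + 1) c.index)) (c.carrier n r ∩ dom)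
  smooth_frame : ∀ j, ContDiffOn ℝ ∞ (frame j) (c.carrier n r ∩ dom)

/-- The value of a local section at a point of its domain. -/
def LocalSection.at {c : SpaceForm} {n : ℕ} {r : ℝ} (q : LocalSection c n r)
    (x : Vec (n + 1)) (hx : x ∈ c.carrier n r ∩ q.dom) : SpinFrame c n r :=
  ⟨x, q.lift x, hx.1, q.lift_mem x hx, q.normal x hx⟩

open Classical in
/-- The local representation of a function on the spin structure by means of a local section
(extended by `0`). -/
def LocalSection.pull {c : SpaceForm} {n : ℕ} {r : ℝ} (q : LocalSection c n r)
    (f : SpinFrame c n r → Spinor n) (x : Vec (n + 1)) : Spinor n :=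
  if hx : x ∈ c.carrier n r ∩ q.dom then f (q.at x hx) else 0

/-! ### Spinor fields, the spinor derivative and the twistor operator -/

/-- Smooth sections of the spinor bundle (spin structure `×_{Spin(n,1)} Δ_{n,1}`), as the smooth
functions `f` on the spin structure with `f(p·a) = a⁻¹ · f(p)` for `a ∈ Spin(n,1)`. -/
def IsSpinorField {c : SpaceForm} {n : ℕ} {r : ℝ} (f : SpinFrame c n r → Spinor n) : Prop :=
  (∀ p p' : SpinFrame c n r, ∀ a ∈ Spin n 1, p'.pt = p.pt →
    (p'.lift : Cliff (n + 1) c.index) = p.lift * inclCliff c n a →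
    f p' = (kappa n 1 ((a⁻¹ : (Cliff n 1)ˣ) : Cliff n 1)).mulVec (f p)) ∧
  ∀ q : LocalSection c n r, ContDiffOn ℝ ∞ (q.pull f) (c.carrier n r ∩ q.dom)

/-- The derivative of a function on the hypersurface at `x` in the direction of a tangent
vector `X`. (The derivative within a subset is unique on tangent vectors.) -/
def tderiv {c : SpaceForm} {n : ℕ} {r : ℝ} {W : Type*} [NormedAddCommGroup W] [NormedSpace ℝ W]
    (q : LocalSection c n r) (h : Vec (n + 1) → W) (x X : Vec (n + 1)) : W :=
  fderivWithin ℝ h (c.carrier n r ∩ q.dom) x X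

/-- The Levi-Civita connection `∇_X Y` of the induced metric: the tangential part of the flat
derivative of `Y`. -/
def leviCivita {c : SpaceForm} {n : ℕ} {r : ℝ} (q : LocalSection c n r)
    (Y : Vec (n + 1) → Vec (n + 1)) (x X : Vec (n + 1)) : Vec (n + 1) :=
  tderiv q Y x X - (c.sign * sp c.index (tderiv q Y x X) (gauss r x)) • gauss r x

/-- The spinor derivative `∇^S_{s_j} f`, in the local representation given by `q`:
`s_j(f) + ½ ∑_{a<b} ε_a ε_b ⟨∇_{s_j} s_a, s_b⟩ e_a · e_b · f`. -/
def spinorDeriv {c : SpaceForm} {n : ℕ} {r : ℝ} (q : LocalSection c n r)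
    (f : SpinFrame c n r → Spinor n) (x : Vec (n + 1)) (j : Fin n) : Spinor n :=
  tderiv q (q.pull f) x (q.frame j x) +
    (1 / 2 : ℝ) • ∑ a : Fin n, ∑ b ∈ Finset.Ioi a,
      (eps 1 a * eps 1 b *
        sp c.index (leviCivita q (q.frame a) x (q.frame j x)) (q.frame b x)) •
      cmul 1 (e a) (cmul 1 (e b) (q.pull f x))

/-- The Clifford multiplication `μ : T_x ⊗ S_x → S_x`, with `∑ s_j ⊗ t_j` written as `t`. -/
def cliffMul {n : ℕ} (t : Fin n → Spinor n) : Spinor n := ∑ j, cmul 1 (e j) (t j)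

/-- The projection of `T_x ⊗ S_x` onto the kernel of the Clifford multiplication,
`X ⊗ w ↦ X ⊗ w + (1/n) ∑ ε_j s_j ⊗ s_j · X · w`. -/
def projKer {n : ℕ} (t : Fin n → Spinor n) : Fin n → Spinor n :=
  fun j => t j + ((1 / n : ℝ) * eps 1 j) • cmul 1 (e j) (cliffMul t)

/-- The twistor operator `𝒟 f` at `x`: the projection of `∑ ε_j s_j ⊗ ∇^S_{s_j} f` onto the kernel
of the Clifford multiplication, in the local representation given by `q`. -/
def twistorOp {c : SpaceForm} {n : ℕ} {r : ℝ} (q : LocalSection c n r)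
    (f : SpinFrame c n r → Spinor n) (x : Vec (n + 1)) : Fin n → Spinor n :=
  projKer fun j => eps 1 j • spinorDeriv q f x j

/-- The set `𝒯` of twistor spinors: the spinor fields with `𝒟 f = 0`. -/
def twistorSpinors (c : SpaceForm) (n : ℕ) (r : ℝ) : Set (SpinFrame c n r → Spinor n) :=
  {f | IsSpinorField f ∧ ∀ q : LocalSection c n r, ∀ x ∈ c.carrier n r ∩ q.dom,
    twistorOp q f x = 0}

/-! ### Restriction of ambient spinor fields -/

/-- `i` restricts to an isomorphism of the `Spin(n,1)`-module `W ⊂ Δ_{n+1,k}` with `Δ_{n,1}`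
(the values of `i` outside of `W` do not matter). Such an isomorphism identifies the restriction
to the hypersurface of the subbundle with fibre `W` of the trivial ambient spinor bundle with the
spinor bundle of the hypersurface. -/
def IsSpinIso (c : SpaceForm) (n : ℕ) (W : Submodule ℂ (Spinor (n + 1)))
    (i : Spinor (n + 1) →ₗ[ℂ] Spinor n) : Prop :=
  Function.Bijective (i.domRestrict W) ∧
  ∀ a ∈ Spin n 1, ∀ w ∈ W,
    (kappa (n + 1) c.index (inclCliff c n a)).mulVec w ∈ W ∧
    i ((kappa (n + 1) c.index (inclCliff c n a)).mulVec w)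
      = (kappa n 1 (a : Cliff n 1)).mulVec (i w)

/-- The spinor field on the hypersurface that corresponds to the restriction of the ambient spinor
field `φ`: at the spin frame `(x, g)` it is the vector `i (g⁻¹ · φ(x))`. -/
def restrict {c : SpaceForm} {n : ℕ} {r : ℝ} (i : Spinor (n + 1) →ₗ[ℂ] Spinor n)
    (φ : Vec (n + 1) → Spinor (n + 1)) : SpinFrame c n r → Spinor n :=
  fun p => i ((kappa (n + 1) c.index
    ((p.lift⁻¹ : (Cliff (n + 1) c.index)ˣ) : Cliff (n + 1) c.index)).mulVec (φ p.pt))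

/-- `ψ_{u,v}(x) = u + x · v`. -/
def psi (k : ℕ) {N : ℕ} (u v : Spinor N) (x : Vec N) : Spinor N := u + cmul k x v

end

end LorentzTwistor

open LorentzTwistor

/-! An isomorphism of `W ⊂ Δ_{n+1,k}` with `Δ_{n,1}` turns a spinor field `f` into an ambient-valued
field on the hypersurface, `φ(x) = g · I(f(x,g))`, where `I` is the inverse isomorphism. This does
not depend on `g`: two lifts over the same point differ by an element of `Spin(n+1,k)` that fixes
the normal basis vector, and such elements come from `Spin(n,1)` (`exists_eq_inclCliff`, which rests
on the Cartan–Dieudonné theorem).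

For a local lift `g` of a frame, `g⁻¹ dg` is the bivector of the flat connection coefficients of the
frame completed by the normal (`inv_mul_liftDeriv`). The terms without the normal form the
connection form of the spinor derivative. The terms with the normal are explicit, since the
hypersurface is totally umbilic: `dη = r⁻¹ id` on tangent vectors. Hence `∇^S_{s_j} f` corresponds
to `g⁻¹ dφ(s_j)` plus `e_j` times a spinor that does not depend on `j` (`map_spinorDeriv`). The
projection onto the kernel of the Clifford multiplication annihilates precisely the tensors `∑ ε_j
s_j ⊗ s_j · χ`. So the twistor equation says that at every point there is a `χ` with `dφ(X) = X · χ`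
for all tangent `X` (`twistorOp_eq_zero_iff`).

This equation is integrated in `exists_eq_psi`. The field `χ` is smooth, and the symmetry of second
derivatives gives `X · dχ(Y) = Y · dχ(X)`. Three orthogonal non-isotropic tangent vectors, available
for `n ≥ 3`, force `dχ = 0` (`eq_zero_of_cmul_symm`). The open cone over the hypersurface is
connected, so `χ` is a constant `v`, and `φ - x · v` has vanishing derivative, so it is a constant
`u`. Conversely `ψ_{u,v}` has derivative `X · v` along `X`. Comparing the values at `x` and `-x`
shows that `u` and all `x · v` lie in `W`; for half spinors the latter means `v ∈ Δ⁻`, because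
vectors anticommute with the volume element.

The existence of the isomorphism is explicit. If the normal is the last basis vector, dropping
spinor components (`truncation`) intertwines the tangent vectors. If it is the first one, an
invertible product of Clifford elements first shifts the numbering of the basis
(`exists_intertwiner`). -/

namespace LorentzTwistor

noncomputable section

open CliffordAlgebra (involute reverse)

/-! ### Bilinear algebra of the scalar product of index `k` -/

section ScalarProduct
variable {N k : ℕ}

theorem eps_mul_self (k : ℕ) {N : ℕ} (j : Fin N) : eps k j * eps k j = 1 := by
  unfold eps; split_ifs <;> norm_num

theorem eps_ne_zero (k : ℕ) {N : ℕ} (j : Fin N) : eps k j ≠ 0 := by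
  unfold eps; split_ifs <;> norm_num

theorem abs_eps (k : ℕ) {N : ℕ} (j : Fin N) : |eps k j| = 1 := by
  unfold eps; split_ifs <;> norm_num

theorem sp_comm (x y : Vec N) : sp k x y = sp k y x := by
  unfold sp; exact Finset.sum_congr rfl fun j _ => by ring

theorem sp_add_left (x y z : Vec N) : sp k (x + y) z = sp k x z + sp k y z := by
  simp only [sp, ← Finset.sum_add_distrib]
  exact Finset.sum_congr rfl fun j _ => by simp only [Pi.add_apply]; ring

theorem sp_smul_left (a : ℝ) (x z : Vec N) : sp k (a • x) z = a * sp k x z := by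
  simp only [sp, Finset.mul_sum]
  exact Finset.sum_congr rfl fun j _ => by simp only [Pi.smul_apply, smul_eq_mul]; ring

/-- The scalar product as a bilinear map. -/
def spForm (N k : ℕ) : Vec N →ₗ[ℝ] Vec N →ₗ[ℝ] ℝ :=
  LinearMap.mk₂ ℝ (fun x y => sp k x y) sp_add_left sp_smul_left
    (fun x y z => by rw [sp_comm, sp_add_left, sp_comm y, sp_comm z])
    (fun a x y => by rw [sp_comm, sp_smul_left, sp_comm y]; rfl)

theorem spForm_apply (x y : Vec N) : spForm N k x y = sp k x y := rfl

theorem sp_add_right (x y z : Vec N) : sp k x (y + z) = sp k x y + sp k x z :=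
  map_add (spForm N k x) y z

theorem sp_smul_right (a : ℝ) (x z : Vec N) : sp k x (a • z) = a * sp k x z :=
  map_smul (spForm N k x) a z

theorem sp_neg_left (x z : Vec N) : sp k (-x) z = -sp k x z := by
  rw [← neg_one_smul ℝ, sp_smul_left]; ring

theorem sp_neg_right (x z : Vec N) : sp k x (-z) = -sp k x z :=
  map_neg (spForm N k x) z

theorem sp_sub_left (x y z : Vec N) : sp k (x - y) z = sp k x z - sp k y z := by
  rw [sub_eq_add_neg, sp_add_left, sp_neg_left]; ring

theorem sp_sub_right (x y z : Vec N) : sp k x (y - z) = sp k x y - sp k x z :=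
  map_sub (spForm N k x) y z

theorem sp_zero_left (x : Vec N) : sp k 0 x = 0 := by simp [sp]

theorem sp_e_right (x : Vec N) (j : Fin N) : sp k x (e j) = eps k j * x j := by
  simp [sp, e, Pi.single_apply]

theorem sp_e_e_self (j : Fin N) : sp k (e j) (e j) = eps k j := by
  rw [sp_e_right]; simp [e]

theorem sp_e_e_of_ne {i j : Fin N} (h : i ≠ j) : sp k (e i) (e j) = 0 := by
  rw [sp_e_right]; simp [e, h.symm]

theorem sum_smul_e (x : Vec N) : ∑ j, x j • e j = x := by
  ext i; simp [e, Pi.single_apply, Finset.sum_apply]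

theorem eq_of_sp_eq {x y : Vec N} (h : ∀ j, sp k x (e j) = sp k y (e j)) : x = y := by
  ext j
  have := h j
  rw [sp_e_right, sp_e_right] at this
  exact mul_left_cancel₀ (eps_ne_zero k j) this

theorem cliffForm_apply (x : Vec N) : cliffForm N k x = -sp k x x := by
  simp only [cliffForm, QuadraticMap.weightedSumSquares_apply, sp, ← Finset.sum_neg_distrib]
  exact Finset.sum_congr rfl fun j _ => by simp only [smul_eq_mul]; ring

end ScalarProduct

/-! ### Clifford relations, graded center and finite dimension of the Clifford algebra -/

section Clifford
variable {N k : ℕ}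

theorem vec_mul_self (x : Vec N) :
    vec N k x * vec N k x = algebraMap ℝ (Cliff N k) (-sp k x x) := by
  rw [CliffordAlgebra.ι_sq_scalar, cliffForm_apply]

theorem vec_mul_vec_add (x y : Vec N) :
    vec N k x * vec N k y + vec N k y * vec N k x = algebraMap ℝ (Cliff N k) (-2 * sp k x y) := by
  have h := vec_mul_self (k := k) (x + y)
  rw [map_add, mul_add, add_mul, add_mul, vec_mul_self, vec_mul_self, sp_add_left, sp_add_right,
    sp_add_right, sp_comm y x] at h
  have : vec N k x * vec N k y + vec N k y * vec N k x
      = algebraMap ℝ (Cliff N k) (-(sp k x x + sp k x y + (sp k x y + sp k y y)))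
        - algebraMap ℝ _ (-sp k x x) - algebraMap ℝ _ (-sp k y y) := by
    rw [← h]; abel
  rw [this, ← map_sub, ← map_sub]
  congr 1; ring

theorem vec_mul_vec_of_sp_eq_zero {x y : Vec N} (h : sp k x y = 0) :
    vec N k x * vec N k y = -(vec N k y * vec N k x) := by
  have := vec_mul_vec_add (k := k) x y
  rw [h, mul_zero, map_zero] at this
  exact eq_neg_of_add_eq_zero_left this

theorem algebraMap_cliff_injective : Function.Injective (algebraMap ℝ (Cliff N k)) :=
  FaithfulSMul.algebraMap_injective ℝ (Cliff N k)

theorem vec_injective : Function.Injective (vec N k) := by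
  intro x y h
  refine eq_of_sp_eq (k := k) fun j => ?_
  have h1 := vec_mul_vec_add (k := k) x (e j)
  rw [h, vec_mul_vec_add] at h1
  have := algebraMap_cliff_injective h1
  linarith

theorem vec_e_mul_vec_e {i j : Fin N} (h : i ≠ j) :
    vec N k (e i) * vec N k (e j) = -(vec N k (e j) * vec N k (e i)) :=
  vec_mul_vec_of_sp_eq_zero (sp_e_e_of_ne h)

theorem vec_e_mul_self (j : Fin N) :
    vec N k (e j) * vec N k (e j) = algebraMap ℝ (Cliff N k) (-eps k j) := by
  rw [vec_mul_self, sp_e_e_self]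

/-- The subalgebra generated by the basis vectors from the number `p` on. -/
def tailAlg (N k p : ℕ) : Subalgebra ℝ (Cliff N k) :=
  Algebra.adjoin ℝ {b | ∃ j : Fin N, p ≤ (j : ℕ) ∧ b = vec N k (e j)}

theorem tailAlg_zero : tailAlg N k 0 = ⊤ := by
  rw [eq_top_iff, ← CliffordAlgebra.adjoin_range_ι, Algebra.adjoin_le_iff]
  rintro _ ⟨x, rfl⟩
  rw [← sum_smul_e x, map_sum]
  refine Subalgebra.sum_mem _ fun j _ => ?_
  rw [map_smul]
  have hj : vec N k (e j) ∈ tailAlg N k 0 := Algebra.subset_adjoin ⟨j, Nat.zero_le _, rfl⟩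
  exact Subalgebra.smul_mem _ hj _

theorem tailAlg_last : tailAlg N k N = ⊥ := by
  rw [tailAlg, ← Algebra.adjoin_empty ℝ (Cliff N k)]
  congr 1
  ext b
  simp only [Set.mem_ofPred_eq, Set.mem_empty_iff_false, iff_false, not_exists, not_and]
  intro j hj
  omega

theorem tailAlg_commute {p : ℕ} {j : Fin N} (hj : (j : ℕ) < p) {b : Cliff N k}
    (hb : b ∈ tailAlg N k p) : involute b * vec N k (e j) = vec N k (e j) * b := by
  induction hb using Algebra.adjoin_induction with
  | mem x hx =>
    obtain ⟨i, hi, rfl⟩ := hx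
    rw [CliffordAlgebra.involute_ι, vec_e_mul_vec_e (i := j) (j := i) (by rintro rfl; omega),
      neg_mul]
  | algebraMap r => rw [AlgHom.commutes, Algebra.commutes]
  | add x y _ _ hx hy => rw [map_add, add_mul, hx, hy, mul_add]
  | mul x y _ _ hx hy => rw [map_mul, mul_assoc, hy, ← mul_assoc, hx, mul_assoc]

/-- The generator number `p` can be moved to the left through all later ones at the cost of signs,
and its square is a scalar. This peels off one basis vector at a time, for the graded center and for
the dimension. -/
theorem tailAlg_split {p : ℕ} (hp : p < N) {b : Cliff N k} (hb : b ∈ tailAlg N k p) :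
    ∃ a₀ ∈ tailAlg N k (p + 1), ∃ a₁ ∈ tailAlg N k (p + 1),
      b = a₀ + vec N k (e ⟨p, hp⟩) * a₁ := by
  -- Stability of the split elements under left multiplication by `b` is the stronger claim that
  -- passes through products without any computation.
  suffices h : ∀ c, (∃ a₀ ∈ tailAlg N k (p + 1), ∃ a₁ ∈ tailAlg N k (p + 1),
      c = a₀ + vec N k (e ⟨p, hp⟩) * a₁) → ∃ a₀ ∈ tailAlg N k (p + 1),
      ∃ a₁ ∈ tailAlg N k (p + 1), b * c = a₀ + vec N k (e ⟨p, hp⟩) * a₁ by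
    have := h 1 ⟨1, Subalgebra.one_mem _, 0, Subalgebra.zero_mem _, by simp⟩
    rwa [mul_one] at this
  induction hb using Algebra.adjoin_induction with
  | mem x hx =>
    rintro _ ⟨a₀, h₀, a₁, h₁, rfl⟩
    obtain ⟨i, hi, rfl⟩ := hx
    by_cases hip : (i : ℕ) = p
    · obtain rfl : i = ⟨p, hp⟩ := Fin.ext hip
      refine ⟨(-eps k ⟨p, hp⟩) • a₁, Subalgebra.smul_mem _ h₁ _, a₀, h₀, ?_⟩
      rw [mul_add, ← mul_assoc, vec_e_mul_self, Algebra.smul_def, add_comm]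
    · have hm : vec N k (e i) ∈ tailAlg N k (p + 1) :=
        Algebra.subset_adjoin ⟨i, by omega, rfl⟩
      refine ⟨vec N k (e i) * a₀, Subalgebra.mul_mem _ hm h₀, -(vec N k (e i) * a₁),
        Subalgebra.neg_mem _ (Subalgebra.mul_mem _ hm h₁), ?_⟩
      rw [mul_add, ← mul_assoc, vec_e_mul_vec_e (i := i) (j := ⟨p, hp⟩)
        (fun h => hip (by rw [h])), mul_neg, neg_mul, mul_assoc]
  | algebraMap r =>
    rintro _ ⟨a₀, h₀, a₁, h₁, rfl⟩
    refine ⟨r • a₀, Subalgebra.smul_mem _ h₀ _, r • a₁, Subalgebra.smul_mem _ h₁ _, ?_⟩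
    rw [← Algebra.smul_def, smul_add, mul_smul_comm]
  | add x y _ _ hx hy =>
    intro c hc
    obtain ⟨a₀, h₀, a₁, h₁, h⟩ := hx c hc
    obtain ⟨b₀, h₀', b₁, h₁', h'⟩ := hy c hc
    refine ⟨a₀ + b₀, Subalgebra.add_mem _ h₀ h₀', a₁ + b₁, Subalgebra.add_mem _ h₁ h₁', ?_⟩
    rw [add_mul, h, h', mul_add]; abel
  | mul x y _ _ hx hy =>
    intro c hc
    rw [mul_assoc]
    exact hx _ (hy c hc)

/-- The graded center of the Clifford algebra consists of the scalars. -/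
theorem exists_eq_algebraMap_of_graded_central {b : Cliff N k}
    (hb : ∀ j : Fin N, involute b * vec N k (e j) = vec N k (e j) * b) :
    ∃ t : ℝ, b = algebraMap ℝ (Cliff N k) t := by
  have key : ∀ p, p ≤ N → b ∈ tailAlg N k p := by
    intro p
    induction p with
    | zero => intro _; rw [tailAlg_zero]; exact Algebra.mem_top
    | succ p ih =>
      intro hp
      obtain ⟨a₀, h₀, a₁, h₁, hs⟩ := tailAlg_split (Nat.lt_of_succ_le hp) (ih (by omega))
      set E := vec N k (e ⟨p, hp⟩) with hE
      have c₀ : involute a₀ * E = E * a₀ := tailAlg_commute (j := ⟨p, hp⟩) (Nat.lt_succ_self p) h₀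
      have c₁ : involute a₁ * E = E * a₁ := tailAlg_commute (j := ⟨p, hp⟩) (Nat.lt_succ_self p) h₁
      -- Both `a₀` and `a₁` already satisfy the twisted commutation with `E`, and `E` itself is odd.
      -- What remains of the relation for `b` is `-E² a₁ = E² a₁`, hence `a₁ = 0`.
      have h := hb ⟨p, hp⟩
      rw [← hE, hs, map_add, map_mul, hE, CliffordAlgebra.involute_ι, ← hE, add_mul, mul_add, c₀,
        mul_assoc, c₁, neg_mul, ← mul_assoc, hE, vec_e_mul_self] at h
      have h2 : algebraMap ℝ (Cliff N k) (-eps k ⟨p, hp⟩) * a₁ = 0 := by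
        have h3 := add_left_cancel h
        have h4 : (2 : ℝ) • (algebraMap ℝ (Cliff N k) (-eps k ⟨p, hp⟩) * a₁) = 0 := by
          rw [two_smul]
          nth_rewrite 1 [← h3]
          exact neg_add_cancel _
        exact (smul_eq_zero.mp h4).resolve_left two_ne_zero
      rw [← Algebra.smul_def, smul_eq_zero] at h2
      rcases h2 with h2 | h2
      · exact absurd (neg_eq_zero.mp h2) (eps_ne_zero k _)
      · rw [hs, h2, mul_zero, add_zero]; exact h₀
  have := key N le_rfl
  rw [tailAlg_last, Algebra.mem_bot] at this
  obtain ⟨t, ht⟩ := this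
  exact ⟨t, ht.symm⟩

/-- Each splitting at most doubles the generators of the tail algebra, starting from the scalars.
Finite dimension is what provides a norm on the algebra and continuity of linear maps out of it. -/
instance finite_cliff : Module.Finite ℝ (Cliff N k) := by
  have key : ∀ d p, p + d = N → (Subalgebra.toSubmodule (tailAlg N k p)).FG := by
    intro d
    induction d with
    | zero =>
      rintro p hp
      obtain rfl : p = N := by omega
      rw [tailAlg_last, Algebra.toSubmodule_bot]
      rw [Submodule.one_eq_span]; exact Submodule.fg_span_singleton 1
    | succ d ih =>
      intro p hp
      have h1 := ih (p + 1) (by omega)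
      have hpN : p < N := by omega
      have h2 := h1.sup (h1.map (LinearMap.mulLeft ℝ (vec N k (e ⟨p, hpN⟩))))
      have hle : Subalgebra.toSubmodule (tailAlg N k p) ≤
          Subalgebra.toSubmodule (tailAlg N k (p + 1)) ⊔
            (Subalgebra.toSubmodule (tailAlg N k (p + 1))).map
              (LinearMap.mulLeft ℝ (vec N k (e ⟨p, hpN⟩))) := by
        intro b hb
        obtain ⟨a₀, h₀, a₁, h₁, rfl⟩ := tailAlg_split hpN hb
        exact Submodule.add_mem_sup h₀ ⟨a₁, h₁, rfl⟩
      have := Module.Finite.iff_fg.mpr h2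
      exact Module.Finite.iff_fg.mp (Submodule.finiteDimensional_of_le hle)
  have h := key N 0 (by omega)
  rw [tailAlg_zero, Algebra.top_toSubmodule] at h
  exact ⟨h⟩

end Clifford

/-! ### Unit vectors, reflections and invariants of the spin group -/

section SpinGroup
variable {N k : ℕ}

/-- The invertible element of the Clifford algebra given by a non-isotropic vector. -/
def vecUnit (x : Vec N) (hx : sp k x x ≠ 0) : (Cliff N k)ˣ where
  val := vec N k x
  inv := (-(sp k x x)⁻¹) • vec N k x
  val_inv := by
    rw [mul_smul_comm, vec_mul_self, Algebra.smul_def, ← map_mul, neg_mul_neg, inv_mul_cancel₀ hx,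
      map_one]
  inv_val := by
    rw [smul_mul_assoc, vec_mul_self, Algebra.smul_def, ← map_mul, neg_mul_neg,
      inv_mul_cancel₀ hx, map_one]

theorem ne_zero_of_abs_eq_one {a : ℝ} (h : |a| = 1) : a ≠ 0 := by
  rintro rfl; simp at h

theorem mul_self_of_abs_eq_one {a : ℝ} (h : |a| = 1) : a * a = 1 := by
  rw [← abs_mul_abs_self, h, one_mul]

theorem vecUnit_mul_mem_spin {x y : Vec N} (hx : |sp k x x| = 1) (hy : |sp k y y| = 1) :
    vecUnit x (ne_zero_of_abs_eq_one hx) * vecUnit y (ne_zero_of_abs_eq_one hy) ∈ Spin N k :=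
  Subgroup.subset_closure ⟨x, y, hx, hy, rfl⟩

/-- Reflection in the hyperplane orthogonal to a unit vector `v`. -/
def reflect (k : ℕ) {N : ℕ} (v : Vec N) : Vec N →ₗ[ℝ] Vec N :=
  LinearMap.id - (2 * sp k v v) • (spForm N k v).smulRight v

theorem reflect_apply (v x : Vec N) : reflect k v x = x - (2 * sp k v v * sp k v x) • v := by
  simp [reflect, spForm_apply, mul_smul]

/-- Conjugation by a unit vector is the negative of the reflection. The sign cancels in even
products, and the grading involution absorbs it in general. -/
theorem vec_mul_vec_eq_reflect {v : Vec N} (hv : |sp k v v| = 1) (x : Vec N) :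
    vec N k v * vec N k x = -(vec N k (reflect k v x) * vec N k v) := by
  have h := vec_mul_vec_add (k := k) v x
  rw [reflect_apply, map_sub, map_smul, sub_mul, smul_mul_assoc, vec_mul_self, Algebra.smul_def,
    ← (algebraMap ℝ (Cliff N k)).map_mul, eq_sub_of_add_eq h]
  have : 2 * sp k v v * sp k v x * -sp k v v = -2 * sp k v x := by
    linear_combination (-2 * sp k v x) * mul_self_of_abs_eq_one hv
  rw [this]; abel

theorem reflect_reflect {v : Vec N} (hv : |sp k v v| = 1) (x : Vec N) :
    reflect k v (reflect k v x) = x := by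
  rw [reflect_apply, reflect_apply, sp_sub_right, sp_smul_right]
  have h := mul_self_of_abs_eq_one hv
  have : 2 * sp k v v * (sp k v x - 2 * sp k v v * sp k v x * sp k v v)
      = - (2 * sp k v v * sp k v x) := by
    linear_combination (-4 * sp k v v * sp k v x) * h
  rw [this]; module

theorem sp_reflect {v : Vec N} (hv : |sp k v v| = 1) (x y : Vec N) :
    sp k (reflect k v x) (reflect k v y) = sp k x y := by
  rw [reflect_apply, reflect_apply]
  simp only [sp_sub_right, sp_sub_left, sp_smul_left, sp_smul_right]
  rw [sp_comm x v]
  linear_combination (4 * sp k v v * sp k v x * sp k v y) * mul_self_of_abs_eq_one hv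

/-- Reflection as a linear equivalence. -/
def reflectEquiv {v : Vec N} (hv : |sp k v v| = 1) : Vec N ≃ₗ[ℝ] Vec N :=
  LinearEquiv.ofInvolutive (reflect k v) (reflect_reflect hv)

/-- The elementary properties of elements of the spin group. -/
structure IsSpinLike (g : (Cliff N k)ˣ) : Prop where
  even : involute (g : Cliff N k) = g
  norm : reverse (g : Cliff N k) * g = 1 ∨ reverse (g : Cliff N k) * g = -1
  rotation : ∃ A : Vec N ≃ₗ[ℝ] Vec N, ∀ x,
    (g : Cliff N k) * vec N k x = vec N k (A x) * g

theorem isSpinLike_mul {g h : (Cliff N k)ˣ} (hg : IsSpinLike g) (hh : IsSpinLike h) :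
    IsSpinLike (g * h) where
  even := by rw [Units.val_mul, map_mul, hg.even, hh.even]
  norm := by
    rw [Units.val_mul, CliffordAlgebra.reverse.map_mul, mul_assoc,
      ← mul_assoc (reverse (g : Cliff N k))]
    rcases hg.norm with h1 | h1 <;> rcases hh.norm with h2 | h2 <;> simp [h1, h2]
  rotation := by
    obtain ⟨A, hA⟩ := hg.rotation
    obtain ⟨B, hB⟩ := hh.rotation
    refine ⟨B.trans A, fun x => ?_⟩
    rw [Units.val_mul, mul_assoc, hB, ← mul_assoc, hA, mul_assoc]; rfl

theorem reverse_inv_mul {g : (Cliff N k)ˣ} {t : Cliff N k} (ht : t = 1 ∨ t = -1)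
    (h : reverse (g : Cliff N k) * g = t) :
    reverse ((g⁻¹ : (Cliff N k)ˣ) : Cliff N k) * (g⁻¹ : (Cliff N k)ˣ) = t := by
  have h1 : reverse (g : Cliff N k) = t * (g⁻¹ : (Cliff N k)ˣ) := by
    rw [← h, mul_assoc, Units.mul_inv, mul_one]
  have h2 : reverse ((g⁻¹ : (Cliff N k)ˣ) : Cliff N k) * reverse (g : Cliff N k) = 1 := by
    rw [← CliffordAlgebra.reverse.map_mul, Units.mul_inv, CliffordAlgebra.reverse.map_one]
  rw [h1] at h2
  rcases ht with rfl | rfl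
  · simpa using h2
  · simp only [neg_mul, one_mul, mul_neg] at h2
    exact neg_eq_iff_eq_neg.mp h2

theorem isSpinLike_inv {g : (Cliff N k)ˣ} (hg : IsSpinLike g) : IsSpinLike g⁻¹ where
  even := by
    have h : involute (g : Cliff N k) * involute ((g⁻¹ : (Cliff N k)ˣ) : Cliff N k) = 1 := by
      rw [← map_mul, Units.mul_inv, map_one]
    rw [hg.even] at h
    exact (Units.inv_eq_of_mul_eq_one_right h).symm
  norm := by
    rcases hg.norm with h | h
    · exact Or.inl (reverse_inv_mul (Or.inl rfl) h)
    · exact Or.inr (reverse_inv_mul (Or.inr rfl) h)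
  rotation := by
    obtain ⟨A, hA⟩ := hg.rotation
    refine ⟨A.symm, fun x => ?_⟩
    rw [Units.inv_mul_eq_iff_eq_mul, ← mul_assoc, hA, LinearEquiv.apply_symm_apply, mul_assoc,
      Units.mul_inv, mul_one]

theorem isSpinLike_of_eq_vec_mul_vec {g : (Cliff N k)ˣ} {x y : Vec N} (hx : |sp k x x| = 1)
    (hy : |sp k y y| = 1) (hg : (g : Cliff N k) = vec N k x * vec N k y) : IsSpinLike g where
  even := by rw [hg, map_mul, CliffordAlgebra.involute_ι, CliffordAlgebra.involute_ι, neg_mul_neg]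
  norm := by
    rw [hg, CliffordAlgebra.reverse.map_mul, CliffordAlgebra.reverse_ι, CliffordAlgebra.reverse_ι,
      mul_assoc, ← mul_assoc (vec N k x), vec_mul_self, Algebra.commutes, ← mul_assoc,
      vec_mul_self, ← (algebraMap ℝ (Cliff N k)).map_mul]
    rcases eq_or_eq_neg_of_abs_eq hx with h1 | h1 <;>
      rcases eq_or_eq_neg_of_abs_eq hy with h2 | h2 <;> simp [h1, h2]
  rotation := by
    refine ⟨(reflectEquiv hy).trans (reflectEquiv hx), fun z => ?_⟩
    rw [hg, mul_assoc, vec_mul_vec_eq_reflect hy, mul_neg, ← mul_assoc,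
      vec_mul_vec_eq_reflect hx, neg_mul, neg_neg, mul_assoc]
    rfl

theorem isSpinLike_of_mem {g : (Cliff N k)ˣ} (hg : g ∈ Spin N k) : IsSpinLike g := by
  induction hg using Subgroup.closure_induction with
  | mem g h =>
    obtain ⟨x, y, hx, hy, h⟩ := h
    exact isSpinLike_of_eq_vec_mul_vec hx hy h
  | one =>
    exact ⟨by simp, Or.inl (by simp), LinearEquiv.refl ℝ _, fun x => by simp⟩
  | mul g h _ _ hg hh => exact isSpinLike_mul hg hh
  | inv g _ hg => exact isSpinLike_inv hg

theorem rotatesTo_iff {g : (Cliff N k)ˣ} {x y : Vec N} :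
    RotatesTo g x y ↔ (g : Cliff N k) * vec N k x = vec N k y * g := by
  rw [RotatesTo, Units.mul_inv_eq_iff_eq_mul]

/-- Scalar products are anticommutators up to the factor `-2`, and conjugation fixes scalars. -/
theorem RotatesTo.sp_eq {g : (Cliff N k)ˣ} {x y x' y' : Vec N} (h : RotatesTo g x y)
    (h' : RotatesTo g x' y') : sp k y y' = sp k x x' := by
  have h1 := vec_mul_vec_add (k := k) y y'
  rw [RotatesTo] at h h'
  rw [← h, ← h'] at h1
  have h2 : (g : Cliff N k) * (vec N k x * vec N k x' + vec N k x' * vec N k x)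
      = (algebraMap ℝ (Cliff N k) (-2 * sp k y y')) * g := by
    rw [← h1]
    simp only [add_mul, mul_add, mul_assoc, Units.inv_mul_cancel_left, Units.inv_mul, mul_one]
  rw [vec_mul_vec_add, ← Algebra.commutes, Units.mul_left_inj] at h2
  have := algebraMap_cliff_injective h2
  linarith

/-- A subspace that is preserved by products of two vectors is preserved by the spin group. -/
theorem kappa_mulVec_mem {W : Submodule ℂ (Spinor N)}
    (hW : ∀ x y : Vec N, ∀ w ∈ W, cmul k x (cmul k y w) ∈ W) {g : (Cliff N k)ˣ}
    (hg : g ∈ Spin N k) {w : Spinor N} (hw : w ∈ W) :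
    (kappa N k (g : Cliff N k)).mulVec w ∈ W := by
  -- The inverse is carried along in the induction, so that the case of inverses is a swap.
  suffices h : (∀ w ∈ W, (kappa N k (g : Cliff N k)).mulVec w ∈ W) ∧
      ∀ w ∈ W, (kappa N k ((g⁻¹ : (Cliff N k)ˣ) : Cliff N k)).mulVec w ∈ W from h.1 w hw
  clear hw w
  induction hg using Subgroup.closure_induction with
  | mem g h =>
    obtain ⟨x, y, hx, hy, h⟩ := h
    have hg : g = vecUnit x (ne_zero_of_abs_eq_one hx) * vecUnit y (ne_zero_of_abs_eq_one hy) :=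
      Units.ext h
    refine ⟨fun w hw => ?_, fun w hw => ?_⟩
    · rw [h, map_mul, ← Matrix.mulVec_mulVec]
      exact hW x y w hw
    · rw [hg, mul_inv_rev, Units.val_mul]
      change (kappa N k (((-(sp k y y)⁻¹) • vec N k y) * ((-(sp k x x)⁻¹) • vec N k x))).mulVec w ∈ W
      rw [smul_mul_smul_comm, map_smul, Matrix.smul_mulVec, map_mul, ← Matrix.mulVec_mulVec]
      exact W.smul_of_tower_mem _ (hW y x w hw)
  | one => simp
  | mul g h _ _ hg hh =>
    refine ⟨fun w hw => ?_, fun w hw => ?_⟩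
    · rw [Units.val_mul, map_mul, ← Matrix.mulVec_mulVec]
      exact hg.1 _ (hh.1 w hw)
    · rw [mul_inv_rev, Units.val_mul, map_mul, ← Matrix.mulVec_mulVec]
      exact hh.2 _ (hg.2 w hw)
  | inv g _ hg => exact ⟨hg.2, by simpa using hg.1⟩

end SpinGroup
end

noncomputable section

open CliffordAlgebra (involute reverse)

/-! ### Cartan–Dieudonné, and lifts of isometries to the Clifford algebra -/

section Reflections
variable {N k : ℕ}

theorem eq_zero_of_neg_eq_self {b : Cliff N k} (h : -b = b) : b = 0 := by
  have h2 : (2 : ℝ) • b = 0 := by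
    rw [two_smul]
    nth_rewrite 1 [← h]
    exact neg_add_cancel b
  exact (smul_eq_zero.mp h2).resolve_left two_ne_zero

/-- The unit vector in the direction of a non-isotropic vector. -/
def normalize (k : ℕ) {N : ℕ} (u : Vec N) : Vec N := (Real.sqrt |sp k u u|)⁻¹ • u

theorem sp_normalize {u : Vec N} (hu : sp k u u ≠ 0) :
    sp k (normalize k u) (normalize k u) = sp k u u / |sp k u u| := by
  have h : 0 < |sp k u u| := abs_pos.mpr hu
  have h2 := Real.mul_self_sqrt h.le
  rw [normalize, sp_smul_left, sp_smul_right, ← mul_assoc, ← mul_inv, h2]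
  ring

theorem abs_sp_normalize {u : Vec N} (hu : sp k u u ≠ 0) :
    |sp k (normalize k u) (normalize k u)| = 1 := by
  rw [sp_normalize hu, abs_div, abs_abs, div_self (abs_pos.mpr hu).ne']

theorem reflect_normalize {u : Vec N} (hu : sp k u u ≠ 0) (x : Vec N) :
    reflect k (normalize k u) x = x - (2 * sp k u x / sp k u u) • u := by
  have h : 0 < |sp k u u| := abs_pos.mpr hu
  have h2 := Real.mul_self_sqrt h.le
  have h3 : Real.sqrt |sp k u u| ≠ 0 := (Real.sqrt_pos.mpr h).ne'
  rw [reflect_apply, sp_normalize hu, normalize, sp_smul_left, smul_smul]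
  congr 2
  have h4 : |sp k u u| * |sp k u u| = sp k u u * sp k u u := abs_mul_abs_self _
  have h5 : 2 * (sp k u u / |sp k u u|) * ((√|sp k u u|)⁻¹ * sp k u x) * (√|sp k u u|)⁻¹
      = 2 * sp k u u * sp k u x / (|sp k u u| * (√|sp k u u| * √|sp k u u|)) := by
    field_simp
  rw [h5, h2, h4]
  field_simp

theorem reflect_normalize_sub {y z : Vec N} (hyz : sp k y y = sp k z z)
    (hu : sp k (y - z) (y - z) ≠ 0) : reflect k (normalize k (y - z)) z = y := by
  rw [reflect_normalize hu]
  have : 2 * sp k (y - z) z = -sp k (y - z) (y - z) := by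
    simp only [sp_sub_left, sp_sub_right, sp_comm z y, hyz]; ring
  rw [this, neg_div, div_self hu]; simp

theorem reflect_self_apply {z : Vec N} (hz : |sp k z z| = 1) : reflect k z z = -z := by
  rw [reflect_apply, mul_assoc, mul_self_of_abs_eq_one hz]; module

theorem reflect_of_sp_eq_zero {v x : Vec N} (h : sp k v x = 0) : reflect k v x = x := by
  rw [reflect_apply, h]; simp

theorem reflect_normalize_of_sp_eq_zero {v x : Vec N} (h : sp k v x = 0) :
    reflect k (normalize k v) x = x :=
  reflect_of_sp_eq_zero (by rw [normalize, sp_smul_left, h, mul_zero])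

/-- The norms of `y - z` and `y + z` add up to `4⟨z,z⟩`, so they cannot both vanish. In indefinite
signature this replaces a reflection in an isotropic difference by one in the sum. -/
theorem sp_add_self_ne_zero {y z : Vec N} (hyz : sp k y y = sp k z z) (hz : sp k z z ≠ 0)
    (h : sp k (y - z) (y - z) = 0) : sp k (y + z) (y + z) ≠ 0 := by
  intro h2
  simp only [sp_sub_left, sp_sub_right, sp_add_left, sp_add_right, sp_comm z y, hyz] at h h2
  exact hz (by linarith)

/-- The composition of the reflections in the vectors of a list. -/
def reflectList (k : ℕ) {N : ℕ} (l : List (Vec N)) (x : Vec N) : Vec N :=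
  l.foldr (fun v y => reflect k v y) x

/-- Every linear isometry is a composition of reflections. -/
theorem exists_eq_reflectList (A : Vec N →ₗ[ℝ] Vec N)
    (hA : ∀ x y, sp k (A x) (A y) = sp k x y) :
    ∃ l : List (Vec N), (∀ v ∈ l, |sp k v v| = 1) ∧ ∀ x, A x = reflectList k l x := by
  -- Induction on the number of basis vectors still to be fixed. The reflecting vectors are
  -- orthogonal to the basis vectors fixed before, which therefore stay fixed.
  suffices h : ∀ d p, p + d = N → ∀ A : Vec N →ₗ[ℝ] Vec N,
      (∀ x y, sp k (A x) (A y) = sp k x y) → (∀ j : Fin N, (j : ℕ) < p → A (e j) = e j) →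
      ∃ l : List (Vec N), (∀ v ∈ l, |sp k v v| = 1) ∧ ∀ x, A x = reflectList k l x from
    h N 0 (by omega) A hA (by simp)
  clear hA A
  intro d
  induction d with
  | zero =>
    intro p hp A _ hfix
    refine ⟨[], by simp, fun x => ?_⟩
    rw [← sum_smul_e x, map_sum]
    refine Finset.sum_congr rfl fun j _ => ?_
    rw [map_smul, hfix j (by omega)]
  | succ d ih =>
    intro p hp A hA hfix
    have hpN : p < N := by omega
    set z : Vec N := e ⟨p, hpN⟩ with hz
    have hz1 : |sp k z z| = 1 := by rw [hz, sp_e_e_self, abs_eps]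
    have horth : ∀ j : Fin N, (j : ℕ) < p → sp k z (e j) = 0 := fun j hj =>
      sp_e_e_of_ne (by rintro rfl; exact lt_irrefl _ hj)
    have horth' : ∀ j : Fin N, (j : ℕ) < p → sp k (A z) (e j) = 0 := fun j hj => by
      conv_lhs => rw [← hfix j hj]
      rw [hA, horth j hj]
    have hnorm : sp k z z = sp k (A z) (A z) := (hA z z).symm
    by_cases hu : sp k (z - A z) (z - A z) = 0
    -- The difference is isotropic: `A z` is reflected to `-z` instead, and the reflection in `z`
    -- corrects the sign.
    · have hu' : sp k (-z - A z) (-z - A z) ≠ 0 := by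
        have := sp_add_self_ne_zero hnorm (ne_zero_of_abs_eq_one (hA z z ▸ hz1)) hu
        rwa [show -z - A z = -(z + A z) by abel, sp_neg_left, sp_neg_right, neg_neg]
      have hv := abs_sp_normalize hu'
      obtain ⟨l, hl, h⟩ := ih (p + 1) (by omega)
        (reflect k z ∘ₗ reflect k (normalize k (-z - A z)) ∘ₗ A)
        (fun x y => by
          simp only [LinearMap.comp_apply]
          rw [sp_reflect hz1, sp_reflect hv, hA])
        (fun j hj => by
          simp only [LinearMap.comp_apply]
          rcases Nat.lt_succ_iff_lt_or_eq.mp hj with hj | hj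
          · rw [hfix j hj, reflect_normalize_of_sp_eq_zero, reflect_of_sp_eq_zero (horth j hj)]
            rw [sp_sub_left, sp_neg_left, horth j hj, horth' j hj]; simp
          · obtain rfl : j = ⟨p, hpN⟩ := Fin.ext hj
            rw [← hz, reflect_normalize_sub (by rw [sp_neg_left, sp_neg_right, neg_neg, hnorm]) hu',
              map_neg, reflect_self_apply hz1, neg_neg])
      refine ⟨normalize k (-z - A z) :: z :: l, ?_, fun x => ?_⟩
      · simp only [List.mem_cons, forall_eq_or_imp]
        exact ⟨hv, hz1, hl⟩
      · have h1 := h x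
        simp only [LinearMap.comp_apply] at h1
        simp only [reflectList, List.foldr_cons] at h1 ⊢
        rw [← h1, reflect_reflect hz1, reflect_reflect hv]
    · have hv := abs_sp_normalize hu
      obtain ⟨l, hl, h⟩ := ih (p + 1) (by omega) (reflect k (normalize k (z - A z)) ∘ₗ A)
        (fun x y => by
          simp only [LinearMap.comp_apply]
          rw [sp_reflect hv, hA])
        (fun j hj => by
          simp only [LinearMap.comp_apply]
          rcases Nat.lt_succ_iff_lt_or_eq.mp hj with hj | hj
          · rw [hfix j hj, reflect_normalize_of_sp_eq_zero]
            rw [sp_sub_left, horth j hj, horth' j hj]; simp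
          · obtain rfl : j = ⟨p, hpN⟩ := Fin.ext hj
            rw [← hz, reflect_normalize_sub hnorm hu])
      refine ⟨normalize k (z - A z) :: l, ?_, fun x => ?_⟩
      · simp only [List.mem_cons, forall_eq_or_imp]
        exact ⟨hv, hl⟩
      · have h1 := h x
        simp only [LinearMap.comp_apply] at h1
        simp only [reflectList, List.foldr_cons] at h1 ⊢
        rw [← h1, reflect_reflect hv]

/-- Moving `x` past a unit vector reflects it and costs a sign, which the involution compensates.
The identity therefore holds for any parity of the number of reflections. -/
theorem involute_prod_mul_vec {l : List (Vec N)} (hl : ∀ v ∈ l, |sp k v v| = 1) (x : Vec N) :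
    involute (l.map (vec N k)).prod * vec N k x
      = vec N k (reflectList k l x) * (l.map (vec N k)).prod := by
  induction l with
  | nil => simp [reflectList]
  | cons v l ih =>
    simp only [List.mem_cons, forall_eq_or_imp] at hl
    rw [List.map_cons, List.prod_cons, map_mul, CliffordAlgebra.involute_ι, mul_assoc, ih hl.2,
      ← mul_assoc, neg_mul, vec_mul_vec_eq_reflect hl.1, neg_neg, mul_assoc]
    rfl

theorem exists_spin_eq_prod : ∀ l : List (Vec N), (∀ v ∈ l, |sp k v v| = 1) → Even l.length →
    ∃ g ∈ Spin N k, (g : Cliff N k) = (l.map (vec N k)).prod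
  | [], _, _ => ⟨1, one_mem _, rfl⟩
  | [_], _, h => by simp at h
  | v :: w :: l, hl, h => by
    simp only [List.mem_cons, forall_eq_or_imp] at hl
    obtain ⟨g, hg, hgl⟩ := exists_spin_eq_prod l hl.2.2 (by
      simpa [Nat.even_add_one, add_assoc] using h)
    refine ⟨_, mul_mem (vecUnit_mul_mem_spin hl.1 hl.2.1) hg, ?_⟩
    rw [Units.val_mul, hgl, List.map_cons, List.map_cons, List.prod_cons, List.prod_cons,
      ← mul_assoc]
    rfl

theorem exists_units_eq_prod (l : List (Vec N)) (hl : ∀ v ∈ l, |sp k v v| = 1) :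
    ∃ g : (Cliff N k)ˣ, (g : Cliff N k) = (l.map (vec N k)).prod := by
  induction l with
  | nil => exact ⟨1, rfl⟩
  | cons v l ih =>
    simp only [List.mem_cons, forall_eq_or_imp] at hl
    obtain ⟨g, hg⟩ := ih hl.2
    refine ⟨vecUnit v (ne_zero_of_abs_eq_one hl.1) * g, ?_⟩
    rw [Units.val_mul, hg, List.map_cons, List.prod_cons]
    rfl

/-- Two invertible elements that rotate the basis vectors in the same way differ by a scalar. -/
theorem eq_algebraMap_mul_of_twisted {g h : (Cliff N k)ˣ} (y : Fin N → Cliff N k)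
    (hg : ∀ j, involute (g : Cliff N k) * vec N k (e j) = y j * g)
    (hh : ∀ j, involute (h : Cliff N k) * vec N k (e j) = y j * h) :
    ∃ t : ℝ, (h : Cliff N k) = algebraMap ℝ (Cliff N k) t * g := by
  obtain ⟨t, ht⟩ := exists_eq_algebraMap_of_graded_central (N := N) (k := k)
    (b := ((g⁻¹ * h : (Cliff N k)ˣ) : Cliff N k)) (fun j => by
      have hi : involute ((g⁻¹ : (Cliff N k)ˣ) : Cliff N k) * involute (g : Cliff N k) = 1 := by
        rw [← map_mul, Units.inv_mul, map_one]
      have h1 : vec N k (e j) * ((g⁻¹ : (Cliff N k)ˣ) : Cliff N k)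
          = involute ((g⁻¹ : (Cliff N k)ˣ) : Cliff N k) * y j := by
        rw [Units.mul_inv_eq_iff_eq_mul, mul_assoc, ← hg, ← mul_assoc, hi, one_mul]
      rw [Units.val_mul, map_mul, mul_assoc, hh, ← mul_assoc, ← h1, mul_assoc])
  refine ⟨t, ?_⟩
  rw [Units.val_mul, Units.inv_mul_eq_iff_eq_mul] at ht
  rw [ht, Algebra.commutes]

theorem neg_one_mem_spin {x : Vec N} (hx : |sp k x x| = 1) : (-1 : (Cliff N k)ˣ) ∈ Spin N k := by
  rcases eq_or_eq_neg_of_abs_eq hx with h | h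
  · refine Subgroup.subset_closure ⟨x, x, hx, hx, ?_⟩
    rw [vec_mul_self, h]; simp
  · refine Subgroup.subset_closure ⟨x, -x, hx, by rwa [sp_neg_left, sp_neg_right, neg_neg], ?_⟩
    rw [map_neg, mul_neg, vec_mul_self, h]; simp

/-- The spin group acts transitively on the vectors of a given norm. -/
theorem exists_spin_rotatesTo {y z w : Vec N} (hyz : sp k y y = sp k z z) (hz : |sp k z z| = 1)
    (hw : |sp k w w| = 1) (hwz : sp k w z = 0) : ∃ g ∈ Spin N k, RotatesTo g z y := by
  have key : ∀ v w : Vec N, |sp k v v| = 1 → |sp k w w| = 1 → reflect k v (reflect k w z) = y →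
      ∃ g ∈ Spin N k, RotatesTo g z y := by
    intro v w hv hw h
    refine ⟨_, vecUnit_mul_mem_spin hv hw, rotatesTo_iff.mpr ?_⟩
    change vec N k v * vec N k w * vec N k z = vec N k y * (vec N k v * vec N k w)
    rw [mul_assoc, vec_mul_vec_eq_reflect hw, mul_neg, ← mul_assoc, vec_mul_vec_eq_reflect hv, h,
      neg_mul, neg_neg, mul_assoc]
  by_cases hu : sp k (y - z) (y - z) = 0
  -- An even product needs two reflections. Here `z` goes to `-z` and then, by the reflection in `y
  -- + z`, to `y`. In the other case the first reflection is in `w`, which fixes `z`.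
  · have hu' : sp k (y - -z) (y - -z) ≠ 0 := by
      rw [sub_neg_eq_add]
      exact sp_add_self_ne_zero hyz (ne_zero_of_abs_eq_one hz) hu
    refine key _ z (abs_sp_normalize hu') hz ?_
    rw [reflect_self_apply hz, reflect_normalize_sub _ hu']
    rw [sp_neg_left, sp_neg_right, neg_neg, hyz]
  · refine key _ w (abs_sp_normalize hu) hw ?_
    rw [reflect_of_sp_eq_zero hwz, reflect_normalize_sub hyz hu]

end Reflections

/-! ### The embedding of `Cliff_{n,1}` and the stabilizer of the normal vector -/

section Inclusion
variable {c : SpaceForm} {n : ℕ}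

theorem inclVec_apply (x : Vec n) : inclVec c n x = (c.pos n).insertNth (0 : ℝ) x := rfl

theorem inclVec_pos (x : Vec n) : inclVec c n x (c.pos n) = 0 := by
  rw [inclVec_apply, Fin.insertNth_apply_same]

theorem inclVec_succAbove (x : Vec n) (j : Fin n) :
    inclVec c n x ((c.pos n).succAbove j) = x j := by
  rw [inclVec_apply, Fin.insertNth_apply_succAbove]

theorem inclVec_e (j : Fin n) : inclVec c n (e j) = e ((c.pos n).succAbove j) := by
  ext i
  refine Fin.succAboveCases (c.pos n) ?_ (fun l => ?_) i
  · rw [inclVec_pos, e, Pi.single_eq_of_ne (Fin.succAbove_ne _ _).symm]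
  · rw [inclVec_succAbove, e, e, Pi.single_apply, Pi.single_apply]
    simp

theorem sp_inclVec (x y : Vec n) : sp c.index (inclVec c n x) (inclVec c n y) = sp 1 x y := by
  simp only [sp]
  rw [Fin.sum_univ_succAbove _ (c.pos n)]
  simp [inclVec_pos, inclVec_succAbove, eps_succAbove]

theorem sp_inclVec_e_pos (x : Vec n) : sp c.index (inclVec c n x) (e (c.pos n)) = 0 := by
  rw [sp_e_right, inclVec_pos, mul_zero]

theorem inclCliff_vec (x : Vec n) :
    inclCliff c n (vec n 1 x) = vec (n + 1) c.index (inclVec c n x) :=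
  CliffordAlgebra.map_apply_ι _ _

theorem inclCliff_involute (a : Cliff n 1) :
    inclCliff c n (involute a) = involute (inclCliff c n a) := by
  induction a using CliffordAlgebra.induction with
  | algebraMap r => simp only [AlgHom.commutes]
  | ι x => rw [CliffordAlgebra.involute_ι, map_neg, inclCliff_vec, CliffordAlgebra.involute_ι]
  | mul a b ha hb => simp only [map_mul, ha, hb]
  | add a b ha hb => simp only [map_add, ha, hb]

/-- Vectors of the image are orthogonal to the normal, so they anticommute with it. This is the
comparison at the normal vector in `exists_eq_inclCliff`. -/
theorem inclCliff_mul_e_pos (a : Cliff n 1) :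
    involute (inclCliff c n a) * vec (n + 1) c.index (e (c.pos n))
      = vec (n + 1) c.index (e (c.pos n)) * inclCliff c n a := by
  induction a using CliffordAlgebra.induction with
  | algebraMap r => simp only [AlgHom.commutes, Algebra.commutes]
  | ι x =>
    rw [inclCliff_vec, CliffordAlgebra.involute_ι, neg_mul,
      vec_mul_vec_of_sp_eq_zero (sp_inclVec_e_pos x), neg_neg]
  | mul a b ha hb => rw [map_mul, map_mul, mul_assoc, hb, ← mul_assoc, ha, mul_assoc]
  | add a b ha hb => simp only [map_add, add_mul, mul_add, ha, hb]

theorem kappa_inclCliff_e_e (j l : Fin n) (w : Spinor (n + 1)) :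
    (kappa (n + 1) c.index (inclCliff c n (vec n 1 (e j) * vec n 1 (e l)))).mulVec w
      = cmul c.index (e ((c.pos n).succAbove j)) (cmul c.index (e ((c.pos n).succAbove l)) w) := by
  rw [map_mul, inclCliff_vec, inclCliff_vec, inclVec_e, inclVec_e, map_mul, cmul, cmul,
    Matrix.mulVec_mulVec]

/-- The stabilizer of the normal vector in `Spin(n+1,k)` is `Spin(n,1)`. -/
theorem exists_eq_inclCliff {b : (Cliff (n + 1) c.index)ˣ} (hn : 0 < n)
    (hb : b ∈ Spin (n + 1) c.index) (hbe : RotatesTo b (e (c.pos n)) (e (c.pos n))) :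
    ∃ a ∈ Spin n 1, (b : Cliff (n + 1) c.index) = inclCliff c n a := by
  have hs := isSpinLike_of_mem hb
  obtain ⟨F, hF⟩ := hs.rotation
  have hFsp : ∀ x y, sp c.index (F x) (F y) = sp c.index x y := fun x y =>
    RotatesTo.sp_eq (rotatesTo_iff.mpr (hF x)) (rotatesTo_iff.mpr (hF y))
  have hFe : F (e (c.pos n)) = e (c.pos n) := by
    apply vec_injective (k := c.index)
    have := (hF (e (c.pos n))).symm.trans (rotatesTo_iff.mp hbe)
    exact (Units.mul_left_inj _).mp this
  let R : Vec (n + 1) →ₗ[ℝ] Vec n := LinearMap.funLeft ℝ ℝ (c.pos n).succAbove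
  have hR : ∀ y : Vec (n + 1), sp c.index y (e (c.pos n)) = 0 → inclVec c n (R y) = y := by
    intro y hy
    rw [sp_e_right, mul_eq_zero] at hy
    ext i
    refine Fin.succAboveCases (c.pos n) ?_ (fun l => ?_) i
    · rw [inclVec_pos, hy.resolve_left (eps_ne_zero _ _)]
    · rw [inclVec_succAbove]; rfl
  have hperp : ∀ x : Vec n, sp c.index (F (inclVec c n x)) (e (c.pos n)) = 0 := fun x => by
    conv_lhs => rw [← hFe]
    rw [hFsp, sp_inclVec_e_pos]
  let A : Vec n →ₗ[ℝ] Vec n := R ∘ₗ F.toLinearMap ∘ₗ (inclVec c n).toLinearMap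
  have hA : ∀ x, inclVec c n (A x) = F (inclVec c n x) := fun x => hR _ (hperp x)
  obtain ⟨l, hl, hlA⟩ := exists_eq_reflectList (k := 1) A
    (fun x y => by rw [← sp_inclVec (c := c), hA, hA, hFsp, sp_inclVec])
  obtain ⟨a, ha⟩ := exists_units_eq_prod l hl
  have hav : ∀ x, involute (a : Cliff n 1) * vec n 1 x = vec n 1 (A x) * a := fun x => by
    rw [ha, involute_prod_mul_vec hl, hlA]
  let ia : (Cliff (n + 1) c.index)ˣ := Units.map (inclCliff c n : Cliff n 1 →* _) a
  have hia : (ia : Cliff (n + 1) c.index) = inclCliff c n a := rfl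
  -- The rotation by `b` restricts to the isometry `A` of the orthogonal complement of the normal.
  -- The product `a` of the vectors of its reflections has the same twisted conjugation as `b` after
  -- inclusion, so the two differ by a real factor.
  obtain ⟨t, ht⟩ := eq_algebraMap_mul_of_twisted (g := ia) (h := b)
    (fun j => vec (n + 1) c.index (F (e j)))
    (fun j => by
      refine Fin.succAboveCases (c.pos n) ?_ (fun l => ?_) j
      · rw [hFe, hia, inclCliff_mul_e_pos]
      · rw [← inclVec_e, ← hA, hia, ← inclCliff_vec, ← inclCliff_vec, ← inclCliff_involute,
          ← map_mul, hav, map_mul])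
    (fun j => by rw [hs.even, hF])
  have ht0 : t ≠ 0 := by
    rintro rfl
    rw [map_zero, zero_mul] at ht
    exact b.ne_zero ht
  -- An odd number of reflections would make `b` odd, whereas elements of the spin group are even.
  have heven : Even l.length := by
    by_contra hodd
    rw [Nat.not_even_iff_odd] at hodd
    have h1 : involute (a : Cliff n 1) = -a := by
      rw [ha, CliffordAlgebra.involute_prod_map_ι, hodd.neg_one_pow, neg_one_smul]
    have h2 := hs.even
    rw [ht, map_mul, AlgHom.commutes, hia, ← inclCliff_involute, h1, map_neg, mul_neg, ← hia,
      ← ht] at h2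
    exact b.ne_zero (eq_zero_of_neg_eq_self h2)
  obtain ⟨g, hg, hgl⟩ := exists_spin_eq_prod l hl heven
  obtain rfl : g = a := Units.ext (hgl.trans ha.symm)
  have hrev : ∀ a : Cliff n 1, inclCliff c n (reverse a) = reverse (inclCliff c n a) := by
    intro a
    induction a using CliffordAlgebra.induction with
    | algebraMap r => simp only [AlgHom.commutes, CliffordAlgebra.reverse.commutes]
    | ι x => rw [CliffordAlgebra.reverse_ι, inclCliff_vec, CliffordAlgebra.reverse_ι]
    | mul a b ha hb => simp only [map_mul, CliffordAlgebra.reverse.map_mul, ha, hb]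
    | add a b ha hb => simp only [map_add, ha, hb]
  -- Both spin elements have reversal norm `±1`, so `t² = ±1`, and `t` is real.
  have hnorm : t * t = 1 := by
    have h1 : reverse (b : Cliff (n + 1) c.index) * b
        = algebraMap ℝ _ (t * t) * inclCliff c n (reverse (g : Cliff n 1) * g) := by
      rw [ht, CliffordAlgebra.reverse.map_mul, CliffordAlgebra.reverse.commutes, hia,
        ← hrev, map_mul (algebraMap ℝ _), map_mul (inclCliff c n), mul_assoc, ← mul_assoc,
        ← Algebra.commutes, ← Algebra.commutes]
      simp only [mul_assoc, Algebra.left_comm]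
    have key : t * t = 1 ∨ t * t = -1 := by
      have hinj := algebraMap_cliff_injective (N := n + 1) (k := c.index)
      rcases hs.norm with h2 | h2 <;> rcases (isSpinLike_of_mem hg).norm with h3 | h3 <;>
        rw [h2, h3] at h1
      · left; apply hinj; simpa using h1.symm
      · right; apply hinj; simpa [eq_neg_iff_add_eq_zero, add_comm] using h1
      · right; apply hinj; simpa using h1.symm
      · left; apply hinj; simpa using h1.symm
    rcases key with h | h
    · exact h
    · nlinarith [mul_self_nonneg t]
  rcases mul_self_eq_one_iff.mp hnorm with rfl | rfl
  · exact ⟨g, hg, by rw [ht, map_one, one_mul]; rfl⟩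
  · have hm := neg_one_mem_spin (N := n) (k := 1) (x := e ⟨0, hn⟩) (by rw [sp_e_e_self, abs_eps])
    exact ⟨-1 * g, mul_mem hm hg, by rw [ht, map_neg, map_one, Units.val_mul, map_mul]; simp [hia]⟩

end Inclusion
end

noncomputable section

open CliffordAlgebra (involute reverse)
open Topology Filter

/-! ### A norm on the Clifford algebra -/

section Norm
variable {N k : ℕ}

/-- A norm on the (finite-dimensional) Clifford algebra, given by the coordinates in a basis. -/
@[reducible] def cliffNormedAddCommGroup (N k : ℕ) : NormedAddCommGroup (Cliff N k) :=
  NormedAddCommGroup.induced (Cliff N k) _ (Module.finBasis ℝ (Cliff N k)).equivFun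
    (Module.finBasis ℝ (Cliff N k)).equivFun.injective

attribute [local instance] cliffNormedAddCommGroup

@[reducible] def cliffNormedSpace (N k : ℕ) : NormedSpace ℝ (Cliff N k) :=
  NormedSpace.induced ℝ (Cliff N k) _ (Module.finBasis ℝ (Cliff N k)).equivFun

attribute [local instance] cliffNormedSpace

theorem contDiffOn_cliff {E : Type*} [NormedAddCommGroup E] [NormedSpace ℝ E] {f : E → Cliff N k}
    {s : Set E} (h : ∀ l : Cliff N k →ₗ[ℝ] ℝ, ContDiffOn ℝ ∞ (fun x => l (f x)) s) :
    ContDiffOn ℝ ∞ f s := by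
  let b := Module.finBasis ℝ (Cliff N k)
  have h1 : ContDiffOn ℝ ∞ (fun x => b.equivFun (f x)) s :=
    contDiffOn_pi.mpr fun i => h (b.coord i)
  have h2 := (LinearMap.toContinuousLinearMap b.equivFun.symm.toLinearMap).contDiff.comp_contDiffOn h1
  refine h2.congr fun x _ => ?_
  simp

end Norm

/-! ### Calculus for linear and bilinear maps on finite-dimensional spaces -/

section Bilinear
variable {D E F G : Type*} [NormedAddCommGroup D] [NormedSpace ℝ D]
  [NormedAddCommGroup E] [NormedSpace ℝ E] [FiniteDimensional ℝ E]
  [NormedAddCommGroup F] [NormedSpace ℝ F] [FiniteDimensional ℝ F]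
  [NormedAddCommGroup G] [NormedSpace ℝ G]

theorem contDiffOn_bilinear (B : E →ₗ[ℝ] F →ₗ[ℝ] G) {f : D → E} {g : D → F} {s : Set D}
    {m : WithTop ℕ∞} (hf : ContDiffOn ℝ m f s) (hg : ContDiffOn ℝ m g s) :
    ContDiffOn ℝ m (fun x => B (f x) (g x)) s :=
  (B.toContinuousBilinearMap.isBoundedBilinearMap.contDiff).comp_contDiffOn (hf.prodMk hg)

theorem differentiableAt_bilinear (B : E →ₗ[ℝ] F →ₗ[ℝ] G) {f : D → E} {g : D → F} {x : D}
    (hf : DifferentiableAt ℝ f x) (hg : DifferentiableAt ℝ g x) :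
    DifferentiableAt ℝ (fun x => B (f x) (g x)) x :=
  (B.toContinuousBilinearMap.hasFDerivAt_of_bilinear hf.hasFDerivAt
    hg.hasFDerivAt).differentiableAt

theorem fderiv_bilinear (B : E →ₗ[ℝ] F →ₗ[ℝ] G) {f : D → E} {g : D → F} {x : D}
    (hf : DifferentiableAt ℝ f x) (hg : DifferentiableAt ℝ g x) (X : D) :
    fderiv ℝ (fun x => B (f x) (g x)) x X
      = B (f x) (fderiv ℝ g x X) + B (fderiv ℝ f x X) (g x) := by
  have := B.toContinuousBilinearMap.hasFDerivAt_of_bilinear hf.hasFDerivAt hg.hasFDerivAt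
  rw [show fderiv ℝ (fun x => B (f x) (g x)) x = _ from this.fderiv]
  simp [LinearMap.toContinuousBilinearMap_apply]

theorem fderiv_linear (L : E →ₗ[ℝ] G) {f : D → E} {x : D} (hf : DifferentiableAt ℝ f x) (X : D) :
    fderiv ℝ (fun x => L (f x)) x X = L (fderiv ℝ f x X) := by
  have := (LinearMap.toContinuousLinearMap L).hasFDerivAt.comp x hf.hasFDerivAt
  rw [show fderiv ℝ (fun x => L (f x)) x = _ from this.fderiv]
  rfl

theorem contDiffOn_linear (L : E →ₗ[ℝ] G) {f : D → E} {s : Set D}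
    {m : WithTop ℕ∞} (hf : ContDiffOn ℝ m f s) : ContDiffOn ℝ m (fun x => L (f x)) s :=
  (LinearMap.toContinuousLinearMap L).contDiff.comp_contDiffOn hf

theorem differentiableAt_linear (L : E →ₗ[ℝ] G) {f : D → E} {x : D}
    (hf : DifferentiableAt ℝ f x) : DifferentiableAt ℝ (fun x => L (f x)) x :=
  (LinearMap.toContinuousLinearMap L).differentiableAt.comp x hf

end Bilinear

/-! ### The cone over the hypersurface and derivatives along the retraction -/

section Retraction
variable {c : SpaceForm} {n : ℕ} {r : ℝ}

theorem contDiffOn_sp {D : Type*} [NormedAddCommGroup D] [NormedSpace ℝ D] {N k : ℕ}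
    {f g : D → Vec N} {s : Set D} {m : WithTop ℕ∞} (hf : ContDiffOn ℝ m f s)
    (hg : ContDiffOn ℝ m g s) : ContDiffOn ℝ m (fun x => sp k (f x) (g x)) s :=
  contDiffOn_bilinear (spForm N k) hf hg

theorem contDiffOn_normalize {D : Type*} [NormedAddCommGroup D] [NormedSpace ℝ D] {N k : ℕ}
    {f : D → Vec N} {s : Set D} (hf : ContDiffOn ℝ ∞ f s)
    (h0 : ∀ x ∈ s, sp k (f x) (f x) ≠ 0) : ContDiffOn ℝ ∞ (fun x => normalize k (f x)) s := by
  have h1 : ContDiffOn ℝ ∞ (fun x => |sp k (f x) (f x)|) s := fun x hx =>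
    ContDiffAt.comp_contDiffWithinAt (g := fun t : ℝ => |t|) (f := fun x => sp k (f x) (f x)) x
      (contDiffAt_abs (h0 x hx)) (contDiffOn_sp hf hf x hx)
  have h2 : ContDiffOn ℝ ∞ (fun x => Real.sqrt |sp k (f x) (f x)|) s :=
    h1.sqrt fun x hx => (abs_pos.mpr (h0 x hx)).ne'
  exact (h2.inv fun x hx => (Real.sqrt_pos.mpr (abs_pos.mpr (h0 x hx))).ne').smul hf

theorem sign_mul_self (c : SpaceForm) : c.sign * c.sign = 1 := by
  cases c <;> simp [SpaceForm.sign]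

theorem abs_sign (c : SpaceForm) : |c.sign| = 1 := by
  cases c <;> simp [SpaceForm.sign]

theorem sign_ne_zero (c : SpaceForm) : c.sign ≠ 0 := ne_zero_of_abs_eq_one (abs_sign c)

/-- The open cone over the hypersurface. -/
def cone (c : SpaceForm) (n : ℕ) : Set (Vec (n + 1)) := {y | 0 < c.sign * sp c.index y y}

/-- The radial retraction of the cone onto the hypersurface. -/
def retr (c : SpaceForm) (r : ℝ) {n : ℕ} (y : Vec (n + 1)) : Vec (n + 1) :=
  (r / Real.sqrt (c.sign * sp c.index y y)) • y

theorem contDiff_sp_self {N k : ℕ} : ContDiff ℝ ∞ (fun y : Vec N => sp k y y) := by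
  rw [← contDiffOn_univ]
  exact contDiffOn_sp contDiffOn_id contDiffOn_id

theorem isOpen_cone : IsOpen (cone c n) :=
  isOpen_lt continuous_const (continuous_const.mul contDiff_sp_self.continuous)

theorem carrier_subset_cone (hr : 0 < r) : c.carrier n r ⊆ cone c n := by
  intro x hx
  rw [SpaceForm.carrier, Set.mem_ofPred_eq] at hx
  rw [cone, Set.mem_ofPred_eq, hx, ← mul_assoc, sign_mul_self, one_mul]
  positivity

theorem contDiffOn_radius :
    ContDiffOn ℝ ∞ (fun y => r / Real.sqrt (c.sign * sp c.index y y)) (cone c n) := by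
  refine contDiffOn_const.div ((contDiffOn_const.mul contDiff_sp_self.contDiffOn).sqrt
    fun y hy => ?_) fun y hy => ?_
  · have hy' : 0 < c.sign * sp c.index y y := hy
    exact hy'.ne'
  · exact (Real.sqrt_pos.mpr hy).ne'

theorem contDiffOn_retr : ContDiffOn ℝ ∞ (retr c r) (cone c n) :=
  contDiffOn_radius.smul contDiffOn_id

theorem retr_mem {y : Vec (n + 1)} (hy : y ∈ cone c n) : retr c r y ∈ c.carrier n r := by
  have hy' : 0 < c.sign * sp c.index y y := hy
  have h2 := Real.mul_self_sqrt hy'.le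
  have h3 := (Real.sqrt_pos.mpr hy').ne'
  rw [SpaceForm.carrier, Set.mem_ofPred_eq, retr, sp_smul_left, sp_smul_right, ← mul_assoc]
  have h4 : r / √(c.sign * sp c.index y y) * (r / √(c.sign * sp c.index y y))
      = r ^ 2 / (c.sign * sp c.index y y) := by
    rw [div_mul_div_comm, h2, sq]
  rw [h4, div_mul_eq_mul_div, div_eq_iff hy'.ne']
  linear_combination (- r ^ 2 * sp c.index y y) * sign_mul_self c

theorem retr_eq_self (hr : 0 < r) {x : Vec (n + 1)} (hx : x ∈ c.carrier n r) : retr c r x = x := by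
  rw [SpaceForm.carrier, Set.mem_ofPred_eq] at hx
  rw [retr, hx, ← mul_assoc, sign_mul_self, one_mul, Real.sqrt_sq hr.le, div_self hr.ne', one_smul]

theorem differentiableAt_retr {y : Vec (n + 1)} (hy : y ∈ cone c n) :
    DifferentiableAt ℝ (retr c r) y :=
  (contDiffOn_retr.contDiffAt (isOpen_cone.mem_nhds hy)).differentiableAt (by simp)

theorem sp_fderiv_retr {y : Vec (n + 1)} (hy : y ∈ cone c n) (X : Vec (n + 1)) :
    sp c.index (fderiv ℝ (retr c r) y X) (retr c r y) = 0 := by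
  have h := fderiv_bilinear (spForm (n + 1) c.index) (differentiableAt_retr (r := r) hy)
    (differentiableAt_retr (r := r) hy) X
  have h1 : (fun x => (spForm (n + 1) c.index (retr c r x)) (retr c r x))
      =ᶠ[𝓝 y] fun _ => c.sign * r ^ 2 := by
    filter_upwards [isOpen_cone.mem_nhds hy] with z hz
    exact retr_mem hz
  rw [h1.fderiv_eq, fderiv_fun_const] at h
  simp only [spForm_apply, Pi.zero_apply, zero_apply] at h
  rw [sp_comm (retr c r y)] at h
  linarith

/-- The derivative of the radial factor only adds a multiple of `x` to `X`. The result is orthogonal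
to `x` and `x` is not isotropic, so this multiple vanishes. -/
theorem fderiv_retr (hr : 0 < r) {x : Vec (n + 1)} (hx : x ∈ c.carrier n r) {X : Vec (n + 1)}
    (hX : sp c.index X x = 0) : fderiv ℝ (retr c r) x X = X := by
  have hxc := carrier_subset_cone hr hx
  have hd : DifferentiableAt ℝ (fun y : Vec (n + 1) => r / Real.sqrt (c.sign * sp c.index y y)) x :=
    (contDiffOn_radius.contDiffAt (isOpen_cone.mem_nhds hxc)).differentiableAt (by simp)
  have h := hd.hasFDerivAt.smul (hasFDerivAt_id x)
  have h0 := sp_fderiv_retr (r := r) hxc X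
  have hrad : r / Real.sqrt (c.sign * sp c.index x x) = 1 := by
    rw [show sp c.index x x = c.sign * r ^ 2 from hx, ← mul_assoc, sign_mul_self, one_mul,
      Real.sqrt_sq hr.le, div_self hr.ne']
  rw [retr_eq_self hr hx] at h0
  have h' : HasFDerivAt (retr c r) _ x := h
  rw [h'.fderiv] at h0 ⊢
  simp only [hrad, add_apply,
    ContinuousLinearMap.smulRight_apply, ContinuousLinearMap.id_apply, id_eq, one_smul] at h0 ⊢
  rw [sp_add_left, sp_smul_left, hX, zero_add, show sp c.index x x = c.sign * r ^ 2 from hx] at h0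
  rw [(mul_eq_zero.mp h0).resolve_right (mul_ne_zero (sign_ne_zero c) (pow_pos hr 2).ne'),
    zero_smul, add_zero]

theorem eventually_retr_mem {s : Set (Vec (n + 1))} (hs : IsOpen s)
    {x : Vec (n + 1)} (hx : x ∈ cone c n) (hxs : retr c r x ∈ s) :
    ∀ᶠ y in 𝓝 x, retr c r y ∈ c.carrier n r ∩ s := by
  have h1 : ∀ᶠ y in 𝓝 x, retr c r y ∈ s :=
    (differentiableAt_retr hx).continuousAt.eventually (hs.mem_nhds hxs)
  filter_upwards [h1, isOpen_cone.mem_nhds hx] with y hy hyc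
  exact ⟨retr_mem hyc, hy⟩

variable {W : Type*} [NormedAddCommGroup W] [NormedSpace ℝ W]

theorem differentiableAt_comp_retr (hr : 0 < r) {s : Set (Vec (n + 1))} (hs : IsOpen s)
    {x : Vec (n + 1)} (hx : x ∈ c.carrier n r ∩ s) {h : Vec (n + 1) → W}
    (hh : ContDiffOn ℝ ∞ h (c.carrier n r ∩ s)) :
    DifferentiableAt ℝ (fun y => h (retr c r y)) x := by
  have hxc := carrier_subset_cone hr hx.1
  have hrx := retr_eq_self hr hx.1
  have h1 : DifferentiableWithinAt ℝ h (c.carrier n r ∩ s) (retr c r x) := by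
    rw [hrx]; exact (hh x hx).differentiableWithinAt (by simp)
  exact (h1.hasFDerivWithinAt.comp_hasFDerivAt x (differentiableAt_retr hxc).hasFDerivAt
    (eventually_retr_mem hs hxc (by rw [hrx]; exact hx.2))).differentiableAt

/-- The hypersurface has empty interior, so a derivative within it is not unique on ambient vectors.
Composition with the retraction gives an ordinary derivative on an open set. By the chain rule it
agrees on tangent vectors with whichever derivative within the set was chosen. -/
theorem tderiv_eq_fderiv (hr : 0 < r) (q : LocalSection c n r)
    {x : Vec (n + 1)} (hx : x ∈ c.carrier n r ∩ q.dom) {h : Vec (n + 1) → W}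
    (hh : ContDiffOn ℝ ∞ h (c.carrier n r ∩ q.dom)) {X : Vec (n + 1)} (hX : sp c.index X x = 0) :
    tderiv q h x X = fderiv ℝ (fun y => h (retr c r y)) x X := by
  have hxc := carrier_subset_cone hr hx.1
  have hrx := retr_eq_self hr hx.1
  have h1 : HasFDerivWithinAt h (fderivWithin ℝ h (c.carrier n r ∩ q.dom) x)
      (c.carrier n r ∩ q.dom) (retr c r x) := by
    rw [hrx]; exact ((hh x hx).differentiableWithinAt (by simp)).hasFDerivWithinAt
  have h2 := h1.comp_hasFDerivAt x (differentiableAt_retr hxc).hasFDerivAt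
    (eventually_retr_mem q.isOpen_dom hxc (by rw [hrx]; exact hx.2))
  rw [show fderiv ℝ (fun y => h (retr c r y)) x = _ from h2.fderiv, tderiv,
    ContinuousLinearMap.comp_apply, fderiv_retr hr hx.1 hX]

theorem contDiffOn_comp_retr {s : Set (Vec (n + 1))} {h : Vec (n + 1) → W}
    (hh : ContDiffOn ℝ ∞ h (c.carrier n r ∩ s)) :
    ContDiffOn ℝ ∞ (fun y => h (retr c r y)) (cone c n ∩ {y | retr c r y ∈ s}) :=
  hh.comp (contDiffOn_retr.mono Set.inter_subset_left) fun _ hy => ⟨retr_mem hy.1, hy.2⟩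

end Retraction

/-! ### Smooth local sections of the spin structure -/

section Existence
variable {c : SpaceForm} {n : ℕ} {r : ℝ}

theorem sp_gauss (hr : 0 < r) {x : Vec (n + 1)} (hx : x ∈ c.carrier n r) :
    sp c.index (gauss r x) (gauss r x) = c.sign := by
  rw [gauss, sp_smul_left, sp_smul_right, show sp c.index x x = c.sign * r ^ 2 from hx]
  field_simp

/-- There is a smooth local section of the spin structure around each point. -/
theorem exists_localSection (hn : 0 < n) (hr : 0 < r) {x₀ : Vec (n + 1)}
    (hx₀ : x₀ ∈ c.carrier n r) : ∃ q : LocalSection c n r, x₀ ∈ q.dom := by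
  set η₀ := gauss r x₀ with hη₀
  have hη : sp c.index η₀ η₀ = c.sign := sp_gauss hr hx₀
  have hη1 : |sp c.index η₀ η₀| = 1 := by rw [hη, abs_sign]
  have hpos : sp c.index (e (c.pos n)) (e (c.pos n)) = c.sign := by rw [sp_e_e_self, eps_pos c n hn]
  obtain ⟨g₀, hg₀, hrot⟩ := exists_spin_rotatesTo (k := c.index) (y := η₀) (z := e (c.pos n))
    (w := e ((c.pos n).succAbove ⟨0, hn⟩)) (by rw [hη, hpos]) (by rw [hpos, abs_sign])
    (by rw [sp_e_e_self, abs_eps]) (sp_e_e_of_ne (Fin.succAbove_ne _ _))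
  obtain ⟨A, hA⟩ := (isSpinLike_of_mem hg₀).rotation
  have hAe : A (e (c.pos n)) = η₀ := by
    apply vec_injective (k := c.index)
    exact (Units.mul_left_inj g₀).mp ((hA _).symm.trans (rotatesTo_iff.mp hrot))
  -- The lift is `v(x) η₀ g₀` with `v(x)` the normalized sum `η(x) + η₀`. Here `g₀` takes the normal
  -- basis vector to `η₀`, the reflection in `η₀` takes this to `-η₀`, and the reflection in `v(x)`
  -- takes `-η₀` to `η(x)`. The domain is where the sum is not isotropic and has the causal type of
  -- the normal; at `x₀` the sum is `2η₀`.
  let u : Vec (n + 1) → Vec (n + 1) := fun x => gauss r x - -η₀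
  let v : Vec (n + 1) → Vec (n + 1) := fun x => normalize c.index (u x)
  let dom : Set (Vec (n + 1)) := {x | 0 < c.sign * sp c.index (u x) (u x)}
  have hu : ContDiff ℝ ∞ u := (contDiff_id.const_smul r⁻¹).sub contDiff_const
  have hudom : ∀ x ∈ dom, sp c.index (u x) (u x) ≠ 0 := fun x hx =>
    right_ne_zero_of_mul (show 0 < c.sign * sp c.index (u x) (u x) from hx).ne'
  have hv1 : ∀ x ∈ dom, |sp c.index (v x) (v x)| = 1 := fun x hx => abs_sp_normalize (hudom x hx)
  have hvs : ContDiffOn ℝ ∞ v dom := contDiffOn_normalize hu.contDiffOn hudom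
  have hvs' : ContDiffOn ℝ ∞ v (c.carrier n r ∩ dom) := hvs.mono Set.inter_subset_right
  classical
  let lift : Vec (n + 1) → (Cliff (n + 1) c.index)ˣ := fun x =>
    if h : sp c.index (v x) (v x) ≠ 0 then
      vecUnit (v x) h * vecUnit η₀ (ne_zero_of_abs_eq_one hη1) * g₀ else 1
  have hlift : ∀ x (hx : x ∈ dom), lift x = vecUnit (v x) (ne_zero_of_abs_eq_one (hv1 x hx)) *
      vecUnit η₀ (ne_zero_of_abs_eq_one hη1) * g₀ := fun x hx =>
    dif_pos (ne_zero_of_abs_eq_one (hv1 x hx))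
  have hlift' : ∀ x ∈ dom, (lift x : Cliff (n + 1) c.index)
      = vec (n + 1) c.index (v x) * vec (n + 1) c.index η₀ * g₀ := fun x hx => by rw [hlift x hx]; rfl
  have hrotl : ∀ x ∈ dom, ∀ z, RotatesTo (lift x) z
      (reflect c.index (v x) (reflect c.index η₀ (A z))) := fun x hx z => by
    rw [rotatesTo_iff, hlift' x hx, mul_assoc, hA, ← mul_assoc, mul_assoc (vec (n + 1) c.index (v x)),
      vec_mul_vec_eq_reflect hη1, mul_neg, ← mul_assoc, vec_mul_vec_eq_reflect (hv1 x hx)]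
    simp only [neg_mul, neg_neg, mul_assoc]
  refine ⟨⟨dom, ?_, lift, fun j x => reflect c.index (v x)
    (reflect c.index η₀ (A (e ((c.pos n).succAbove j)))), ?_, ?_, ?_, ?_, ?_⟩, ?_⟩
  · exact isOpen_lt continuous_const
      (continuous_const.mul (contDiff_sp_self.continuous.comp hu.continuous))
  · rintro x ⟨-, hx⟩
    rw [hlift x hx]
    exact mul_mem (vecUnit_mul_mem_spin (hv1 x hx) hη1) hg₀
  · rintro x ⟨hxc, hx⟩
    have h := hrotl x hx (e (c.pos n))
    rwa [hAe, reflect_self_apply hη1, reflect_normalize_sub _ (hudom x hx)] at h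
    rw [sp_neg_left, sp_neg_right, neg_neg, hη, sp_gauss hr hxc]
  · rintro x ⟨-, hx⟩ j
    exact hrotl x hx _
  · intro l
    have h1 := contDiffOn_linear ((l ∘ₗ LinearMap.mulRight ℝ (vec (n + 1) c.index η₀ *
      (g₀ : Cliff (n + 1) c.index))) ∘ₗ
      vec (n + 1) c.index) hvs'
    refine h1.congr fun x hx => ?_
    rw [hlift' x hx.2, mul_assoc]
    rfl
  · intro j
    simp only [reflect_apply (v _)]
    exact contDiffOn_const.sub (((contDiffOn_const.mul (contDiffOn_sp hvs' hvs')).mul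
      (contDiffOn_sp hvs' contDiffOn_const)).smul hvs')
  · change 0 < c.sign * sp c.index (η₀ - -η₀) (η₀ - -η₀)
    simp only [sub_neg_eq_add, sp_add_left, sp_add_right, hη]
    linarith [sign_mul_self c]

end Existence
end

noncomputable section

open CliffordAlgebra (involute reverse)
open Topology Filter

/-! ### Skew endomorphisms as bivectors -/

section Bivector
variable {N k : ℕ}

/-- The element of the Clifford algebra that belongs to the skew endomorphism with the coefficients
`w`. -/
def bivector (k : ℕ) {N : ℕ} (w : Fin N → Fin N → ℝ) : Cliff N k :=
  (1 / 4 : ℝ) • ∑ i, ∑ l, (eps k i * eps k l * w i l) • (vec N k (e i) * vec N k (e l))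

theorem involute_bivector (w : Fin N → Fin N → ℝ) : involute (bivector k w) = bivector k w := by
  simp only [bivector, map_smul, map_sum, map_mul, CliffordAlgebra.involute_ι, neg_mul_neg]

theorem reverse_bivector {w : Fin N → Fin N → ℝ} (hw : ∀ i l, w i l = -w l i) :
    reverse (bivector k w) = -bivector k w := by
  simp only [bivector, map_smul, map_sum, CliffordAlgebra.reverse.map_mul,
    CliffordAlgebra.reverse_ι]
  rw [Finset.sum_comm, ← smul_neg]
  simp only [← Finset.sum_neg_distrib]
  congr 1
  refine Finset.sum_congr rfl fun i _ => Finset.sum_congr rfl fun l _ => ?_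
  rw [hw l i, mul_neg, neg_smul, mul_comm (eps k l)]

theorem mul_mul_sub_mul_mul (a b x : Vec N) :
    vec N k a * vec N k b * vec N k x - vec N k x * (vec N k a * vec N k b)
      = (-2 * sp k b x) • vec N k a - (-2 * sp k a x) • vec N k b := by
  have h1 := vec_mul_vec_add (k := k) b x
  have h2 := vec_mul_vec_add (k := k) a x
  rw [Algebra.smul_def, Algebra.smul_def, ← h1, ← h2, h1, Algebra.commutes, ← h1]
  noncomm_ring

/-- The normalization `1/4` in `bivector` compensates a factor `2` from the Clifford relation and
another `2` from summing over ordered pairs. The commutator then reproduces the rows of `w` with the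
signs `ε_l`. -/
theorem bivector_mul_vec_e {w : Fin N → Fin N → ℝ} (hw : ∀ i l, w i l = -w l i) (m : Fin N) :
    bivector k w * vec N k (e m) - vec N k (e m) * bivector k w
      = ∑ l, (eps k l * w m l) • vec N k (e l) := by
  have h0 : ∀ i l : Fin N, (-2 * sp k (e l : Vec N) (e m)) • vec N k (e i)
      - (-2 * sp k (e i : Vec N) (e m)) • vec N k (e l)
      = (if l = m then (-2 * eps k m) • vec N k (e i) else 0)
        - (if i = m then (-2 * eps k m) • vec N k (e l) else 0) := by
    intro i l
    congr 1
    · split_ifs with h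
      · rw [h, sp_e_e_self]
      · rw [sp_e_e_of_ne h]; simp
    · split_ifs with h
      · rw [h, sp_e_e_self]
      · rw [sp_e_e_of_ne h]; simp
  simp only [bivector, smul_mul_assoc, mul_smul_comm, Finset.sum_mul, Finset.mul_sum, ← smul_sub,
    ← Finset.sum_sub_distrib, mul_mul_sub_mul_mul, h0]
  simp only [smul_sub, Finset.sum_sub_distrib, smul_ite, smul_zero, Finset.sum_ite_eq',
    Finset.mem_univ, if_true]
  rw [Finset.sum_comm (f := fun i l => if i = m then _ else _)]
  simp only [Finset.sum_ite_eq', Finset.mem_univ, if_true, Finset.smul_sum,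
    ← Finset.sum_sub_distrib]
  refine Finset.sum_congr rfl fun l _ => ?_
  rw [smul_smul, smul_smul, smul_smul, smul_smul, ← sub_smul, hw l m]
  congr 1
  linear_combination (eps k l * w m l) * eps_mul_self k m

theorem sum_sum_eq_two_smul_sum_Ioi {M : Type*} [AddCommGroup M] [Module ℝ M]
    {F : Fin N → Fin N → M} (hs : ∀ i l, F i l = F l i) (hd : ∀ i, F i i = 0) :
    ∑ i, ∑ l, F i l = (2 : ℝ) • ∑ i, ∑ l ∈ Finset.Ioi i, F i l := by
  have h1 : ∀ i, ∑ l, F i l = ∑ l ∈ Finset.Ioi i, F i l + ∑ l ∈ Finset.Iio i, F i l := by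
    intro i
    rw [← Finset.sum_union]
    · refine (Finset.sum_subset (Finset.subset_univ _) fun l _ hl => ?_).symm
      obtain rfl : i = l := by
        simp only [Finset.mem_union, Finset.mem_Ioi, Finset.mem_Iio, not_or, not_lt] at hl
        exact le_antisymm hl.2 hl.1
      exact hd i
    · rw [Finset.disjoint_left]
      intro l h1 h2
      simp only [Finset.mem_Ioi, Finset.mem_Iio] at h1 h2
      exact lt_asymm h1 h2
  have h2 : ∑ i, ∑ l ∈ Finset.Iio i, F i l = ∑ i, ∑ l ∈ Finset.Ioi i, F i l := by
    rw [Finset.sum_comm' (t' := Finset.univ) (s' := fun l => Finset.Ioi l) (by simp)]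
    exact Finset.sum_congr rfl fun i _ => Finset.sum_congr rfl fun l _ => hs _ _
  rw [Finset.sum_congr rfl fun i _ => h1 i, Finset.sum_add_distrib, h2, two_smul]

/-- Expansion with respect to an orthonormal basis. -/
theorem eq_sum_of_rotatesTo {g : (Cliff N k)ˣ} {t : Fin N → Vec N}
    (ht : ∀ l, RotatesTo g (e l) (t l)) (hg : g ∈ Spin N k) (y : Vec N) :
    y = ∑ l, (eps k l * sp k y (t l)) • t l ∧
    RotatesTo g (∑ l, (eps k l * sp k y (t l)) • e l) y := by
  obtain ⟨A, hA⟩ := (isSpinLike_of_mem hg).rotation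
  have hAt : ∀ l, A (e l) = t l := fun l => by
    apply vec_injective (k := k)
    exact (Units.mul_left_inj g).mp ((hA _).symm.trans (rotatesTo_iff.mp (ht l)))
  obtain ⟨z, rfl⟩ := A.surjective y
  have hz : ∀ l, eps k l * sp k (A z) (t l) = z l := fun l => by
    rw [RotatesTo.sp_eq (rotatesTo_iff.mpr (hA z)) (ht l), sp_e_right, ← mul_assoc, eps_mul_self,
      one_mul]
  simp only [hz]
  constructor
  · conv_lhs => rw [← sum_smul_e z, map_sum]
    simp only [map_smul, hAt]
  · rw [sum_smul_e]
    exact rotatesTo_iff.mpr (hA z)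

end Bivector

/-! ### Derivatives of frames and lifts, and the spinorial Gauss formula -/

section Gauge
variable {c : SpaceForm} {n : ℕ} {r : ℝ}

attribute [local instance] cliffNormedAddCommGroup cliffNormedSpace

/-- The orthonormal basis field of a local section, together with the unit normal. -/
def LocalSection.fullFrame (q : LocalSection c n r) (i : Fin (n + 1)) :
    Vec (n + 1) → Vec (n + 1) :=
  (c.pos n).insertNth (α := fun _ => Vec (n + 1) → Vec (n + 1)) (gauss r) q.frame i

theorem fullFrame_pos (q : LocalSection c n r) : q.fullFrame (c.pos n) = gauss r :=
  Fin.insertNth_apply_same _ _ _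

theorem fullFrame_succAbove (q : LocalSection c n r) (j : Fin n) :
    q.fullFrame ((c.pos n).succAbove j) = q.frame j :=
  Fin.insertNth_apply_succAbove _ _ _ _

theorem rotatesTo_fullFrame (q : LocalSection c n r) {x : Vec (n + 1)}
    (hx : x ∈ c.carrier n r ∩ q.dom) (i : Fin (n + 1)) :
    RotatesTo (q.lift x) (e i) (q.fullFrame i x) := by
  refine Fin.succAboveCases (c.pos n) ?_ (fun j => ?_) i
  · rw [fullFrame_pos]; exact q.normal x hx
  · rw [fullFrame_succAbove]; exact q.tangent x hx j

theorem contDiffOn_fullFrame (q : LocalSection c n r) (i : Fin (n + 1)) :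
    ContDiffOn ℝ ∞ (q.fullFrame i) (c.carrier n r ∩ q.dom) := by
  refine Fin.succAboveCases (c.pos n) ?_ (fun j => ?_) i
  · rw [fullFrame_pos]; exact (contDiff_id.const_smul r⁻¹).contDiffOn
  · rw [fullFrame_succAbove]; exact q.smooth_frame j

theorem contDiffOn_lift (q : LocalSection c n r) :
    ContDiffOn ℝ ∞ (fun x => (q.lift x : Cliff (n + 1) c.index)) (c.carrier n r ∩ q.dom) :=
  contDiffOn_cliff q.smooth_lift

theorem sp_frame_self (hr : 0 < r) (q : LocalSection c n r) {x : Vec (n + 1)}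
    (hx : x ∈ c.carrier n r ∩ q.dom) (j : Fin n) : sp c.index (q.frame j x) x = 0 := by
  have h := RotatesTo.sp_eq (q.tangent x hx j) (q.normal x hx)
  rw [sp_e_e_of_ne (Fin.succAbove_ne _ _), gauss, sp_smul_right] at h
  exact (mul_eq_zero.mp h).resolve_left (inv_ne_zero hr.ne')

theorem sp_frame_frame (q : LocalSection c n r) {x : Vec (n + 1)}
    (hx : x ∈ c.carrier n r ∩ q.dom) (j l : Fin n) :
    sp c.index (q.frame j x) (q.frame l x) = if j = l then eps 1 j else 0 := by
  rw [RotatesTo.sp_eq (q.tangent x hx j) (q.tangent x hx l)]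
  split_ifs with h
  · rw [h, sp_e_e_self, eps_succAbove]
  · exact sp_e_e_of_ne (fun h' => h (Fin.succAbove_right_injective h'))

/-- Multiplication of the Clifford algebra as a bilinear map. -/
abbrev cliffMulForm (N k : ℕ) : Cliff N k →ₗ[ℝ] Cliff N k →ₗ[ℝ] Cliff N k :=
  LinearMap.mul ℝ (Cliff N k)

section Point
variable (q : LocalSection c n r) {x : Vec (n + 1)}

/-- The derivative of the lift in a tangent direction, at the point `x`. -/
def liftDeriv (x X : Vec (n + 1)) : Cliff (n + 1) c.index :=
  fderiv ℝ (fun y => (q.lift (retr c r y) : Cliff (n + 1) c.index)) x X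

/-- The derivative of a vector of the full frame in a tangent direction, at the point `x`. -/
def frameDeriv (i : Fin (n + 1)) (x X : Vec (n + 1)) : Vec (n + 1) :=
  fderiv ℝ (fun y => q.fullFrame i (retr c r y)) x X

theorem eventually_mem (hr : 0 < r) (hx : x ∈ c.carrier n r ∩ q.dom) :
    ∀ᶠ y in 𝓝 x, retr c r y ∈ c.carrier n r ∩ q.dom :=
  eventually_retr_mem q.isOpen_dom (carrier_subset_cone hr hx.1)
    (by rw [retr_eq_self hr hx.1]; exact hx.2)

theorem involute_liftDeriv (hr : 0 < r) (hx : x ∈ c.carrier n r ∩ q.dom) (X : Vec (n + 1)) :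
    involute (liftDeriv q x X) = liftDeriv q x X := by
  have hd := differentiableAt_comp_retr hr q.isOpen_dom hx (contDiffOn_lift q)
  have h := fderiv_linear (involute (Q := cliffForm (n + 1) c.index)).toLinearMap hd X
  have he : (fun y => (involute (Q := cliffForm (n + 1) c.index)).toLinearMap
      (q.lift (retr c r y) : Cliff (n + 1) c.index)) =ᶠ[𝓝 x]
      fun y => (q.lift (retr c r y) : Cliff (n + 1) c.index) := by
    filter_upwards [eventually_mem q hr hx] with y hy
    exact (isSpinLike_of_mem (q.lift_mem _ hy)).even
  rw [he.fderiv_eq] at h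
  exact h.symm

/-- The element `reverse g * g` is `1` or `-1`. Its square is the constant `1`, and differentiating
the square avoids showing that the sign is locally constant. -/
theorem reverse_liftDeriv (hr : 0 < r) (hx : x ∈ c.carrier n r ∩ q.dom) (X : Vec (n + 1)) :
    reverse (q.lift x : Cliff (n + 1) c.index) * liftDeriv q x X
      + reverse (liftDeriv q x X) * q.lift x = 0 := by
  have hd := differentiableAt_comp_retr hr q.isOpen_dom hx (contDiffOn_lift q)
  have hd' := differentiableAt_linear (reverse (Q := cliffForm (n + 1) c.index)) hd
  have h := fderiv_bilinear (cliffMulForm (n + 1) c.index) hd' hd X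
  have hT := differentiableAt_bilinear (cliffMulForm (n + 1) c.index) hd' hd
  rw [fderiv_linear _ hd, retr_eq_self hr hx.1] at h
  simp only [LinearMap.mul_apply'] at h hT
  refine h.symm.trans ?_
  have hsq := fderiv_bilinear (cliffMulForm (n + 1) c.index) hT hT X
  simp only [LinearMap.mul_apply'] at hsq
  have he : (fun y => reverse (q.lift (retr c r y) : Cliff (n + 1) c.index) * q.lift (retr c r y)
      * (reverse (q.lift (retr c r y) : Cliff (n + 1) c.index) * q.lift (retr c r y)))
      =ᶠ[𝓝 x] fun _ => 1 := by
    filter_upwards [eventually_mem q hr hx] with y hy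
    rcases (isSpinLike_of_mem (q.lift_mem _ hy)).norm with h | h <;> simp [h]
  rw [he.fderiv_eq, fderiv_fun_const, retr_eq_self hr hx.1] at hsq
  simp only [Pi.zero_apply, zero_apply] at hsq
  generalize fderiv ℝ (fun y => reverse (q.lift (retr c r y) : Cliff (n + 1) c.index) *
    q.lift (retr c r y)) x X = T at hsq ⊢
  rcases (isSpinLike_of_mem (q.lift_mem _ hx)).norm with h | h
  · rw [h, one_mul, mul_one] at hsq
    exact eq_zero_of_neg_eq_self (neg_eq_of_add_eq_zero_left hsq.symm)
  · rw [h, neg_one_mul, mul_neg_one] at hsq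
    rw [← neg_eq_zero]
    exact eq_zero_of_neg_eq_self (neg_eq_of_add_eq_zero_left hsq.symm)

theorem frameDeriv_comm (hr : 0 < r) (hx : x ∈ c.carrier n r ∩ q.dom) (X : Vec (n + 1))
    (i : Fin (n + 1)) :
    liftDeriv q x X * vec (n + 1) c.index (e i)
      = vec (n + 1) c.index (q.fullFrame i x) * liftDeriv q x X
        + vec (n + 1) c.index (frameDeriv q i x X) * q.lift x := by
  have hd := differentiableAt_comp_retr hr q.isOpen_dom hx (contDiffOn_lift q)
  have hf := differentiableAt_comp_retr hr q.isOpen_dom hx (contDiffOn_fullFrame q i)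
  have h1 := fderiv_linear (LinearMap.mulRight ℝ (vec (n + 1) c.index (e i))) hd X
  have h2 := fderiv_bilinear ((cliffMulForm (n + 1) c.index).comp (vec (n + 1) c.index)) hf hd X
  simp only [LinearMap.mulRight_apply, LinearMap.comp_apply, LinearMap.mul_apply'] at h1 h2
  have he : (fun y => (q.lift (retr c r y) : Cliff (n + 1) c.index) * vec (n + 1) c.index (e i))
      =ᶠ[𝓝 x] fun y => vec (n + 1) c.index (q.fullFrame i (retr c r y)) * q.lift (retr c r y) := by
    filter_upwards [eventually_mem q hr hx] with y hy
    exact rotatesTo_iff.mp (rotatesTo_fullFrame q hy i)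
  rw [he.fderiv_eq, h2, retr_eq_self hr hx.1] at h1
  exact h1.symm

/-- The scalar products of the frame vectors are constant; differentiating them makes the connection
coefficients skew. -/
theorem sp_frameDeriv (hr : 0 < r) (hx : x ∈ c.carrier n r ∩ q.dom) (X : Vec (n + 1))
    (i l : Fin (n + 1)) :
    sp c.index (frameDeriv q i x X) (q.fullFrame l x)
      = -sp c.index (frameDeriv q l x X) (q.fullFrame i x) := by
  have hi := differentiableAt_comp_retr hr q.isOpen_dom hx (contDiffOn_fullFrame q i)
  have hl := differentiableAt_comp_retr hr q.isOpen_dom hx (contDiffOn_fullFrame q l)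
  have h := fderiv_bilinear (spForm (n + 1) c.index) hi hl X
  have he : (fun y => spForm (n + 1) c.index (q.fullFrame i (retr c r y))
      (q.fullFrame l (retr c r y))) =ᶠ[𝓝 x] fun _ => sp c.index (e i : Vec (n + 1)) (e l) := by
    filter_upwards [eventually_mem q hr hx] with y hy
    exact RotatesTo.sp_eq (rotatesTo_fullFrame q hy i) (rotatesTo_fullFrame q hy l)
  rw [he.fderiv_eq, fderiv_fun_const, retr_eq_self hr hx.1] at h
  simp only [Pi.zero_apply, zero_apply, spForm_apply] at h
  rw [sp_comm (q.fullFrame i x)] at h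
  exact eq_neg_of_add_eq_zero_right h.symm

/-- The logarithmic derivative of the lift of a frame is the bivector of the connection
coefficients of the frame. -/
theorem inv_mul_liftDeriv (hr : 0 < r) (hx : x ∈ c.carrier n r ∩ q.dom) (X : Vec (n + 1)) :
    (((q.lift x)⁻¹ : (Cliff (n + 1) c.index)ˣ) : Cliff (n + 1) c.index) * liftDeriv q x X
      = bivector c.index fun i l => sp c.index (frameDeriv q i x X) (q.fullFrame l x) := by
  have hs := isSpinLike_of_mem (q.lift_mem x hx)
  have hi := isSpinLike_inv hs
  have hw := sp_frameDeriv q hr hx X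
  set g := q.lift x with hg
  set w : Fin (n + 1) → Fin (n + 1) → ℝ :=
    fun i l => sp c.index (frameDeriv q i x X) (q.fullFrame l x) with hwdef
  set θ := ((g⁻¹ : (Cliff (n + 1) c.index)ˣ) : Cliff (n + 1) c.index) * liftDeriv q x X with hθ
  clear_value θ
  have heven : involute θ = θ := by rw [hθ, map_mul, hi.even, involute_liftDeriv q hr hx]
  have hgθ : liftDeriv q x X = g * θ := by rw [hθ, Units.mul_inv_cancel_left]
  have hrev : reverse θ = -θ := by
    have h := reverse_liftDeriv q hr hx X
    rw [hgθ, CliffordAlgebra.reverse.map_mul, ← hg, ← mul_assoc, mul_assoc (reverse θ)] at h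
    rcases hs.norm with h' | h'
    · rw [h', one_mul, mul_one] at h
      exact eq_neg_of_add_eq_zero_right h
    · rw [h', neg_one_mul, mul_neg_one, ← neg_add, neg_eq_zero] at h
      exact eq_neg_of_add_eq_zero_right h
  have hcomm : ∀ i, θ * vec (n + 1) c.index (e i) - vec (n + 1) c.index (e i) * θ
      = ∑ l, (eps c.index l * w i l) • vec (n + 1) c.index (e l) := by
    intro i
    have h1 := frameDeriv_comm q hr hx X i
    have h2 := (eq_sum_of_rotatesTo (rotatesTo_fullFrame q hx) (q.lift_mem x hx)
      (frameDeriv q i x X)).2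
    rw [rotatesTo_iff, map_sum] at h2
    rw [hgθ, hg, ← mul_assoc, ← rotatesTo_iff.mp (rotatesTo_fullFrame q hx i), ← h2, mul_assoc,
      mul_assoc, ← mul_add, Units.mul_right_inj] at h1
    rw [h1, add_sub_cancel_left]
    simp only [map_smul, hwdef]
  -- Both `θ` and the bivector are even and have the same commutators with the basis vectors, so
  -- their difference is a scalar. Both change sign under reversal, so this scalar is `0`.
  obtain ⟨t, ht⟩ := exists_eq_algebraMap_of_graded_central (b := θ - bivector c.index w)
    (fun i => by
      rw [map_sub, heven, involute_bivector, sub_mul, mul_sub, sub_eq_sub_iff_sub_eq_sub, hcomm,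
        bivector_mul_vec_e hw])
  have h1 : reverse (θ - bivector c.index w) = -(θ - bivector c.index w) := by
    rw [map_sub, hrev, reverse_bivector hw]; abel
  rw [ht, CliffordAlgebra.reverse.commutes] at h1
  rw [eq_zero_of_neg_eq_self h1.symm] at ht
  exact sub_eq_zero.mp ht

/-- The connection form of the spinor derivative. -/
def connectionForm (x : Vec (n + 1)) (j : Fin n) : Cliff n 1 :=
  (1 / 2 : ℝ) • ∑ a : Fin n, ∑ b ∈ Finset.Ioi a,
    (eps 1 a * eps 1 b *
      sp c.index (leviCivita q (q.frame a) x (q.frame j x)) (q.frame b x)) •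
    (vec n 1 (e a) * vec n 1 (e b))

theorem sp_leviCivita (hr : 0 < r) (hx : x ∈ c.carrier n r ∩ q.dom) (j a b : Fin n) :
    sp c.index (leviCivita q (q.frame a) x (q.frame j x)) (q.frame b x)
      = sp c.index (frameDeriv q ((c.pos n).succAbove a) x (q.frame j x)) (q.frame b x) := by
  rw [leviCivita, sp_sub_left, sp_smul_left, gauss, sp_smul_left, sp_comm x, sp_frame_self hr q hx,
    mul_zero, mul_zero, sub_zero, tderiv_eq_fderiv hr q hx (q.smooth_frame a)
    (sp_frame_self hr q hx j), frameDeriv, fullFrame_succAbove]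

/-- The Gauss map is linear on the ambient space, so the Weingarten map is a multiple of the
identity. This is where total umbilicity enters. -/
theorem frameDeriv_pos (hr : 0 < r) (hx : x ∈ c.carrier n r ∩ q.dom) (j : Fin n) :
    frameDeriv q (c.pos n) x (q.frame j x) = r⁻¹ • q.frame j x := by
  rw [frameDeriv, fullFrame_pos]
  have h := fderiv_linear (r⁻¹ • LinearMap.id : Vec (n + 1) →ₗ[ℝ] Vec (n + 1))
    (differentiableAt_retr (r := r) (carrier_subset_cone hr hx.1)) (q.frame j x)
  rw [fderiv_retr hr hx.1 (sp_frame_self hr q hx j)] at h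
  exact h

/-- The ambient bivector splits into pairs of tangent vectors, which give the Levi-Civita part, and
pairs with the normal. By umbilicity only the pairs of `s_j` with the normal survive for the
direction `s_j`. -/
theorem inclCliff_connectionForm (hn : 0 < n) (hr : 0 < r) (hx : x ∈ c.carrier n r ∩ q.dom)
    (j : Fin n) :
    inclCliff c n (connectionForm q x j)
      = (((q.lift x)⁻¹ : (Cliff (n + 1) c.index)ˣ) : Cliff (n + 1) c.index)
          * liftDeriv q x (q.frame j x)
        + (c.sign / (2 * r)) • (vec (n + 1) c.index (e ((c.pos n).succAbove j))
          * vec (n + 1) c.index (e (c.pos n))) := by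
  have hw := sp_frameDeriv q hr hx (q.frame j x)
  rw [inv_mul_liftDeriv q hr hx, bivector]
  set w : Fin (n + 1) → Fin (n + 1) → ℝ :=
    fun i l => sp c.index (frameDeriv q i x (q.frame j x)) (q.fullFrame l x) with hwdef
  set V : Fin (n + 1) → Cliff (n + 1) c.index := fun i => vec (n + 1) c.index (e i) with hV
  have hwself : ∀ i, w i i = 0 := fun i => by have := hw i i; simp only [hwdef]; linarith
  have hpa : ∀ a, w (c.pos n) ((c.pos n).succAbove a) = if a = j then eps 1 j * r⁻¹ else 0 := by
    intro a
    simp only [hwdef]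
    rw [frameDeriv_pos q hr hx, sp_smul_left, fullFrame_succAbove, sp_frame_frame q hx]
    by_cases h : a = j
    · simp [h, mul_comm]
    · simp [h, Ne.symm h]
  have hap : ∀ a, w ((c.pos n).succAbove a) (c.pos n) = if a = j then -(eps 1 j * r⁻¹) else 0 := by
    intro a
    rw [show w ((c.pos n).succAbove a) (c.pos n) = -w (c.pos n) ((c.pos n).succAbove a) from
      hw _ _, hpa]
    split_ifs <;> simp
  -- This matches `1/4` over all ordered pairs in the bivector with `1/2` over `a < b` in the
  -- connection form.
  have hsum := sum_sum_eq_two_smul_sum_Ioi (N := n) (F := fun a b =>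
    (eps c.index ((c.pos n).succAbove a) * eps c.index ((c.pos n).succAbove b)
      * w ((c.pos n).succAbove a) ((c.pos n).succAbove b)) •
      (V ((c.pos n).succAbove a) * V ((c.pos n).succAbove b)))
    (fun a b => by
      by_cases hab : a = b
      · rw [hab]
      · rw [show w ((c.pos n).succAbove a) ((c.pos n).succAbove b)
          = -w ((c.pos n).succAbove b) ((c.pos n).succAbove a) from hw _ _, hV]
        simp only
        rw [vec_e_mul_vec_e (fun h => hab (Fin.succAbove_right_injective h)), smul_neg, mul_neg,
          neg_smul, neg_neg, mul_comm (eps c.index ((c.pos n).succAbove a))])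
    (fun a => by rw [hwself, mul_zero, zero_smul])
  have hcross : V (c.pos n) * V ((c.pos n).succAbove j)
      = -(V ((c.pos n).succAbove j) * V (c.pos n)) :=
    vec_e_mul_vec_e (Fin.succAbove_ne _ _).symm
  have hL : inclCliff c n (connectionForm q x j) = (1 / 2 : ℝ) • ∑ a, ∑ b ∈ Finset.Ioi a,
      (eps c.index ((c.pos n).succAbove a) * eps c.index ((c.pos n).succAbove b)
      * w ((c.pos n).succAbove a) ((c.pos n).succAbove b)) •
      (V ((c.pos n).succAbove a) * V ((c.pos n).succAbove b)) := by
    simp only [connectionForm, map_smul, map_sum, map_mul, inclCliff_vec, inclVec_e,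
      sp_leviCivita q hr hx, eps_succAbove, hwdef, fullFrame_succAbove, hV]
  have hR : ∑ i, ∑ l, (eps c.index i * eps c.index l * w i l) • (V i * V l)
      = (2 : ℝ) • ∑ a, ∑ b ∈ Finset.Ioi a,
      (eps c.index ((c.pos n).succAbove a) * eps c.index ((c.pos n).succAbove b)
      * w ((c.pos n).succAbove a) ((c.pos n).succAbove b)) •
      (V ((c.pos n).succAbove a) * V ((c.pos n).succAbove b))
      - (2 * c.sign * r⁻¹) • (V ((c.pos n).succAbove j) * V (c.pos n)) := by
    rw [← hsum, Fin.sum_univ_succAbove _ (c.pos n)]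
    simp only [Fin.sum_univ_succAbove _ (c.pos n), hwself, hpa, hap, Finset.sum_add_distrib]
    simp only [mul_ite, mul_zero, ite_smul, zero_smul, Finset.sum_ite_eq', Finset.mem_univ,
      if_true, zero_add, hcross, eps_pos c n hn, eps_succAbove]
    have he := eps_mul_self 1 j
    have h1 : c.sign * eps 1 j * (eps 1 j * r⁻¹) = c.sign * r⁻¹ := by
      linear_combination (c.sign * r⁻¹) * he
    have h2 : eps 1 j * c.sign * -(eps 1 j * r⁻¹) = -(c.sign * r⁻¹) := by
      linear_combination (-c.sign * r⁻¹) * he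
    rw [h1, h2]
    module
  rw [hL, hR]
  have : c.sign / (2 * r) = 1 / 4 * (2 * c.sign * r⁻¹) := by field_simp; norm_num
  rw [this]
  module

end Point

end Gauge
end

noncomputable section

open Topology Filter

/-! ### Clifford action on spinors -/

section Action
variable {N k : ℕ}

/-- The action of the Clifford algebra on spinors as a real bilinear map. -/
def actForm (N k : ℕ) : Cliff N k →ₗ[ℝ] Spinor N →ₗ[ℝ] Spinor N :=
  LinearMap.mk₂ ℝ (fun a w => (kappa N k a).mulVec w)
    (fun a b w => by rw [map_add, Matrix.add_mulVec])
    (fun t a w => by rw [map_smul, Matrix.smul_mulVec])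
    (fun a v w => Matrix.mulVec_add _ _ _)
    (fun t a w => Matrix.mulVec_smul _ _ _)

theorem actForm_apply (a : Cliff N k) (w : Spinor N) :
    actForm N k a w = (kappa N k a).mulVec w := rfl

theorem actForm_mul (a b : Cliff N k) (w : Spinor N) :
    actForm N k (a * b) w = actForm N k a (actForm N k b w) := by
  simp only [actForm_apply, map_mul, Matrix.mulVec_mulVec]

theorem actForm_one (w : Spinor N) : actForm N k 1 w = w := by
  simp [actForm_apply]

theorem actForm_inv_cancel_left (g : (Cliff N k)ˣ) (w : Spinor N) :
    actForm N k (g⁻¹ : (Cliff N k)ˣ) (actForm N k g w) = w := by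
  rw [← actForm_mul, Units.inv_mul, actForm_one]

theorem actForm_cancel_inv_left (g : (Cliff N k)ˣ) (w : Spinor N) :
    actForm N k g (actForm N k (g⁻¹ : (Cliff N k)ˣ) w) = w := by
  rw [← actForm_mul, Units.mul_inv, actForm_one]

theorem actForm_algebraMap (t : ℝ) (w : Spinor N) :
    actForm N k (algebraMap ℝ (Cliff N k) t) w = t • w := by
  rw [Algebra.algebraMap_eq_smul_one, map_smul, LinearMap.smul_apply, actForm_one]

theorem cmul_eq (x : Vec N) (w : Spinor N) : cmul k x w = actForm N k (vec N k x) w := rfl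

theorem cmul_add_right (x : Vec N) (v w : Spinor N) : cmul k x (v + w) = cmul k x v + cmul k x w :=
  map_add (actForm N k (vec N k x)) v w

theorem cmul_smul_right (x : Vec N) (t : ℝ) (w : Spinor N) : cmul k x (t • w) = t • cmul k x w :=
  map_smul (actForm N k (vec N k x)) t w

theorem cmul_smul_left (x : Vec N) (t : ℝ) (w : Spinor N) : cmul k (t • x) w = t • cmul k x w := by
  rw [cmul_eq, map_smul, map_smul]; rfl

theorem cmul_sum_right {ι : Type*} (s : Finset ι) (x : Vec N) (f : ι → Spinor N) :
    cmul k x (∑ i ∈ s, f i) = ∑ i ∈ s, cmul k x (f i) :=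
  map_sum (actForm N k (vec N k x)) f s

theorem cmul_neg_right (x : Vec N) (w : Spinor N) : cmul k x (-w) = -cmul k x w :=
  map_neg (actForm N k (vec N k x)) w

theorem cmul_cmul_self (x : Vec N) (w : Spinor N) : cmul k x (cmul k x w) = (-sp k x x) • w := by
  rw [cmul_eq, cmul_eq, ← actForm_mul, vec_mul_self, actForm_algebraMap]

theorem cmul_cmul_of_sp_eq_zero {x y : Vec N} (h : sp k x y = 0) (w : Spinor N) :
    cmul k x (cmul k y w) = -cmul k y (cmul k x w) := by
  rw [cmul_eq, cmul_eq, ← actForm_mul, vec_mul_vec_of_sp_eq_zero h, map_neg, LinearMap.neg_apply,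
    actForm_mul]
  rfl

theorem actForm_vec_of_rotatesTo {g : (Cliff N k)ˣ} {x y : Vec N} (h : RotatesTo g x y)
    (w : Spinor N) : actForm N k g (cmul k x w) = cmul k y (actForm N k g w) := by
  rw [cmul_eq, cmul_eq, ← actForm_mul, ← actForm_mul, rotatesTo_iff.mp h]

end Action

/-! ### The twistor equation in the ambient trivialization -/

section Twistor
variable {c : SpaceForm} {n : ℕ} {r : ℝ}

attribute [local instance] cliffNormedAddCommGroup cliffNormedSpace

/-- A linear map from the spinor module of `ℝ^{n,1}` to the one of the ambient space that commutes
with the even products of basis vectors. -/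
def IsEvenEquivariant (c : SpaceForm) (n : ℕ) (I : Spinor n →ₗ[ℂ] Spinor (n + 1)) : Prop :=
  ∀ a b : Fin n, ∀ w, I (cmul 1 (e a) (cmul 1 (e b) w))
    = cmul c.index (e ((c.pos n).succAbove a)) (cmul c.index (e ((c.pos n).succAbove b)) (I w))

theorem map_real_smul {V W : Type*} [AddCommGroup V] [Module ℂ V] [AddCommGroup W] [Module ℂ W]
    (I : V →ₗ[ℂ] W) (t : ℝ) (w : V) : I (t • w) = t • I w :=
  LinearMap.map_smul_of_tower I t w

theorem spinorDeriv_eq (hr : 0 < r) (q : LocalSection c n r) {x : Vec (n + 1)}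
    (hx : x ∈ c.carrier n r ∩ q.dom) {f : SpinFrame c n r → Spinor n}
    (hf : ContDiffOn ℝ ∞ (q.pull f) (c.carrier n r ∩ q.dom)) (j : Fin n) :
    spinorDeriv q f x j = fderiv ℝ (fun y => q.pull f (retr c r y)) x (q.frame j x)
      + actForm n 1 (connectionForm q x j) (q.pull f x) := by
  rw [spinorDeriv, tderiv_eq_fderiv hr q hx hf (sp_frame_self hr q hx j)]
  simp only [connectionForm, map_smul, map_sum, LinearMap.smul_apply, LinearMap.sum_apply,
    actForm_mul, cmul_eq]

theorem map_actForm_connectionForm {I : Spinor n →ₗ[ℂ] Spinor (n + 1)}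
    (hI : IsEvenEquivariant c n I) (q : LocalSection c n r) (x : Vec (n + 1)) (j : Fin n)
    (w : Spinor n) : I (actForm n 1 (connectionForm q x j) w)
      = actForm (n + 1) c.index (inclCliff c n (connectionForm q x j)) (I w) := by
  simp only [connectionForm, map_smul, map_sum, LinearMap.smul_apply, LinearMap.sum_apply,
    actForm_mul, map_mul, inclCliff_vec, inclVec_e, map_real_smul, ← cmul_eq, hI _ _ _]

/-- Applying `g⁻¹` to the Leibniz rule for `φ = g · I(f)` gives `g⁻¹ dφ = I(df) + g⁻¹ dg · I(f)`,
and the connection form is `g⁻¹ dg` plus the umbilic term. -/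
theorem map_spinorDeriv (hn : 0 < n) (hr : 0 < r) {I : Spinor n →ₗ[ℂ] Spinor (n + 1)}
    (hI : IsEvenEquivariant c n I) (q : LocalSection c n r) {x : Vec (n + 1)}
    (hx : x ∈ c.carrier n r ∩ q.dom) {f : SpinFrame c n r → Spinor n}
    (hf : ContDiffOn ℝ ∞ (q.pull f) (c.carrier n r ∩ q.dom)) {φ : Vec (n + 1) → Spinor (n + 1)}
    (hφ : ∀ y ∈ c.carrier n r ∩ q.dom,
      φ y = actForm (n + 1) c.index (q.lift y : Cliff (n + 1) c.index) (I (q.pull f y)))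
    (j : Fin n) :
    I (spinorDeriv q f x j)
      = actForm (n + 1) c.index ((q.lift x)⁻¹ : (Cliff (n + 1) c.index)ˣ)
          (fderiv ℝ (fun y => φ (retr c r y)) x (q.frame j x))
        + (c.sign / (2 * r)) • cmul c.index (e ((c.pos n).succAbove j))
            (cmul c.index (e (c.pos n)) (I (q.pull f x))) := by
  have hdf := differentiableAt_comp_retr hr q.isOpen_dom hx hf
  have hdI := differentiableAt_linear (I.restrictScalars ℝ) hdf
  have hdg := differentiableAt_comp_retr hr q.isOpen_dom hx (contDiffOn_lift q)
  have h := fderiv_bilinear (actForm (n + 1) c.index) hdg hdI (q.frame j x)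
  rw [fderiv_linear _ hdf, retr_eq_self hr hx.1] at h
  have he : (fun y => φ (retr c r y)) =ᶠ[𝓝 x] fun y => actForm (n + 1) c.index
      (q.lift (retr c r y) : Cliff (n + 1) c.index) (I.restrictScalars ℝ (q.pull f (retr c r y))) := by
    filter_upwards [eventually_mem q hr hx] with y hy
    exact hφ _ hy
  rw [he.fderiv_eq, h, map_add, actForm_inv_cancel_left, ← actForm_mul, spinorDeriv_eq hr q hx hf,
    map_add, map_actForm_connectionForm hI, inclCliff_connectionForm q hn hr hx, map_add,
    LinearMap.add_apply, map_smul, LinearMap.smul_apply, actForm_mul _ (vec (n + 1) c.index _)]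
  simp only [LinearMap.restrictScalars_apply, cmul_eq]
  rw [add_assoc]
  rfl

theorem sum_eps_cmul_cmul_e (w : Spinor (n + 1)) :
    ∑ a : Fin n, eps 1 a • cmul c.index (e ((c.pos n).succAbove a))
      (cmul c.index (e ((c.pos n).succAbove a)) w) = -(n : ℝ) • w := by
  simp only [cmul_cmul_self, sp_e_e_self, eps_succAbove, smul_smul, mul_neg, eps_mul_self]
  rw [Finset.sum_const, Finset.card_univ, Fintype.card_fin, ← Nat.cast_smul_eq_nsmul ℝ, smul_smul]
  simp

/-- The twistor equation at a point: the ambient derivative in the tangent directions is a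
Clifford multiplication. -/
theorem twistorOp_eq_zero_iff (hn : 0 < n) (hr : 0 < r) {I : Spinor n →ₗ[ℂ] Spinor (n + 1)}
    (hI : IsEvenEquivariant c n I) (hinj : Function.Injective I) (q : LocalSection c n r)
    {x : Vec (n + 1)} (hx : x ∈ c.carrier n r ∩ q.dom) {f : SpinFrame c n r → Spinor n}
    (hf : ContDiffOn ℝ ∞ (q.pull f) (c.carrier n r ∩ q.dom)) {φ : Vec (n + 1) → Spinor (n + 1)}
    (hφ : ∀ y ∈ c.carrier n r ∩ q.dom,
      φ y = actForm (n + 1) c.index (q.lift y : Cliff (n + 1) c.index) (I (q.pull f y))) :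
    twistorOp q f x = 0 ↔ ∃ χ : Spinor (n + 1), ∀ j,
      fderiv ℝ (fun y => φ (retr c r y)) x (q.frame j x) = cmul c.index (q.frame j x) χ := by
  set E : Fin n → Spinor (n + 1) → Spinor (n + 1) :=
    fun j w => cmul c.index (e ((c.pos n).succAbove j)) w with hE
  set η := (c.sign / (2 * r)) • cmul c.index (e (c.pos n)) (I (q.pull f x)) with hη
  set d : Fin n → Spinor (n + 1) := fun j =>
    actForm (n + 1) c.index ((q.lift x)⁻¹ : (Cliff (n + 1) c.index)ˣ)
      (fderiv ℝ (fun y => φ (retr c r y)) x (q.frame j x)) with hd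
  have hD : ∀ j, I (spinorDeriv q f x j) = d j + E j η := fun j => by
    rw [map_spinorDeriv hn hr hI q hx hf hφ, hE, hη]
    simp only [cmul_smul_right, hd]
  -- The projection contains Clifford multiplications only in pairs, so compatibility of `I` with
  -- even products suffices.
  have hT : ∀ j, I (twistorOp q f x j) = eps 1 j • ((d j + E j η)
      + (1 / n : ℝ) • E j (∑ a, eps 1 a • E a (d a + E a η))) := fun j => by
    rw [twistorOp, projKer, cliffMul, map_add, map_real_smul, map_real_smul, hD, cmul_sum_right,
      map_sum, smul_add _ (d j + E j η), smul_smul, mul_comm (1 / n : ℝ)]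
    congr 2
    simp only [cmul_smul_right, map_real_smul, hI _ _ _, hD, hE, cmul_sum_right]
  have hpt : ∀ χ j, d j = E j (actForm (n + 1) c.index ((q.lift x)⁻¹ : (Cliff (n + 1) c.index)ˣ) χ) ↔
      fderiv ℝ (fun y => φ (retr c r y)) x (q.frame j x) = cmul c.index (q.frame j x) χ := by
    intro χ j
    have hrot := actForm_vec_of_rotatesTo (q.tangent x hx j)
      (actForm (n + 1) c.index ((q.lift x)⁻¹ : (Cliff (n + 1) c.index)ˣ) χ)
    rw [actForm_cancel_inv_left] at hrot
    rw [← hrot]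
    constructor
    · intro h
      rw [← actForm_cancel_inv_left (q.lift x) (fderiv ℝ (fun y => φ (retr c r y)) x (q.frame j x))]
      exact congrArg _ h
    · intro h
      simp only [hd, h, actForm_inv_cancel_left, hE]
  have hEadd : ∀ j v w, E j (v + w) = E j v + E j w := fun j v w => cmul_add_right _ _ _
  have hEsmul : ∀ j (t : ℝ) w, E j (t • w) = t • E j w := fun j t w => cmul_smul_right _ _ _
  have hsum : ∀ w, ∑ a : Fin n, eps 1 a • E a (E a w) = -(n : ℝ) • w := fun w =>
    sum_eps_cmul_cmul_e w
  have hn' : (n : ℝ) ≠ 0 := by positivity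
  constructor
  · intro h
    -- The vanishing of the projection expresses `d j` as `E j` of one spinor independent of `j`;
    -- applying the lift transports this spinor to the ambient point.
    refine ⟨actForm (n + 1) c.index (q.lift x) (-(η + (1 / n : ℝ) •
      ∑ a, eps 1 a • E a (d a + E a η))), fun j => (hpt _ j).mp ?_⟩
    rw [actForm_inv_cancel_left]
    have h1 := hT j
    rw [h, Pi.zero_apply, map_zero] at h1
    have h2 := (smul_eq_zero.mp h1.symm).resolve_left (eps_ne_zero 1 j)
    have hEneg : ∀ w, E j (-w) = -E j w := fun w => cmul_neg_right _ _
    rw [hEneg, hEadd, hEsmul _ (1 / n : ℝ), ← add_eq_zero_iff_eq_neg, ← h2, add_assoc]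
  · rintro ⟨χ, hχ⟩
    set χ' := actForm (n + 1) c.index ((q.lift x)⁻¹ : (Cliff (n + 1) c.index)ˣ) χ
    have hdχ : ∀ j, d j = E j χ' := fun j => (hpt χ j).mpr (hχ j)
    funext j
    apply hinj
    rw [hT, Pi.zero_apply, map_zero]
    simp only [hdχ, ← hEadd, hsum, hEsmul, smul_smul]
    -- The contraction `∑ ε_a E_a E_a = -n` meets the factor `1/n` of the projection.
    rw [show (1 / n : ℝ) * -n = -1 by field_simp]
    simp

end Twistor
end

noncomputable section

open Topology Filter

/-! ### Connectedness of the cone -/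

section Connected
variable {c : SpaceForm} {n : ℕ}

/-- The projection onto the coordinates on which the form `sign · ⟨·,·⟩` is positive. -/
def posPart (c : SpaceForm) {n : ℕ} (y : Vec (n + 1)) : Vec (n + 1) :=
  fun j => if c.sign * eps c.index j = 1 then y j else 0

theorem sign_mul_eps (c : SpaceForm) {n : ℕ} (j : Fin (n + 1)) :
    c.sign * eps c.index j = 1 ∨ c.sign * eps c.index j = -1 := by
  apply mul_self_eq_one_iff.mp
  linear_combination (c.sign * c.sign) * eps_mul_self c.index j + sign_mul_self c

theorem sign_mul_sp_self (y : Vec (n + 1)) :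
    c.sign * sp c.index y y = ∑ j, (c.sign * eps c.index j) * (y j * y j) := by
  rw [sp, Finset.mul_sum]
  exact Finset.sum_congr rfl fun j _ => by ring

/-- Moving towards `posPart` only shrinks the coordinates that contribute negatively. -/
theorem mem_cone_of_mem_segment {y : Vec (n + 1)} (hy : y ∈ cone c n) {z : Vec (n + 1)}
    (hz : z ∈ segment ℝ (posPart c y) y) : z ∈ cone c n := by
  have hy' : 0 < c.sign * sp c.index y y := hy
  obtain ⟨s, t, hs, ht, hst, rfl⟩ := hz
  change 0 < c.sign * sp c.index (s • posPart c y + t • y) (s • posPart c y + t • y)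
  refine hy'.trans_le ?_
  rw [sign_mul_sp_self, sign_mul_sp_self]
  refine Finset.sum_le_sum fun j _ => ?_
  simp only [Pi.add_apply, Pi.smul_apply, smul_eq_mul, posPart]
  rcases sign_mul_eps c j with h | h
  · rw [if_pos h, h, ← add_mul, hst, one_mul, one_mul, one_mul]
  · rw [if_neg (by rw [h]; norm_num), h, mul_zero, zero_add]
    have ht1 : t ≤ 1 := by linarith
    nlinarith [mul_self_nonneg (y j), mul_nonneg ht (mul_self_nonneg (y j))]

/-- The embedding of the positive coordinates. -/
def posIncl (c : SpaceForm) (n : ℕ) :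
    ({j : Fin (n + 1) // c.sign * eps c.index j = 1} → ℝ) →ₗ[ℝ] Vec (n + 1) where
  toFun z := fun j => if h : c.sign * eps c.index j = 1 then z ⟨j, h⟩ else 0
  map_add' x y := by ext j; by_cases h : c.sign * eps c.index j = 1 <;> simp [h]
  map_smul' a x := by ext j; by_cases h : c.sign * eps c.index j = 1 <;> simp [h]

theorem posIncl_mem_cone {z : {j : Fin (n + 1) // c.sign * eps c.index j = 1} → ℝ}
    (hz : z ≠ 0) : posIncl c n z ∈ cone c n := by
  obtain ⟨⟨i, hi⟩, hzi⟩ := Function.ne_iff.mp hz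
  change 0 < c.sign * sp c.index (posIncl c n z) (posIncl c n z)
  rw [sign_mul_sp_self]
  refine Finset.sum_pos' (fun j _ => ?_) ⟨i, Finset.mem_univ _, ?_⟩
  · by_cases h : c.sign * eps c.index j = 1
    · rw [h, one_mul]; exact mul_self_nonneg _
    · simp [posIncl, h]
  · rw [hi, one_mul]
    have : posIncl c n z i = z ⟨i, hi⟩ := dif_pos hi
    rw [this]
    exact mul_self_pos.mpr hzi

theorem one_lt_card_pos (hn : 2 ≤ n) :
    1 < Fintype.card {j : Fin (n + 1) // c.sign * eps c.index j = 1} := by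
  rw [Fintype.one_lt_card_iff]
  cases c
  · refine ⟨⟨⟨1, by omega⟩, ?_⟩, ⟨⟨2, by omega⟩, ?_⟩, fun h => ?_⟩
    · simp [SpaceForm.sign, SpaceForm.index, eps]
    · simp [SpaceForm.sign, SpaceForm.index, eps]
    · simpa using congrArg (fun j => ((j.1 : Fin (n + 1)) : ℕ)) h
  · refine ⟨⟨⟨0, by omega⟩, ?_⟩, ⟨⟨1, by omega⟩, ?_⟩, fun h => ?_⟩
    · simp [SpaceForm.sign, SpaceForm.index, eps]
    · simp [SpaceForm.sign, SpaceForm.index, eps]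
    · simpa using congrArg (fun j => ((j.1 : Fin (n + 1)) : ℕ)) h

/-- Every point is joined by a segment to the positive coordinate subspace without the origin. That
set is connected because at least two coordinates are positive. -/
theorem isPreconnected_cone (hn : 2 ≤ n) : IsPreconnected (cone c n) := by
  have hcard := one_lt_card_pos (c := c) hn
  set P := {j : Fin (n + 1) // c.sign * eps c.index j = 1} with hP
  have hrank : 1 < Module.rank ℝ (P → ℝ) := by
    rw [rank_fun']
    exact_mod_cast hcard
  have hL : IsPreconnected (posIncl c n '' {0}ᶜ) :=
    (isConnected_compl_singleton_of_one_lt_rank hrank 0).isPreconnected.image _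
      (LinearMap.continuous_of_finiteDimensional (posIncl c n)).continuousOn
  have hLc : posIncl c n '' {0}ᶜ ⊆ cone c n := by
    rintro _ ⟨z, hz, rfl⟩
    exact posIncl_mem_cone hz
  obtain ⟨i⟩ : Nonempty P := Fintype.card_pos_iff.mp (zero_lt_one.trans hcard)
  have h1 : (fun _ : P => (1 : ℝ)) ≠ 0 := fun h => one_ne_zero (congrFun h i)
  refine isPreconnected_of_forall (posIncl c n fun _ => 1) fun y hy => ?_
  have hpp : posPart c y = posIncl c n fun j => y j := by
    ext j
    by_cases h : c.sign * eps c.index j = 1 <;> simp [posPart, posIncl, h]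
  have hmem : posPart c y ∈ posIncl c n '' {0}ᶜ := by
    refine ⟨_, ?_, hpp.symm⟩
    intro h0
    rw [Set.mem_singleton_iff] at h0
    have hc : posPart c y ∈ cone c n :=
      mem_cone_of_mem_segment hy (left_mem_segment ℝ _ _)
    rw [hpp, h0, map_zero] at hc
    have hc' : 0 < c.sign * sp c.index (0 : Vec (n + 1)) 0 := hc
    rw [sp_zero_left, mul_zero] at hc'
    exact lt_irrefl _ hc'
  refine ⟨posIncl c n '' {0}ᶜ ∪ segment ℝ (posPart c y) y, ?_, Or.inl ⟨_, h1, rfl⟩,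
    Or.inr (right_mem_segment ℝ _ _), ?_⟩
  · exact Set.union_subset hLc fun z hz => mem_cone_of_mem_segment hy hz
  · exact hL.union _ hmem (left_mem_segment ℝ _ _) (convex_segment _ _).isPreconnected

end Connected

/-! ### Integration of the equation `dφ(X) = X · χ` -/

section Integration
variable {c : SpaceForm} {n : ℕ} {r : ℝ}

theorem minSmoothness_le_infty : minSmoothness ℝ 2 ≤ ∞ := by
  rw [minSmoothness_of_isRCLikeNormedField]
  exact WithTop.coe_le_coe.mpr (le_top : (2 : ℕ∞) ≤ ⊤)

/-- Put `B i = t_i · A_i` and let `q i` be the norm of `t_i`. Symmetry and anticommutation give `q_i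
B_j = -q_j B_i`, that is, `B_i / q_i` changes sign whenever the index changes. Going around a cycle
of three indices gives `B_0 = -B_0`, and `t_0` acts injectively. -/
theorem eq_zero_of_cmul_symm {N k : ℕ} {t A : Fin 3 → _} (hq : ∀ i, sp k (t i : Vec N) (t i) ≠ 0)
    (ht : ∀ i j, i ≠ j → sp k (t i) (t j) = 0)
    (hA : ∀ i j, cmul k (t i) (A j) = cmul k (t j) (A i : Spinor N)) : A 0 = 0 := by
  have h : ∀ i j, i ≠ j → sp k (t i) (t i) • cmul k (t j) (A j)
      = -(sp k (t j) (t j) • cmul k (t i) (A i)) := by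
    intro i j hij
    have h1 : cmul k (t i) (cmul k (t j) (cmul k (t i) (A j)))
        = -(sp k (t j) (t j) • cmul k (t i) (A i)) := by
      rw [hA i j, cmul_cmul_self, cmul_smul_right, neg_smul]
    have h2 : cmul k (t i) (cmul k (t j) (cmul k (t i) (A j)))
        = sp k (t i) (t i) • cmul k (t j) (A j) := by
      rw [cmul_cmul_of_sp_eq_zero (ht i j hij), cmul_cmul_self, cmul_smul_right, neg_smul, neg_neg]
    rw [← h1, h2]
  have h01 := h 0 1 (by decide)
  have h12 := h 1 2 (by decide)
  have h02 := h 0 2 (by decide)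
  set B : Fin 3 → Spinor N := fun i => cmul k (t i) (A i) with hB
  set q : Fin 3 → ℝ := fun i => sp k (t i) (t i) with hqdef
  change q 0 • B 1 = -(q 1 • B 0) at h01
  change q 1 • B 2 = -(q 2 • B 1) at h12
  change q 0 • B 2 = -(q 2 • B 0) at h02
  have e1 : (q 0 * q 1) • B 2 = (q 1 * q 2) • B 0 := by
    have : (q 0 * q 1) • B 2 = -(q 2 • (q 0 • B 1)) := by
      rw [mul_smul, h12]; module
    rw [this, h01]; module
  have e2 : (q 0 * q 1) • B 2 = -((q 1 * q 2) • B 0) := by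
    rw [mul_comm, mul_smul, h02]; module
  have e3 : (2 * (q 1 * q 2)) • B 0 = 0 := by
    rw [mul_smul, two_smul]
    nth_rewrite 1 [← e1]
    rw [e2]; exact neg_add_cancel _
  have hB0 : B 0 = 0 := (smul_eq_zero.mp e3).resolve_left
    (mul_ne_zero two_ne_zero (mul_ne_zero (hq 1) (hq 2)))
  have h3 := cmul_cmul_self (k := k) (t 0) (A 0)
  rw [show cmul k (t 0) (A 0) = 0 from hB0] at h3
  rw [show cmul k (t 0) (0 : Spinor N) = 0 from map_zero (actForm N k (vec N k (t 0)))] at h3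
  exact (smul_eq_zero.mp h3.symm).resolve_left (neg_ne_zero.mpr (hq 0))

theorem eq_sum_frame (q : LocalSection c n r) {x : Vec (n + 1)}
    (hx : x ∈ c.carrier n r ∩ q.dom) {X : Vec (n + 1)} (hX : sp c.index X x = 0) :
    X = ∑ a, (eps 1 a * sp c.index X (q.frame a x)) • q.frame a x := by
  have h := (eq_sum_of_rotatesTo (rotatesTo_fullFrame q hx) (q.lift_mem x hx) X).1
  rw [Fin.sum_univ_succAbove _ (c.pos n), fullFrame_pos, gauss, sp_smul_right, hX] at h
  simpa only [mul_zero, zero_smul, zero_add, fullFrame_succAbove, eps_succAbove] using h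

/-- The retraction is idempotent, so derivatives on the whole cone are determined by tangential
derivatives on the hypersurface. -/
theorem fderiv_comp_retr {W : Type*} [NormedAddCommGroup W] [NormedSpace ℝ W] (hr : 0 < r)
    {h : Vec (n + 1) → W}
    (hd : DifferentiableOn ℝ (fun y => h (retr c r y)) (cone c n)) {y : Vec (n + 1)}
    (hy : y ∈ cone c n) (Z : Vec (n + 1)) :
    fderiv ℝ (fun y => h (retr c r y)) y Z
      = fderiv ℝ (fun y => h (retr c r y)) (retr c r y) (fderiv ℝ (retr c r) y Z) := by
  have h1 := (hd.differentiableAt (isOpen_cone.mem_nhds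
    (carrier_subset_cone hr (retr_mem (r := r) hy)))).hasFDerivAt
  have h2 := h1.comp y (differentiableAt_retr hy).hasFDerivAt
  have he : (fun y => h (retr c r y)) =ᶠ[𝓝 y] (fun y => h (retr c r y)) ∘ retr c r := by
    filter_upwards [isOpen_cone.mem_nhds hy] with z hz
    simp only [Function.comp_apply]
    rw [retr_eq_self hr (retr_mem hz)]
  rw [he.fderiv_eq, h2.fderiv]
  rfl

/-- A solution of the twistor equation on the hypersurface is the restriction of `u + x · v`. -/
theorem exists_eq_psi (hn : 3 ≤ n) (hr : 0 < r) {φ : Vec (n + 1) → Spinor (n + 1)}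
    (hφ : ContDiffOn ℝ ∞ (fun y => φ (retr c r y)) (cone c n))
    (h : ∀ x ∈ c.carrier n r, ∃ χ : Spinor (n + 1), ∀ X, sp c.index X x = 0 →
      fderiv ℝ (fun y => φ (retr c r y)) x X = cmul c.index X χ) :
    ∃ u v : Spinor (n + 1), ∀ x ∈ c.carrier n r, φ x = psi c.index u v x := by
  choose! χ hχ using h
  set Φ : Vec (n + 1) → Spinor (n + 1) := fun y => φ (retr c r y) with hΦ
  set K : Vec (n + 1) → Spinor (n + 1) := fun y => χ (retr c r y) with hK
  set B := (actForm (n + 1) c.index).comp (vec (n + 1) c.index) with hB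
  have hBapp : ∀ X w, B X w = cmul c.index X w := fun X w => rfl
  have hdΦ : DifferentiableOn ℝ Φ (cone c n) := hφ.differentiableOn (by simp)
  have hfderiv : ∀ y ∈ cone c n, ∀ Z, fderiv ℝ Φ y Z = B (fderiv ℝ (retr c r) y Z) (K y) := by
    intro y hy Z
    rw [fderiv_comp_retr hr hdΦ hy]
    exact hχ _ (retr_mem hy) _ (sp_fderiv_retr hy Z)
  have hφ' : ContDiffOn ℝ ∞ (fderiv ℝ Φ) (cone c n) :=
    hφ.fderiv_of_isOpen isOpen_cone (by simp)
  have hK' : DifferentiableOn ℝ K (cone c n) := by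
    intro y₀ hy₀
    obtain ⟨q, hq⟩ := exists_localSection (by omega : 0 < n) hr (retr_mem (r := r) hy₀)
    let a : Fin n := ⟨0, by omega⟩
    have hs := contDiffOn_comp_retr (q.smooth_frame a)
    have hopen : cone c n ∩ {y | retr c r y ∈ q.dom} ∈ 𝓝 y₀ := by
      filter_upwards [isOpen_cone.mem_nhds hy₀,
        (differentiableAt_retr hy₀).continuousAt.eventually (q.isOpen_dom.mem_nhds hq)] with y h1 h2
      exact ⟨h1, h2⟩
    have hfd : ContDiffOn ℝ ∞ (fun y => fderiv ℝ Φ (retr c r y))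
        (cone c n ∩ {y | retr c r y ∈ q.dom}) :=
      hφ'.comp (contDiffOn_retr.mono Set.inter_subset_left)
        fun y hy => carrier_subset_cone hr (retr_mem hy.1)
    have hsm := contDiffOn_linear (((-eps 1 a) • LinearMap.id : Spinor (n + 1) →ₗ[ℝ] Spinor (n + 1)))
      (contDiffOn_bilinear B hs (hfd.clm_apply hs))
    -- A unit tangent vector satisfies `s_a · s_a · χ = -ε_a χ`, so `χ = -ε_a s_a · dΦ(s_a)`. The
    -- pointwise choice of `χ` is therefore forced and smooth.
    have he : K =ᶠ[𝓝 y₀] fun y => ((-eps 1 a) • LinearMap.id : Spinor (n + 1) →ₗ[ℝ] Spinor (n + 1))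
        (B (q.frame a (retr c r y)) (fderiv ℝ Φ (retr c r y) (q.frame a (retr c r y)))) := by
      filter_upwards [hopen] with y hy
      have hm : retr c r y ∈ c.carrier n r ∩ q.dom := ⟨retr_mem hy.1, hy.2⟩
      rw [hχ _ hm.1 _ (sp_frame_self hr q hm a), hBapp, cmul_cmul_self, sp_frame_frame q hm,
        if_pos rfl, LinearMap.smul_apply, LinearMap.id_apply, smul_smul, neg_mul_neg, eps_mul_self,
        one_smul]
    exact (((hsm.contDiffAt hopen).differentiableAt (by simp)).congr_of_eventuallyEq
      he).differentiableWithinAt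
  have hsymm : ∀ x ∈ c.carrier n r, ∀ X Y, sp c.index X x = 0 → sp c.index Y x = 0 →
      cmul c.index X (fderiv ℝ K x Y) = cmul c.index Y (fderiv ℝ K x X) := by
    intro x hx X Y hX hY
    have hxc := carrier_subset_cone hr hx
    have hnx := isOpen_cone.mem_nhds hxc
    have hKx := hK'.differentiableAt hnx
    have hretr' : DifferentiableAt ℝ (fderiv ℝ (retr c r)) x :=
      ((contDiffOn_retr.fderiv_of_isOpen (m := ∞) isOpen_cone (by simp)).contDiffAt
        hnx).differentiableAt (by simp)
    have hΦ' : DifferentiableAt ℝ (fderiv ℝ Φ) x :=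
      (hφ'.contDiffAt hnx).differentiableAt (by simp)
    have hs1 : IsSymmSndFDerivAt ℝ Φ x := (hφ.contDiffAt hnx).isSymmSndFDerivAt minSmoothness_le_infty
    have hs2 : IsSymmSndFDerivAt ℝ (retr c r) x :=
      (contDiffOn_retr.contDiffAt hnx).isSymmSndFDerivAt minSmoothness_le_infty
    -- The equation is differentiated once more. The term with the second derivative of the
    -- retraction is symmetric and cancels below.
    have key : ∀ Y Z, fderiv ℝ (fderiv ℝ Φ) x Y Z = B (fderiv ℝ (retr c r) x Z) (fderiv ℝ K x Y)
        + B (fderiv ℝ (fderiv ℝ (retr c r)) x Y Z) (K x) := by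
      intro Y Z
      have e1 : fderiv ℝ (fun y => fderiv ℝ Φ y Z) x Y = fderiv ℝ (fderiv ℝ Φ) x Y Z := by
        rw [fderiv_clm_apply hΦ' (differentiableAt_const Z)]; simp
      have e2 : fderiv ℝ (fun y => fderiv ℝ (retr c r) y Z) x Y
          = fderiv ℝ (fderiv ℝ (retr c r)) x Y Z := by
        rw [fderiv_clm_apply hretr' (differentiableAt_const Z)]; simp
      have e3 : (fun y => fderiv ℝ Φ y Z) =ᶠ[𝓝 x]
          fun y => B (fderiv ℝ (retr c r) y Z) (K y) := by
        filter_upwards [hnx] with y hy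
        exact hfderiv y hy Z
      rw [← e1, ← e2, e3.fderiv_eq]
      exact fderiv_bilinear B (hretr'.clm_apply (differentiableAt_const Z)) hKx Y
    have h1 := hs1 Y X
    rw [key, key, hs2 Y X, fderiv_retr hr hx hX, fderiv_retr hr hx hY] at h1
    exact add_right_cancel h1
  have hK0 : ∀ x ∈ c.carrier n r, ∀ X, sp c.index X x = 0 → fderiv ℝ K x X = 0 := by
    intro x hx X hX
    obtain ⟨q, hq⟩ := exists_localSection (by omega : 0 < n) hr hx
    have hxq : x ∈ c.carrier n r ∩ q.dom := ⟨hx, hq⟩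
    have hframe : ∀ a, fderiv ℝ K x (q.frame a x) = 0 := by
      intro a
      -- Three different frame vectors are needed: here `n ≥ 3` is essential.
      obtain ⟨b, hb⟩ : ∃ b : Fin n, b ≠ a :=
        Fintype.exists_ne_of_one_lt_card (by rw [Fintype.card_fin]; omega) a
      obtain ⟨d, hd⟩ : ∃ d : Fin n, d ∉ ({a, b} : Finset (Fin n)) := by
        by_contra! hall
        have hc := Finset.card_le_card (fun d _ => hall d : Finset.univ ⊆ ({a, b} : Finset (Fin n)))
        rw [Finset.card_univ, Fintype.card_fin] at hc
        have := Finset.card_le_two (a := a) (b := b)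
        omega
      simp only [Finset.mem_insert, Finset.mem_singleton, not_or] at hd
      let ι : Fin 3 → Fin n := ![a, b, d]
      have hι : ∀ i j, i ≠ j → ι i ≠ ι j := by
        intro i j hij
        fin_cases i <;> fin_cases j <;>
          first
          | exact absurd rfl hij
          | simp [ι, hb, hb.symm, hd.1, hd.2, Ne.symm hd.1, Ne.symm hd.2]
      refine eq_zero_of_cmul_symm (k := c.index) (t := fun i => q.frame (ι i) x)
        (A := fun i => fderiv ℝ K x (q.frame (ι i) x)) (fun i => ?_) (fun i j hij => ?_)
        (fun i j => ?_)
      · rw [sp_frame_frame q hxq, if_pos rfl]; exact eps_ne_zero _ _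
      · rw [sp_frame_frame q hxq, if_neg (hι i j hij)]
      · exact hsymm x hx _ _ (sp_frame_self hr q hxq _) (sp_frame_self hr q hxq _)
    rw [eq_sum_frame q hxq hX, map_sum]
    exact Finset.sum_eq_zero fun a _ => by rw [map_smul, hframe, smul_zero]
  have hKconst : Set.EqOn (fderiv ℝ K) 0 (cone c n) := by
    intro y hy
    ext1 Z
    rw [fderiv_comp_retr hr hK' hy]
    exact hK0 _ (retr_mem hy) _ (sp_fderiv_retr hy Z)
  have hpre : IsPreconnected (cone c n) := isPreconnected_cone (by omega)
  obtain ⟨v, hv⟩ := isOpen_cone.exists_is_const_of_fderiv_eq_zero hpre hK' hKconst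
  have hdR : ∀ y ∈ cone c n, DifferentiableAt ℝ (fun y => B.flip v (retr c r y)) y :=
    fun y hy => differentiableAt_linear _ (differentiableAt_retr hy)
  have hdiff : DifferentiableOn ℝ (fun y => Φ y - B.flip v (retr c r y)) (cone c n) :=
    hdΦ.sub fun y hy => (hdR y hy).differentiableWithinAt
  have hzero : Set.EqOn (fderiv ℝ fun y => Φ y - B.flip v (retr c r y)) 0 (cone c n) := by
    intro y hy
    ext1 Z
    rw [fderiv_fun_sub (hdΦ.differentiableAt (isOpen_cone.mem_nhds hy)) (hdR y hy),
      sub_apply, fderiv_linear _ (differentiableAt_retr hy), hfderiv y hy, hv y hy]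
    simp
  obtain ⟨u, hu⟩ := isOpen_cone.exists_is_const_of_fderiv_eq_zero hpre hdiff hzero
  refine ⟨u, v, fun x hx => ?_⟩
  have h1 := hu x (carrier_subset_cone hr hx)
  simp only [hΦ, retr_eq_self hr hx] at h1
  rw [psi, ← h1]
  exact (sub_add_cancel _ _).symm

end Integration
end

noncomputable section

open CliffordAlgebra (involute reverse)
open Topology Filter

/-! ### Twistor spinors as restrictions of `ψ_{u,v}` -/

section Main
variable {c : SpaceForm} {n : ℕ} {r : ℝ}

attribute [local instance] cliffNormedAddCommGroup cliffNormedSpace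

/-- With `reverse g * g = ±1` the unknown sign occurs twice and cancels. The inverse is thus
polynomial in `g` and its reversal, which makes it smooth along a smooth lift. -/
theorem inv_eq_of_isSpinLike {N k : ℕ} {g : (Cliff N k)ˣ} (hg : IsSpinLike g) :
    ((g⁻¹ : (Cliff N k)ˣ) : Cliff N k)
      = reverse (g : Cliff N k) * g * reverse (g : Cliff N k) := by
  have h1 : reverse (g : Cliff N k) = reverse (g : Cliff N k) * g * (g⁻¹ : (Cliff N k)ˣ) := by
    rw [mul_assoc, Units.mul_inv, mul_one]
  rcases hg.norm with h | h
  · rw [h1, h]; simp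
  · rw [h1, h]; simp

theorem contDiffOn_lift_inv (q : LocalSection c n r) :
    ContDiffOn ℝ ∞ (fun x => (((q.lift x)⁻¹ : (Cliff (n + 1) c.index)ˣ) : Cliff (n + 1) c.index))
      (c.carrier n r ∩ q.dom) := by
  have h1 := contDiffOn_lift q
  have h2 := contDiffOn_linear (reverse (Q := cliffForm (n + 1) c.index)) h1
  have h3 := contDiffOn_bilinear (cliffMulForm (n + 1) c.index)
    (contDiffOn_bilinear (cliffMulForm (n + 1) c.index) h2 h1) h2
  exact h3.congr fun x hx => inv_eq_of_isSpinLike (isSpinLike_of_mem (q.lift_mem x hx))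

theorem pull_apply (q : LocalSection c n r) (f : SpinFrame c n r → Spinor n) {x : Vec (n + 1)}
    (hx : x ∈ c.carrier n r ∩ q.dom) : q.pull f x = f (q.at x hx) := dif_pos hx

/-- The inverse of an isomorphism of the spin modules. -/
theorem exists_inverse {W : Submodule ℂ (Spinor (n + 1))} {i : Spinor (n + 1) →ₗ[ℂ] Spinor n}
    (hi : IsSpinIso c n W i) : ∃ I : Spinor n →ₗ[ℂ] Spinor (n + 1),
      (∀ w, I w ∈ W) ∧ (∀ w, i (I w) = w) ∧ (∀ w ∈ W, I (i w) = w) ∧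
      ∀ a ∈ Spin n 1, ∀ w, I (actForm n 1 a w)
        = actForm (n + 1) c.index (inclCliff c n a) (I w) := by
  let E := LinearEquiv.ofBijective (i.domRestrict W) hi.1
  have h1 : ∀ w, i (E.symm w : Spinor (n + 1)) = w := fun w => E.apply_symm_apply w
  have h2 : ∀ w ∈ W, (E.symm (i w) : Spinor (n + 1)) = w := fun w hw =>
    congrArg Subtype.val (E.symm_apply_apply ⟨w, hw⟩)
  refine ⟨W.subtype ∘ₗ E.symm.toLinearMap, fun w => (E.symm w).2, h1, h2, fun a ha w => ?_⟩
  have h3 := hi.2 a ha (E.symm w) (E.symm w).2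
  rw [h1] at h3
  have h4 := h2 _ h3.1
  rw [h3.2] at h4
  exact h4

/-- Products of two basis vectors are themselves elements of the spin group. -/
theorem isEvenEquivariant_of_spin {I : Spinor n →ₗ[ℂ] Spinor (n + 1)}
    (hI : ∀ a ∈ Spin n 1, ∀ w, I (actForm n 1 a w)
      = actForm (n + 1) c.index (inclCliff c n a) (I w)) : IsEvenEquivariant c n I := by
  intro a b w
  have h := hI _ (vecUnit_mul_mem_spin (x := e a) (y := e b)
    (by rw [sp_e_e_self, abs_eps]) (by rw [sp_e_e_self, abs_eps])) w
  rw [Units.val_mul, actForm_mul] at h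
  refine h.trans ?_
  exact kappa_inclCliff_e_e a b (I w)

theorem fderiv_psi (hr : 0 < r) (u v : Spinor (n + 1)) {x : Vec (n + 1)}
    (hx : x ∈ c.carrier n r) {X : Vec (n + 1)} (hX : sp c.index X x = 0) :
    fderiv ℝ (fun y => psi c.index u v (retr c r y)) x X = cmul c.index X v := by
  have hd := differentiableAt_retr (r := r) (carrier_subset_cone hr hx)
  have h := fderiv_linear (((actForm (n + 1) c.index).comp (vec (n + 1) c.index)).flip v) hd X
  rw [fderiv_retr hr hx hX] at h
  change fderiv ℝ (fun y => u + cmul c.index (retr c r y) v) x X = _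
  rw [fderiv_const_add]
  exact h

theorem contDiff_psi (k : ℕ) {N : ℕ} (u v : Spinor N) : ContDiff ℝ ∞ (psi k u v) :=
  contDiff_const.add (LinearMap.toContinuousLinearMap
    (((actForm N k).comp (vec N k)).flip v)).contDiff

theorem restrict_psi_mem_twistorSpinors (hn : 0 < n) (hr : 0 < r)
    {W : Submodule ℂ (Spinor (n + 1))}
    (hW : ∀ x y : Vec (n + 1), ∀ w ∈ W, cmul c.index x (cmul c.index y w) ∈ W)
    {i : Spinor (n + 1) →ₗ[ℂ] Spinor n} (hi : IsSpinIso c n W i) {u v : Spinor (n + 1)}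
    (hu : u ∈ W) (hv : ∀ x, cmul c.index x v ∈ W) :
    restrict i (psi c.index u v) ∈ twistorSpinors c n r := by
  obtain ⟨I, -, hiI, hIi, hI⟩ := exists_inverse hi
  have hψ : ∀ x, psi c.index u v x ∈ W := fun x => W.add_mem hu (hv x)
  have hsmooth : ∀ q : LocalSection c n r, ContDiffOn ℝ ∞ (q.pull (restrict i (psi c.index u v)))
      (c.carrier n r ∩ q.dom) := by
    intro q
    have h1 := contDiffOn_bilinear (actForm (n + 1) c.index) (contDiffOn_lift_inv q)
      (contDiff_psi c.index u v).contDiffOn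
    exact (contDiffOn_linear (i.restrictScalars ℝ) h1).congr fun x hx => pull_apply q _ hx
  refine ⟨⟨fun p p' a ha hpt hlift => ?_, hsmooth⟩, fun q x hx => ?_⟩
  · have hmem : (kappa (n + 1) c.index ((p.lift⁻¹ : (Cliff (n + 1) c.index)ˣ) :
        Cliff (n + 1) c.index)).mulVec (psi c.index u v p.pt) ∈ W :=
      kappa_mulVec_mem hW (inv_mem p.lift_mem) (hψ _)
    have h1 := (hi.2 a⁻¹ (inv_mem ha) _ hmem).2
    have h2 : p'.lift = p.lift * Units.map (inclCliff c n : Cliff n 1 →* _) a := Units.ext hlift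
    rw [restrict, restrict, hpt, ← h1, h2, mul_inv_rev, Units.val_mul, map_mul,
      ← Matrix.mulVec_mulVec, ← map_inv]
    rfl
  · rw [twistorOp_eq_zero_iff hn hr (isEvenEquivariant_of_spin hI)
      (Function.LeftInverse.injective hiI) q hx (hsmooth q) (φ := psi c.index u v)]
    · exact ⟨v, fun j => fderiv_psi hr u v hx.1 (sp_frame_self hr q hx j)⟩
    · intro y hy
      rw [pull_apply q _ hy, restrict, hIi, ← actForm_apply]
      · exact (actForm_cancel_inv_left (q.lift y) _).symm
      · exact kappa_mulVec_mem hW (inv_mem (q.lift_mem y hy)) (hψ _)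

/-- A spinor field is given by a field in the ambient spinor module. -/
theorem actForm_lift_eq (hn : 0 < n) {I : Spinor n →ₗ[ℂ] Spinor (n + 1)}
    (hI : ∀ a ∈ Spin n 1, ∀ w, I (actForm n 1 a w)
      = actForm (n + 1) c.index (inclCliff c n a) (I w))
    {f : SpinFrame c n r → Spinor n} (hf : IsSpinorField f) (p p' : SpinFrame c n r)
    (hpt : p'.pt = p.pt) :
    actForm (n + 1) c.index p'.lift (I (f p')) = actForm (n + 1) c.index p.lift (I (f p)) := by
  -- Both lifts take the normal basis vector to the same unit normal, so their quotient lies in its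
  -- stabilizer.
  have hrot : RotatesTo (p.lift⁻¹ * p'.lift) (e (c.pos n)) (e (c.pos n)) := by
    have h1 := rotatesTo_iff.mp p.normal
    have h2 := rotatesTo_iff.mp p'.normal
    rw [rotatesTo_iff, Units.val_mul, mul_assoc, h2, hpt, ← mul_assoc, ← mul_assoc]
    congr 1
    rw [Units.inv_mul_eq_iff_eq_mul, ← mul_assoc, h1, mul_assoc, Units.mul_inv, mul_one]
  obtain ⟨a, ha, hba⟩ := exists_eq_inclCliff hn (mul_mem (inv_mem p.lift_mem) p'.lift_mem) hrot
  rw [Units.val_mul, Units.inv_mul_eq_iff_eq_mul] at hba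
  rw [hf.1 p p' a ha hpt hba, ← actForm_apply, hI _ (inv_mem ha), hba, actForm_mul,
    ← actForm_mul (inclCliff c n a), ← map_mul, Units.mul_inv, map_one, actForm_one]

theorem exists_psi_of_mem_twistorSpinors (hn : 3 ≤ n) (hr : 0 < r)
    {W : Submodule ℂ (Spinor (n + 1))}
    (hW : ∀ x y : Vec (n + 1), ∀ w ∈ W, cmul c.index x (cmul c.index y w) ∈ W)
    {i : Spinor (n + 1) →ₗ[ℂ] Spinor n} (hi : IsSpinIso c n W i)
    {f : SpinFrame c n r → Spinor n} (hf : f ∈ twistorSpinors c n r) :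
    ∃ u ∈ W, ∃ v, (∀ x, cmul c.index x v ∈ W) ∧ f = restrict i (psi c.index u v) := by
  have hn0 : 0 < n := by omega
  obtain ⟨I, hIW, hiI, -, hI⟩ := exists_inverse hi
  obtain ⟨hfield, htw⟩ := hf
  have hfr : ∀ x ∈ c.carrier n r, ∃ p : SpinFrame c n r, p.pt = x := fun x hx => by
    obtain ⟨q, hq⟩ := exists_localSection hn0 hr hx
    exact ⟨q.at x ⟨hx, hq⟩, rfl⟩
  classical
  -- The choice of a spin frame over `x` is irrelevant by `actForm_lift_eq`; the value `0` off the
  -- hypersurface is never used.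
  let φ : Vec (n + 1) → Spinor (n + 1) := fun x => if hx : x ∈ c.carrier n r then
    actForm (n + 1) c.index (hfr x hx).choose.lift (I (f (hfr x hx).choose)) else 0
  have hφ : ∀ p : SpinFrame c n r, φ p.pt = actForm (n + 1) c.index p.lift (I (f p)) := by
    intro p
    rw [show φ p.pt = _ from dif_pos p.pt_mem]
    exact actForm_lift_eq hn0 hI hfield p _ (hfr p.pt p.pt_mem).choose_spec
  have hφq : ∀ q : LocalSection c n r, ∀ y ∈ c.carrier n r ∩ q.dom,
      φ y = actForm (n + 1) c.index (q.lift y : Cliff (n + 1) c.index) (I (q.pull f y)) := by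
    intro q y hy
    rw [pull_apply q f hy]
    exact hφ (q.at y hy)
  have hφs : ∀ q : LocalSection c n r, ContDiffOn ℝ ∞ φ (c.carrier n r ∩ q.dom) := fun q =>
    (contDiffOn_bilinear (actForm (n + 1) c.index) (contDiffOn_lift q)
      (contDiffOn_linear (I.restrictScalars ℝ) (hfield.2 q))).congr (hφq q)
  have hΦ : ContDiffOn ℝ ∞ (fun y => φ (retr c r y)) (cone c n) := by
    intro y hy
    obtain ⟨q, hq⟩ := exists_localSection hn0 hr (retr_mem (r := r) hy)
    have hnhds : cone c n ∩ {y | retr c r y ∈ q.dom} ∈ 𝓝 y := by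
      filter_upwards [isOpen_cone.mem_nhds hy,
        (differentiableAt_retr hy).continuousAt.eventually (q.isOpen_dom.mem_nhds hq)] with z h1 h2
      exact ⟨h1, h2⟩
    exact ((contDiffOn_comp_retr (hφs q)).contDiffAt hnhds).contDiffWithinAt
  obtain ⟨u, v, huv⟩ := exists_eq_psi hn hr hΦ (fun x hx => by
    obtain ⟨q, hq⟩ := exists_localSection hn0 hr hx
    have hxq : x ∈ c.carrier n r ∩ q.dom := ⟨hx, hq⟩
    obtain ⟨χ, hχ⟩ := (twistorOp_eq_zero_iff hn0 hr (isEvenEquivariant_of_spin hI)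
      (Function.LeftInverse.injective hiI) q hxq (hfield.2 q) (hφq q)).mp (htw q x hxq)
    refine ⟨χ, fun X hX => ?_⟩
    have hB : ∀ Y, cmul c.index Y χ
        = ((actForm (n + 1) c.index).comp (vec (n + 1) c.index)).flip χ Y := fun _ => rfl
    rw [eq_sum_frame q hxq hX, map_sum, hB, map_sum]
    refine Finset.sum_congr rfl fun a _ => ?_
    rw [map_smul, map_smul, hχ, hB])
  have hmem : ∀ x ∈ c.carrier n r, psi c.index u v x ∈ W := fun x hx => by
    obtain ⟨p, rfl⟩ := hfr x hx
    rw [← huv _ hx, hφ]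
    exact kappa_mulVec_mem hW p.lift_mem (hIW _)
  obtain ⟨x₀, hx₀⟩ : ∃ x₀, x₀ ∈ c.carrier n r := by
    refine ⟨r • e (c.pos n), ?_⟩
    rw [SpaceForm.carrier, Set.mem_ofPred_eq, sp_smul_left, sp_smul_right, sp_e_e_self,
      eps_pos c n hn0]
    ring
  have hx₀' : -x₀ ∈ c.carrier n r := by
    rw [SpaceForm.carrier, Set.mem_ofPred_eq, sp_neg_left, sp_neg_right, neg_neg]
    exact hx₀
  -- The hypersurface is symmetric under `x ↦ -x`, so `u` and `x₀ · v` are half the sum and half the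
  -- difference of two values in `W`.
  have h1 := hmem _ hx₀
  have h2 := hmem _ hx₀'
  rw [psi, ← neg_one_smul ℝ, cmul_smul_left, neg_one_smul] at h2
  rw [psi] at h1
  have hu : u ∈ W := by
    have h3 := W.smul_of_tower_mem (1 / 2 : ℝ) (W.add_mem h1 h2)
    have h4 : (1 / 2 : ℝ) • (u + cmul c.index x₀ v + (u + -cmul c.index x₀ v)) = u := by module
    rwa [h4] at h3
  have hx₀v : cmul c.index x₀ v ∈ W := by
    have := W.sub_mem h1 hu
    rwa [add_sub_cancel_left] at this
  refine ⟨u, hu, v, fun x => ?_, ?_⟩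
  -- Since `x · x₀ · (x₀ · v)` is a nonzero multiple of `x · v`, one non-isotropic `x₀` suffices for
  -- all `x`.
  · have h3 := hW x x₀ _ hx₀v
    rw [cmul_cmul_self, cmul_smul_right] at h3
    have h0 : -sp c.index x₀ x₀ ≠ 0 := by
      rw [show sp c.index x₀ x₀ = c.sign * r ^ 2 from hx₀]
      exact neg_ne_zero.mpr (mul_ne_zero (sign_ne_zero c) (pow_pos hr 2).ne')
    have h4 := W.smul_of_tower_mem (-sp c.index x₀ x₀)⁻¹ h3
    rwa [inv_smul_smul₀ h0] at h4
  · funext p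
    rw [restrict, ← huv _ p.pt_mem, hφ, ← actForm_apply, actForm_inv_cancel_left, hiI]

end Main
end

noncomputable section

/-! ### A criterion for spin isomorphisms -/

section Criterion
variable {c : SpaceForm} {n : ℕ}

theorem inclCliff_mem_spin {a : (Cliff n 1)ˣ} (ha : a ∈ Spin n 1) :
    Units.map (inclCliff c n : Cliff n 1 →* Cliff (n + 1) c.index) a ∈ Spin (n + 1) c.index := by
  have h : Spin n 1 ≤ (Spin (n + 1) c.index).comap
      (Units.map (inclCliff c n : Cliff n 1 →* Cliff (n + 1) c.index)) := by
    rw [Spin, Subgroup.closure_le]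
    rintro g ⟨x, y, hx, hy, hg⟩
    refine Subgroup.subset_closure ⟨inclVec c n x, inclVec c n y, ?_, ?_, ?_⟩
    · rwa [sp_inclVec]
    · rwa [sp_inclVec]
    · rw [← inclCliff_vec, ← inclCliff_vec, ← map_mul, ← hg]
      rfl
  exact h ha

/-- Bilinearity extends the relation from basis vectors to all generators of `Spin(n,1)`, and
closure induction to the whole group. -/
theorem isSpinIso_of_even {W : Submodule ℂ (Spinor (n + 1))}
    (hW : ∀ x y : Vec (n + 1), ∀ w ∈ W, cmul c.index x (cmul c.index y w) ∈ W)
    {i : Spinor (n + 1) →ₗ[ℂ] Spinor n} (hbij : Function.Bijective (i.domRestrict W))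
    (hi : ∀ a b w, i (cmul c.index (e ((c.pos n).succAbove a))
      (cmul c.index (e ((c.pos n).succAbove b)) w)) = cmul 1 (e a) (cmul 1 (e b) (i w))) :
    IsSpinIso c n W i := by
  have hvec : ∀ x y w, i (cmul c.index (inclVec c n x) (cmul c.index (inclVec c n y) w))
      = cmul 1 x (cmul 1 y (i w)) := by
    intro x y w
    have hx : inclVec c n x = ∑ a, x a • e ((c.pos n).succAbove a) := by
      conv_lhs => rw [← sum_smul_e x]
      have := map_sum (inclVec c n).toLinearMap (fun a => x a • e a) Finset.univ
      refine this.trans (Finset.sum_congr rfl fun a _ => ?_)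
      rw [map_smul]
      exact congrArg _ (inclVec_e a)
    have hy : inclVec c n y = ∑ a, y a • e ((c.pos n).succAbove a) := by
      conv_lhs => rw [← sum_smul_e y]
      have := map_sum (inclVec c n).toLinearMap (fun a => y a • e a) Finset.univ
      refine this.trans (Finset.sum_congr rfl fun a _ => ?_)
      rw [map_smul]
      exact congrArg _ (inclVec_e a)
    conv_rhs => rw [← sum_smul_e x, ← sum_smul_e y]
    rw [hx, hy]
    simp only [cmul_eq, map_sum, map_smul, LinearMap.sum_apply, LinearMap.smul_apply,
      map_real_smul]
    simp only [← cmul_eq, hi]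
  have heq : ∀ a ∈ Spin n 1, ∀ w, i (actForm (n + 1) c.index (inclCliff c n a) w)
      = actForm n 1 a (i w) := by
    intro a ha
    induction ha using Subgroup.closure_induction with
    | mem g h =>
      obtain ⟨x, y, -, -, h⟩ := h
      intro w
      rw [h, map_mul, inclCliff_vec, inclCliff_vec, actForm_mul, actForm_mul]
      exact hvec x y w
    | one => intro w; rw [Units.val_one, map_one, actForm_one, actForm_one]
    | mul g h _ _ hg hh =>
      intro w
      rw [Units.val_mul, map_mul, actForm_mul, actForm_mul, hg, hh]
    | inv g _ hg =>
      intro w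
      have h := hg (actForm (n + 1) c.index
        (inclCliff c n ((g⁻¹ : (Cliff n 1)ˣ) : Cliff n 1)) w)
      rw [← actForm_mul, ← map_mul, Units.mul_inv, map_one, actForm_one] at h
      rw [h, actForm_inv_cancel_left]
  exact ⟨hbij, fun a ha w hw => ⟨kappa_mulVec_mem hW (inclCliff_mem_spin ha) hw, heq a ha w⟩⟩

end Criterion

/-! ### Volume element and half spinors in the matrix model -/

section Gamma
variable {N k : ℕ}

theorem kappa_vec (x : Vec N) : kappa N k (vec N k x) = gammaVec N k x :=
  CliffordAlgebra.lift_ι_apply _ _ _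

theorem kappa_vec_e (j : Fin N) : kappa N k (vec N k (e j)) = gamma N k j := by
  rw [kappa_vec, gammaVec_apply, Finset.sum_eq_single j]
  · simp [e]
  · intro i _ hi; simp [e, hi]
  · simp

theorem cmul_e (j : Fin N) (w : Spinor N) : cmul k (e j) w = (gamma N k j).mulVec w := by
  rw [cmul, kappa_vec_e]

theorem gamma_eq_tau_smul (j : Fin N) : gamma N k j = tau k j • gamma N 0 j := by
  simp [gamma, tau, smul_smul]

/-- The operator `T ⊗ … ⊗ T`. -/
def chirality (N : ℕ) : SpinorMat N := kron fun _ => matT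

theorem chirality_mul_self : chirality N * chirality N = 1 := by
  rw [chirality, kron_mul]
  simp only [matT_sq, kron_one]

/-- `T` commutes with `T` and the identity and anticommutes with `U` and `V`. For even `N` each
basis vector has exactly one factor `U` or `V`. -/
theorem chirality_mul_gamma (hN : Even N) (j : Fin N) :
    chirality N * gamma N k j = -(gamma N k j * chirality N) := by
  have hj := j.isLt
  have hj2 : (j : ℕ) / 2 < N / 2 := by
    obtain ⟨m, rfl⟩ := hN
    omega
  simp only [gamma, chirality, smul_mul_assoc, mul_smul_comm, kron_mul]
  rw [kron_neg (fun l : Fin (N / 2) => matT * factor j l)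
    (fun l : Fin (N / 2) => factor j l * matT) ⟨(j : ℕ) / 2, hj2⟩, smul_neg]
  · by_cases h0 : (j : ℕ) % 2 = 0
    · simp [factor, h0, matUT]
    · simp [factor, h0, matVT]
  · intro l hl
    have hl' : (l : ℕ) ≠ (j : ℕ) / 2 := fun h => hl (Fin.ext h)
    by_cases h1 : (l : ℕ) < (j : ℕ) / 2
    · simp [factor, h1]
    · simp [factor, h1, hl']

theorem chirality_mulVec_cmul (hN : Even N) (x : Vec N) (w : Spinor N) :
    (chirality N).mulVec (cmul k x w) = -cmul k x ((chirality N).mulVec w) := by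
  rw [cmul, cmul, Matrix.mulVec_mulVec, Matrix.mulVec_mulVec, ← Matrix.neg_mulVec, kappa_vec,
    gammaVec_apply, Finset.mul_sum, Finset.sum_mul, ← Finset.sum_neg_distrib]
  congr 1
  refine Finset.sum_congr rfl fun j _ => ?_
  rw [mul_smul_comm, smul_mul_assoc, chirality_mul_gamma hN, smul_neg]

theorem matUV_eq : matU * matV = -Complex.I • matT := by
  ext i j; fin_cases i <;> fin_cases j <;> simp [matU, matV, matT, Matrix.mul_apply]

/-- The vectors number `2p` and `2p+1` together contribute `T² = 1` at the places below `p`, `UV =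
-iT` at the place `p` and the identity above it. -/
theorem prod_factor_kron {M : ℕ} (t : ℕ → ℂ) (p : ℕ) :
    (List.ofFn fun j : Fin (2 * p) => t j • kron fun l : Fin M => factor j l).prod
      = (∏ j ∈ Finset.range (2 * p), t j) •
        kron fun l : Fin M => if (l : ℕ) < p then -Complex.I • matT else 1 := by
  induction p with
  | zero => simp [kron_one]
  | succ p ih =>
    rw [show (List.ofFn fun j : Fin (2 * (p + 1)) => t j • kron fun l : Fin M => factor j l)
      = List.ofFn fun j : Fin (2 * p + 1 + 1) => t j • kron fun l : Fin M => factor j l from rfl,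
      List.ofFn_succ', List.ofFn_succ']
    simp only [List.concat_eq_append, List.prod_append, List.prod_singleton, Fin.val_castSucc,
      Fin.val_last, ih, smul_mul_smul_comm, kron_mul]
    rw [show 2 * (p + 1) = 2 * p + 1 + 1 from rfl, Finset.prod_range_succ, Finset.prod_range_succ]
    congr 2
    funext l
    have e1 : 2 * p / 2 = p := by omega
    have e2 : (2 * p + 1) / 2 = p := by omega
    rcases lt_trichotomy (l : ℕ) p with h | h | h
    · simp [factor, e1, e2, h, h.trans (Nat.lt_succ_self p), matT_sq]
    · simp [factor, e1, e2, h, matUV_eq]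
    · simp [factor, e1, e2, h.ne', h.not_gt, Nat.not_lt.mpr (Nat.succ_le_of_lt h)]

theorem kappa_volumeElement (hN : Even N) (hk : k ≤ N) :
    kappa N k (volumeElement N k) = (Complex.I ^ k * (-Complex.I) ^ (N / 2)) • chirality N := by
  obtain ⟨m, rfl⟩ := hN
  have h1 : kappa (m + m) k (volumeElement (m + m) k)
      = (List.ofFn fun j : Fin (m + m) => (if (j : ℕ) < k then Complex.I else 1) •
        kron fun l : Fin ((m + m) / 2) => factor j l).prod := by
    rw [volumeElement, map_list_prod, List.map_ofFn]
    congr 2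
    funext j
    have hj := j.isLt
    have hj2 : (j : ℕ) / 2 < (m + m) / 2 := by omega
    rw [Function.comp_apply, kappa_vec_e, gamma, if_pos hj2, mul_one, tau]
  have h2 := prod_factor_kron (M := (m + m) / 2) (fun j => if j < k then Complex.I else 1) m
  have h3 : ∏ j ∈ Finset.range (2 * m), (if j < k then Complex.I else 1) = Complex.I ^ k := by
    rw [Finset.prod_ite, Finset.prod_const, Finset.prod_const_one, mul_one]
    congr 1
    have : (Finset.range (2 * m)).filter (· < k) = Finset.range k := by
      ext j; simp only [Finset.mem_filter, Finset.mem_range]; omega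
    rw [this, Finset.card_range]
  have h4 : (kron fun l : Fin ((m + m) / 2) => if (l : ℕ) < m then -Complex.I • matT else 1)
      = (-Complex.I) ^ ((m + m) / 2) • chirality (m + m) := by
    ext a b
    simp only [kron, chirality, Matrix.of_apply, Matrix.smul_apply, smul_eq_mul]
    rw [← Fin.prod_const ((m + m) / 2) (-Complex.I), ← Finset.prod_mul_distrib]
    refine Finset.prod_congr rfl fun l _ => ?_
    have hl := l.isLt
    rw [if_pos (by omega)]
    simp
  rw [h1, mul_smul, ← h4, ← h3, ← h2]
  congr 1
  exact List.ofFn_congr (two_mul m).symm _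

/-- The volume element is `i^k (-i)^m` times the chirality operator with `m = N/2`; dividing the
eigenvalue `s i^{m+k}` by this factor leaves `s (-1)^m`, which is independent of `k`. -/
theorem mem_halfSpinor_iff (hN : Even N) (hk : k ≤ N) (s : ℂ) (w : Spinor N) :
    w ∈ halfSpinor N k s ↔ (chirality N).mulVec w = (s * (-1) ^ (N / 2)) • w := by
  rw [halfSpinor, Module.End.mem_eigenspace_iff, Matrix.toLin'_apply, kappa_volumeElement hN hk,
    Matrix.smul_mulVec]
  set z := Complex.I ^ k * (-Complex.I) ^ (N / 2) with hz
  have hz0 : z ≠ 0 := mul_ne_zero (pow_ne_zero _ Complex.I_ne_zero)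
    (pow_ne_zero _ (neg_ne_zero.mpr Complex.I_ne_zero))
  have h : s * Complex.I ^ (N / 2 + k) = z * (s * (-1) ^ (N / 2)) := by
    rw [hz, pow_add, neg_pow Complex.I]
    have : ((-1 : ℂ) ^ (N / 2)) * (-1) ^ (N / 2) = 1 := by
      rw [← mul_pow]; simp
    linear_combination (-s * Complex.I ^ (N / 2) * Complex.I ^ k) * this
  rw [h, mul_smul z]
  exact smul_right_injective _ hz0 |>.eq_iff

theorem cmul_cmul_mem_halfSpinor (hN : Even N) (hk : k ≤ N) (s : ℂ) (x y : Vec N) {w : Spinor N}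
    (hw : w ∈ halfSpinor N k s) : cmul k x (cmul k y w) ∈ halfSpinor N k s := by
  rw [mem_halfSpinor_iff hN hk] at hw ⊢
  rw [chirality_mulVec_cmul hN, chirality_mulVec_cmul hN, hw, cmul_neg_right, neg_neg]
  simp only [cmul, Matrix.mulVec_smul]

theorem forall_cmul_mem_halfSpinor_iff (hN : Even N) (hk : k ≤ N) (h0 : 0 < N) (v : Spinor N) :
    (∀ x, cmul k x v ∈ halfSpinor N k 1) ↔ v ∈ halfSpinor N k (-1) := by
  have hsmul : ∀ (x : Vec N) (t : ℂ) w, cmul k x (t • w) = t • cmul k x w := fun x t w => by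
    simp only [cmul, Matrix.mulVec_smul]
  simp only [mem_halfSpinor_iff hN hk, chirality_mulVec_cmul hN]
  constructor
  · intro h
    have h1 := h (e ⟨0, h0⟩)
    have h2 : cmul k (e ⟨0, h0⟩) ((chirality N).mulVec v)
        = cmul k (e ⟨0, h0⟩) ((-1 * (-1 : ℂ) ^ (N / 2)) • v) := by
      rw [hsmul, ← neg_inj, h1]; module
    have h3 := congrArg (cmul k (e ⟨0, h0⟩)) h2
    rw [cmul_cmul_self, cmul_cmul_self, sp_e_e_self] at h3
    exact smul_right_injective _ (neg_ne_zero.mpr (eps_ne_zero _ _)) h3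
  · intro h x
    rw [h, hsmul]; module

end Gamma

/-! ### A cyclic shift of anticommuting elements -/

section Shift

/-- The product of the vectors `G_l - G_{l+1}`, which shifts the indices of a system of
anticommuting elements. -/
def shiftProd {R : Type*} [Ring R] (G : ℕ → R) : ℕ → R
  | 0 => 1
  | p + 1 => (G p - G (p + 1)) * shiftProd G p

variable {R : Type*} [Ring R] {G : ℕ → R} {n : ℕ}

/-- The vector `G_p - G_{p+1}` anticommutes with all other `G_j` and satisfies `(G_p - G_{p+1})
G_{p+1} = -G_p (G_p - G_{p+1})`: up to sign its reflection transposes two neighbours. The product of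
these transpositions is a shift. -/
theorem shiftProd_mul (hsq : ∀ j ≤ n, G j * G j = -1)
    (hanti : ∀ i ≤ n, ∀ j ≤ n, i ≠ j → G i * G j = -(G j * G i)) {p : ℕ} (hp : p ≤ n) {j : ℕ}
    (hj : j < n) :
    shiftProd G p * G (j + 1) = (-1) ^ p * ((if j < p then G j else G (j + 1)) * shiftProd G p) := by
  induction p with
  | zero => simp [shiftProd]
  | succ p ih =>
    rw [shiftProd, mul_assoc, ih (by omega), ← mul_assoc (G p - G (p + 1)),
      ((Commute.neg_one_right (G p - G (p + 1))).pow_right p).eq, mul_assoc, pow_succ, mul_assoc]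
    congr 1
    rw [neg_one_mul, ← mul_assoc, ← mul_assoc, ← neg_mul]
    congr 1
    rcases lt_trichotomy j p with h | h | h
    · rw [if_pos h, if_pos (by omega), sub_mul, mul_sub, hanti p (by omega) j (by omega) (by omega),
        hanti (p + 1) (by omega) j (by omega) (by omega)]
      noncomm_ring
    · subst h
      rw [if_neg (by omega), if_pos (by omega), sub_mul, mul_sub, hsq _ (by omega),
        hsq _ (by omega)]
      noncomm_ring
    · rw [if_neg (by omega), if_neg (by omega), sub_mul, mul_sub,
        hanti p (by omega) (j + 1) (by omega) (by omega),
        hanti (p + 1) (by omega) (j + 1) (by omega) (by omega)]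
      noncomm_ring

/-- Each factor `G_p - G_{p+1}` squares to `-2`. -/
theorem isUnit_shiftProd (h2 : IsUnit (-2 : R)) (hsq : ∀ j ≤ n, G j * G j = -1)
    (hanti : ∀ i ≤ n, ∀ j ≤ n, i ≠ j → G i * G j = -(G j * G i)) {p : ℕ} (hp : p ≤ n) :
    IsUnit (shiftProd G p) := by
  induction p with
  | zero => exact isUnit_one
  | succ p ih =>
    refine IsUnit.mul ?_ (ih (by omega))
    have h : (G p - G (p + 1)) * (G p - G (p + 1)) = -2 := by
      rw [sub_mul, mul_sub, mul_sub, hsq _ (by omega), hsq _ hp,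
        hanti p (by omega) (p + 1) hp (by omega)]
      have : (-2 : R) = -1 - 1 := by norm_num
      rw [this]
      noncomm_ring
    rw [← h] at h2
    exact isUnit_mul_self_iff.mp h2

theorem mul_shiftProd {Ω : R} (hΩ : ∀ j ≤ n, Ω * G j = -(G j * Ω)) {p : ℕ} (hp : p ≤ n) :
    Ω * shiftProd G p = (-1) ^ p * (shiftProd G p * Ω) := by
  induction p with
  | zero => simp [shiftProd]
  | succ p ih =>
    rw [shiftProd, ← mul_assoc, mul_sub, hΩ p (by omega), hΩ (p + 1) hp, ← neg_sub',
      ← sub_mul, neg_mul, mul_assoc, ih (by omega), ← mul_assoc (G p - G (p + 1)),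
      ((Commute.neg_one_right (G p - G (p + 1))).pow_right p).eq, pow_succ]
    noncomm_ring

end Shift

end

noncomputable section

/-! ### Spinor modules in neighbouring dimensions -/

section Truncation
variable {n : ℕ}

/-- Extension of an index of the spinor module of `ℝ^n` to one of `ℝ^{n+1}` by `0`. -/
def extIndex (n : ℕ) (b : Fin (n / 2) → Fin 2) : Fin ((n + 1) / 2) → Fin 2 :=
  fun l => if h : (l : ℕ) < n / 2 then b ⟨l, h⟩ else 0

/-- The restriction of the spinor components to the indices with a vanishing last entry, if `n` is
odd, and the identity, if `n` is even. -/
def truncation (n : ℕ) : Spinor (n + 1) →ₗ[ℂ] Spinor n := LinearMap.funLeft ℂ ℂ (extIndex n)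

theorem truncation_apply (w : Spinor (n + 1)) (b : Fin (n / 2) → Fin 2) :
    truncation n w b = w (extIndex n b) := rfl

theorem extIndex_injective : Function.Injective (extIndex n) := by
  intro a b h
  funext l
  have h1 := congrFun h ⟨l, by omega⟩
  simpa [extIndex] using h1

theorem exists_of_notMem_range {a : Fin ((n + 1) / 2) → Fin 2} (ha : a ∉ Set.range (extIndex n)) :
    ∃ l : Fin ((n + 1) / 2), (l : ℕ) = n / 2 ∧ a l = 1 := by
  by_contra! h
  refine ha ⟨fun l => a ⟨l, by omega⟩, ?_⟩
  funext l
  by_cases hl : (l : ℕ) < n / 2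
  · simp [extIndex, hl]
  · have h1 := h l (by omega)
    simp only [extIndex, dif_neg hl]
    revert h1
    generalize a l = y
    intro h1
    fin_cases y
    · rfl
    · exact absurd rfl h1

theorem extIndex_of_le (b : Fin (n / 2) → Fin 2) {l : Fin ((n + 1) / 2)} (hl : (l : ℕ) = n / 2) :
    extIndex n b l = 0 := dif_neg (by omega)

theorem prod_extIndex (F : ℕ → Fin 2 → Fin 2 → ℂ) (a b : Fin (n / 2) → Fin 2) :
    ∏ l : Fin ((n + 1) / 2), F l (extIndex n a l) (extIndex n b l)
      = (∏ l : Fin (n / 2), F l (a l) (b l)) * if Even n then 1 else F (n / 2) 0 0 := by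
  let e : (Fin (n / 2) → Fin 2) → ℕ → Fin 2 := fun b l => if h : l < n / 2 then b ⟨l, h⟩ else 0
  have h1 : ∏ l : Fin ((n + 1) / 2), F l (extIndex n a l) (extIndex n b l)
      = ∏ l ∈ Finset.range ((n + 1) / 2), F l (e a l) (e b l) :=
    Fin.prod_univ_eq_prod_range (fun l => F l (e a l) (e b l)) _
  have h2 : ∏ l : Fin (n / 2), F l (a l) (b l)
      = ∏ l ∈ Finset.range (n / 2), F l (e a l) (e b l) := by
    rw [← Fin.prod_univ_eq_prod_range (fun l => F l (e a l) (e b l))]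
    exact Finset.prod_congr rfl fun l _ => by simp [e]
  rw [h1, h2]
  split_ifs with hn
  · rw [mul_one]
    congr 2
    obtain ⟨m, rfl⟩ := hn
    omega
  · rw [Nat.not_even_iff_odd] at hn
    obtain ⟨m, rfl⟩ := hn
    rw [show (2 * m + 1 + 1) / 2 = (2 * m + 1) / 2 + 1 by omega, Finset.prod_range_succ]
    simp [e]

/-- For odd `n` there is one additional tensor place. There the first `n` vectors act diagonally, so
components with last entry `0` are not mixed with the others. The corner entry is `1`, except for
the vector number `n - 1`, where `U` contributes `i`; this is the extra factor `i` of the last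
vector in odd dimension. -/
theorem truncation_gamma (k : ℕ) (j : Fin n) (w : Spinor (n + 1)) :
    truncation n ((gamma (n + 1) k j.castSucc).mulVec w)
      = (gamma n k j).mulVec (truncation n w) := by
  have hj := j.isLt
  funext b
  rw [truncation_apply]
  simp only [Matrix.mulVec, dotProduct]
  refine (Fintype.sum_of_injective (extIndex n) extIndex_injective _ _ ?_ ?_).symm
  · intro a ha
    obtain ⟨l, hl, hal⟩ := exists_of_notMem_range ha
    have hl' := l.isLt
    have h0 : factor j l 0 1 = 0 := by
      have h1 : ¬ (l : ℕ) < (j : ℕ) / 2 := by omega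
      by_cases h2 : (l : ℕ) = (j : ℕ) / 2
      · have h3 : (j : ℕ) % 2 = 0 := by omega
        simp [factor, h2, h3, matU]
      · simp [factor, h1, h2]
    simp only [gamma, kron, Matrix.smul_apply, Matrix.of_apply, Fin.val_castSucc]
    rw [Finset.prod_eq_zero (Finset.mem_univ l) (by rw [extIndex_of_le b hl, hal, h0])]
    simp
  · intro a
    simp only [gamma, kron, Matrix.smul_apply, Matrix.of_apply, Fin.val_castSucc, smul_eq_mul,
      truncation_apply]
    congr 1
    have hp := prod_extIndex (n := n) (fun l x y => factor j l x y) b a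
    rw [hp, if_pos (by omega : (j : ℕ) / 2 < (n + 1) / 2)]
    have ht : tau k j.castSucc = tau k j := rfl
    rw [ht, mul_one, mul_assoc, mul_comm (∏ l : Fin (n / 2), _), ← mul_assoc, ← mul_assoc]
    congr 2
    by_cases hn : Even n
    · obtain ⟨m, rfl⟩ := hn
      rw [if_pos (by omega : (j : ℕ) / 2 < (m + m) / 2), if_pos ⟨m, rfl⟩]
    · rw [if_neg hn]
      rw [Nat.not_even_iff_odd] at hn
      obtain ⟨m, rfl⟩ := hn
      by_cases h : (j : ℕ) / 2 < (2 * m + 1) / 2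
      · rw [if_pos h]
        have h1 : ¬ (2 * m + 1) / 2 < (j : ℕ) / 2 := by omega
        have h2 : (2 * m + 1) / 2 ≠ (j : ℕ) / 2 := by omega
        simp [factor, h1, h2]
      · rw [if_neg h]
        have h1 : (2 * m + 1) / 2 = (j : ℕ) / 2 := by omega
        have h2 : (j : ℕ) % 2 = 0 := by omega
        simp [factor, h1, h2, matU]

theorem truncation_bijective (hn : Even n) : Function.Bijective (truncation n) := by
  have hs : Function.Surjective (extIndex n) := by
    intro a
    by_contra h
    obtain ⟨l, hl, -⟩ := exists_of_notMem_range (n := n) (a := a) h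
    obtain ⟨m, rfl⟩ := hn
    omega
  exact ⟨LinearMap.funLeft_injective_of_surjective _ _ _ hs,
    LinearMap.funLeft_surjective_of_injective _ _ _ extIndex_injective⟩

theorem chirality_apply_eq_zero {N : ℕ} {a b : Fin (N / 2) → Fin 2} (l : Fin (N / 2))
    (h : a l = b l) : chirality N a b = 0 := by
  rw [chirality, kron, Matrix.of_apply]
  refine Finset.prod_eq_zero (Finset.mem_univ l) ?_
  rw [h]
  generalize b l = y
  fin_cases y <;> simp [matT]

/-- For odd `n` the truncation is bijective on the eigenspaces of the chirality operator. -/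
theorem truncation_bijective_of_odd (hn : Odd n) {s : ℂ} (hs : s * s = 1)
    {W : Submodule ℂ (Spinor (n + 1))} (hW : ∀ w, w ∈ W ↔ (chirality (n + 1)).mulVec w = s • w) :
    Function.Bijective ((truncation n).domRestrict W) := by
  have hs0 : s ≠ 0 := by rintro rfl; simp at hs
  let top : Fin ((n + 1) / 2) := ⟨n / 2, by obtain ⟨m, rfl⟩ := hn; omega⟩
  constructor
  · rw [← LinearMap.ker_eq_bot, LinearMap.ker_eq_bot']
    rintro ⟨w, hw⟩ h
    rw [LinearMap.domRestrict_apply] at h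
    rw [hW] at hw
    have hr : ∀ a ∈ Set.range (extIndex n), w a = 0 := by
      rintro _ ⟨b, rfl⟩
      exact congrFun h b
    have hw0 : w = 0 := by
      funext a
      by_cases ha : a ∈ Set.range (extIndex n)
      · exact hr a ha
      · obtain ⟨l, hl, hal⟩ := exists_of_notMem_range ha
        have h1 := congrFun hw a
        -- Chirality flips every index, in particular the last one. The components with last entry
        -- `1` are thus determined by those with last entry `0`.
        have h2 : (chirality (n + 1)).mulVec w a = 0 := by
          simp only [Matrix.mulVec, dotProduct]
          refine Finset.sum_eq_zero fun a' _ => ?_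
          by_cases ha' : a' ∈ Set.range (extIndex n)
          · rw [hr a' ha', mul_zero]
          · obtain ⟨l', hl', hal'⟩ := exists_of_notMem_range ha'
            obtain rfl : l = l' := Fin.ext (hl.trans hl'.symm)
            rw [chirality_apply_eq_zero l (hal.trans hal'.symm), zero_mul]
        rw [h2, Pi.smul_apply, smul_eq_mul] at h1
        exact (mul_eq_zero.mp h1.symm).resolve_left hs0
    exact Subtype.ext hw0
  · intro x
    -- The extension of `x` by zero is symmetrized into the eigenspace. The added term has last
    -- entry `1` and is invisible to the truncation.
    let w₀ : Spinor (n + 1) := fun a => if a top = 0 then x fun l => a ⟨l, by omega⟩ else 0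
    let w := w₀ + s • (chirality (n + 1)).mulVec w₀
    have hw : w ∈ W := by
      rw [hW, Matrix.mulVec_add, Matrix.mulVec_smul, Matrix.mulVec_mulVec, chirality_mul_self,
        Matrix.one_mulVec, smul_add, smul_smul, hs, one_smul]
      exact add_comm _ _
    refine ⟨⟨w, hw⟩, ?_⟩
    rw [LinearMap.domRestrict_apply]
    funext b
    have htop : extIndex n b top = 0 := extIndex_of_le b rfl
    have h1 : w₀ (extIndex n b) = x b := by
      change (if extIndex n b top = 0 then _ else _) = _
      rw [if_pos htop]
      congr 1
      funext l
      simp [extIndex]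
    have h2 : (chirality (n + 1)).mulVec w₀ (extIndex n b) = 0 := by
      simp only [Matrix.mulVec, dotProduct]
      refine Finset.sum_eq_zero fun a _ => ?_
      by_cases ha : a top = 0
      · rw [chirality_apply_eq_zero top (htop.trans ha.symm), zero_mul]
      · rw [show w₀ a = 0 from if_neg ha, mul_zero]
    change w₀ (extIndex n b) + s * (chirality (n + 1)).mulVec w₀ (extIndex n b) = x b
    rw [h1, h2, mul_zero, add_zero]

end Truncation

/-! ### Existence of the isomorphism of spin modules -/

section Intertwiner

/-- The matrix that carries the tangent basis vectors to the first `n` basis vectors. -/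
theorem exists_intertwiner (c : SpaceForm) (n : ℕ) : ∃ J : SpinorMat (n + 1), IsUnit J ∧
    (∀ a b : Fin n, J * (gamma (n + 1) c.index ((c.pos n).succAbove a)
        * gamma (n + 1) c.index ((c.pos n).succAbove b))
      = gamma (n + 1) 1 a.castSucc * gamma (n + 1) 1 b.castSucc * J) ∧
    (Odd n → J * chirality (n + 1) = chirality (n + 1) * J) := by
  cases c with
  | pseudoSphere =>
    refine ⟨1, isUnit_one, fun a b => ?_, fun _ => by rw [one_mul, mul_one]⟩
    simp [SpaceForm.pos, SpaceForm.index]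
  | pseudoHyperbolic =>
    -- The matrices without the timelike factors `τ` all square to `-1`. The factors can be restored
    -- at the end, since `τ` of the vector `a + 1` for index `2` equals `τ` of the vector `a` for
    -- index `1`. The value `0` beyond `n` is not used.
    let G : ℕ → SpinorMat (n + 1) := fun j =>
      if h : j < n + 1 then gamma (n + 1) 0 ⟨j, h⟩ else 0
    have hG : ∀ j (h : j < n + 1), G j = gamma (n + 1) 0 ⟨j, h⟩ := fun j h => dif_pos h
    have hsq : ∀ j ≤ n, G j * G j = -1 := fun j hj => by
      rw [hG j (by omega), gamma_sq, eps]; simp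
    have hanti : ∀ i ≤ n, ∀ j ≤ n, i ≠ j → G i * G j = -(G j * G i) := by
      intro i hi j hj hij
      rw [hG i (by omega), hG j (by omega)]
      rcases lt_or_gt_of_ne hij with h | h
      · exact gamma_anticomm_of_lt _ _ _ _ h
      · rw [gamma_anticomm_of_lt (n + 1) 0 ⟨j, by omega⟩ ⟨i, by omega⟩ h, neg_neg]
    have h2 : IsUnit (-2 : SpinorMat (n + 1)) := by
      have : (-2 : SpinorMat (n + 1)) = algebraMap ℂ _ (-2) := by
        rw [map_neg, map_ofNat]
      rw [this]
      exact (IsUnit.mk0 (-2 : ℂ) (by norm_num)).map _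
    have hG0 : IsUnit (G 0) := by
      have h : G 0 * G 0 = -1 := hsq 0 (Nat.zero_le n)
      exact isUnit_mul_self_iff.mp (h ▸ isUnit_one.neg)
    -- The additional `G 0` only changes signs here, and they cancel in products of two vectors. It
    -- makes the number of factors `n + 1`, so that for odd `n` the matrix commutes with the
    -- chirality operator.
    have key : ∀ j < n, shiftProd G n * G 0 * G (j + 1)
        = (-1) ^ (n + 1) * (G j * (shiftProd G n * G 0)) := by
      intro j hj
      rw [mul_assoc, hanti 0 (Nat.zero_le n) (j + 1) (by omega) (by omega), mul_neg, ← mul_assoc,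
        shiftProd_mul hsq hanti le_rfl hj, if_pos hj, pow_succ]
      noncomm_ring
    have hgS : ∀ a : Fin n, gamma (n + 1) 2 a.succ = tau 1 a • G (a + 1) := fun a => by
      rw [hG _ (by omega), gamma_eq_tau_smul]
      congr 1
      simp [tau]
    have hgC : ∀ a : Fin n, gamma (n + 1) 1 a.castSucc = tau 1 a • G a := fun a => by
      rw [hG _ (by omega), gamma_eq_tau_smul]
      rfl
    refine ⟨shiftProd G n * G 0, (isUnit_shiftProd h2 hsq hanti le_rfl).mul hG0, fun a b => ?_,
      fun hn => ?_⟩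
    · simp only [SpaceForm.pos, SpaceForm.index, Fin.succAbove_zero]
      rw [hgS, hgS, hgC, hgC, smul_mul_smul_comm, smul_mul_smul_comm, mul_smul_comm,
        smul_mul_assoc, ← mul_assoc, key a a.isLt, mul_assoc, mul_assoc (G a), key b b.isLt]
      congr 1
      rcases Nat.even_or_odd (n + 1) with h | h
      · rw [h.neg_one_pow]; noncomm_ring
      · rw [h.neg_one_pow]; noncomm_ring
    · have hN : Even (n + 1) := hn.add_one
      have hΩ : ∀ j ≤ n, chirality (n + 1) * G j = -(G j * chirality (n + 1)) := fun j hj => by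
        rw [hG j (by omega), chirality_mul_gamma hN]
      rw [← mul_assoc, mul_shiftProd hΩ le_rfl, hn.neg_one_pow, mul_assoc (shiftProd G n),
        neg_one_mul, neg_mul, mul_assoc (shiftProd G n), hΩ 0 (Nat.zero_le n), mul_neg, neg_neg]

/-- The isomorphism is the truncation after the intertwiner `J`, which brings the tangent vectors to
the first `n` places. -/
theorem exists_isSpinIso (c : SpaceForm) {n : ℕ} {W : Submodule ℂ (Spinor (n + 1))}
    (hW : ∀ x y : Vec (n + 1), ∀ w ∈ W, cmul c.index x (cmul c.index y w) ∈ W)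
    (hJ : ∀ J : SpinorMat (n + 1), IsUnit J →
      (Odd n → J * chirality (n + 1) = chirality (n + 1) * J) → ∀ w, J.mulVec w ∈ W ↔ w ∈ W)
    (hbij : Function.Bijective ((truncation n).domRestrict W)) :
    ∃ i : Spinor (n + 1) →ₗ[ℂ] Spinor n, IsSpinIso c n W i := by
  obtain ⟨J, hJu, hJg, hJc⟩ := exists_intertwiner c n
  have hmem := hJ J hJu hJc
  have hinv : ∀ w, J.mulVec (J⁻¹.mulVec w) = w := fun w => by
    rw [Matrix.mulVec_mulVec, Matrix.mul_nonsing_inv _ ((Matrix.isUnit_iff_isUnit_det J).mp hJu),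
      Matrix.one_mulVec]
  have hinv' : ∀ w, J⁻¹.mulVec (J.mulVec w) = w := fun w => by
    rw [Matrix.mulVec_mulVec, Matrix.nonsing_inv_mul _ ((Matrix.isUnit_iff_isUnit_det J).mp hJu),
      Matrix.one_mulVec]
  refine ⟨truncation n ∘ₗ J.mulVecLin, isSpinIso_of_even hW ⟨?_, ?_⟩ fun a b w => ?_⟩
  · rintro ⟨v, hv⟩ ⟨w, hw⟩ h
    have h1 := @hbij.1 ⟨J.mulVec v, (hmem v).mpr hv⟩ ⟨J.mulVec w, (hmem w).mpr hw⟩ h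
    have h2 := congrArg (fun w => J⁻¹.mulVec w.1) h1
    simp only [hinv'] at h2
    exact Subtype.ext h2
  · intro x
    obtain ⟨⟨w, hw⟩, h⟩ := hbij.2 x
    refine ⟨⟨J⁻¹.mulVec w, (hmem _).mp (by rwa [hinv])⟩, ?_⟩
    rw [← h, LinearMap.domRestrict_apply, LinearMap.comp_apply, Matrix.mulVecLin_apply, hinv,
      LinearMap.domRestrict_apply]
  · rw [cmul_e, cmul_e, cmul_e, cmul_e, LinearMap.comp_apply, LinearMap.comp_apply,
      Matrix.mulVecLin_apply, Matrix.mulVecLin_apply, Matrix.mulVec_mulVec, Matrix.mulVec_mulVec,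
      mul_assoc J, hJg, ← truncation_gamma, ← truncation_gamma, Matrix.mulVec_mulVec, Matrix.mulVec_mulVec]

end Intertwiner

theorem twistorSpinors_eq {c : SpaceForm} {n : ℕ} (hn : 3 ≤ n) {r : ℝ} (hr : 0 < r)
    {W : Submodule ℂ (Spinor (n + 1))}
    (hW : ∀ x y : Vec (n + 1), ∀ w ∈ W, cmul c.index x (cmul c.index y w) ∈ W)
    {i : Spinor (n + 1) →ₗ[ℂ] Spinor n} (hi : IsSpinIso c n W i) :
    twistorSpinors c n r = {f | ∃ u ∈ W, ∃ v, (∀ x, cmul c.index x v ∈ W) ∧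
      f = restrict i (psi c.index u v)} := by
  ext f
  constructor
  · exact exists_psi_of_mem_twistorSpinors hn hr hW hi
  · rintro ⟨u, hu, v, hv, rfl⟩
    exact restrict_psi_mem_twistorSpinors (by omega) hr hW hi hu hv

end

end LorentzTwistor

open LorentzTwistor
theorem proposition10 (c : SpaceForm) (n : ℕ) (hn : 3 ≤ n) (r : ℝ) (hr : 0 < r) :
    (Even n →
      (∃ i : Spinor (n + 1) →ₗ[ℂ] Spinor n, IsSpinIso c n ⊤ i) ∧
      ∀ i : Spinor (n + 1) →ₗ[ℂ] Spinor n, IsSpinIso c n ⊤ i →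
        twistorSpinors c n r =
          {f | ∃ u v : Spinor (n + 1), f = restrict i (psi c.index u v)}) ∧
    (Odd n →
      (∃ i : Spinor (n + 1) →ₗ[ℂ] Spinor n,
        IsSpinIso c n (halfSpinor (n + 1) c.index 1) i) ∧
      ∀ i : Spinor (n + 1) →ₗ[ℂ] Spinor n,
        IsSpinIso c n (halfSpinor (n + 1) c.index 1) i →
        twistorSpinors c n r =
          {f | ∃ u ∈ halfSpinor (n + 1) c.index 1, ∃ v ∈ halfSpinor (n + 1) c.index (-1),
            f = restrict i (psi c.index u v)}) := by
  refine ⟨fun heven => ⟨?_, fun i hi => ?_⟩, fun hodd => ?_⟩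
  · refine exists_isSpinIso c (by simp) (by simp) ?_
    have h := truncation_bijective heven
    exact ⟨fun v w hvw => Subtype.ext (h.1 hvw), fun x =>
      let ⟨w, hw⟩ := h.2 x; ⟨⟨w, Submodule.mem_top⟩, hw⟩⟩
  · rw [twistorSpinors_eq hn hr (by simp) hi]
    simp
  · have hN : Even (n + 1) := hodd.add_one
    have hk : c.index ≤ n + 1 := by cases c <;> simp only [SpaceForm.index] <;> omega
    have hW : ∀ x y : Vec (n + 1), ∀ w ∈ halfSpinor (n + 1) c.index 1,
        cmul c.index x (cmul c.index y w) ∈ halfSpinor (n + 1) c.index 1 :=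
      fun x y w hw => cmul_cmul_mem_halfSpinor hN hk 1 x y hw
    refine ⟨exists_isSpinIso c hW ?_ (truncation_bijective_of_odd hodd ?_
      (mem_halfSpinor_iff hN hk 1)), fun i hi => ?_⟩
    -- A matrix that commutes with the chirality operator preserves its eigenspaces; injectivity
    -- gives the converse direction.
    · intro J hJ hJc w
      have hinj : Function.Injective J.mulVec := Matrix.mulVec_injective_of_isUnit hJ
      rw [mem_halfSpinor_iff hN hk, mem_halfSpinor_iff hN hk, Matrix.mulVec_mulVec, ← hJc hodd,
        ← Matrix.mulVec_mulVec, ← Matrix.mulVec_smul]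
      exact hinj.eq_iff
    · rw [one_mul, ← mul_pow]; simp
    · rw [twistorSpinors_eq hn hr hW hi]
      simp only [forall_cmul_mem_halfSpinor_iff hN hk (Nat.succ_pos n)]
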